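/- Let $d\ge 0$, let $U_s:\mathbb R^d\to\mathbb R$ (the surrogate potential) be twice continuously differentiable, let $U_t:\mathbb R^d\to\mathbb R$ (the target potential) be continuously differentiable, and put $U_d=U_t-U_s$. The bouncy Hamiltonian dynamics act on states $(x,v,p)\in\mathbb R^d\times\mathbb R^d\times[0,\infty)\subset\mathbb R^{2d+1}$ as follows. From $(x_0,v_0,p_0)$, position and velocity follow the surrogate dynamics $\dot x=v$, $\dot v=-\nabla U_s(x)$, and the inertia is $p_t=p_0+U_d(x_0)-U_d(x_t)$, until the first time $t^*>0$ with $U_d(x_{t^*})-U_d(x_0)=p_0$. At that time the inertia is $0$ and the velocity $v$ is replaced by its reflection $v-2\frac{v^{\top}\nabla U_d(x)}{\|\nabla U_d(x)\|^2}\nabla U_d(x)$ at $x=x_{t^*}$ (which requires $\nabla U_d(x_{t^*})\neq0$), and the procedure is repeated from the new state for the remaining time. For $T\ge0$ let $D_T$ be the set of states with $p\ge 0$ from which this procedure runs up to time $T$ with finitely many bounces, let $\Psi_T$ be the resulting time-$T$ map on $D_T$, and let $F(x,v,p)=(x,-v,p)$. Then the procedure is deterministic (it gives at most one state at time $T$),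 and there is a Lebesgue-null set $N\subset\mathbb R^{2d+1}$ such that for every initial state $z=(x,v,p)\notin N$ with $p\ge0$: 1. (existence) if $T\ge 0$ and $z\notin D_T$, then the position of the trajectory from $z$ is unbounded before time $T$; in particular, if $U_s(x)\ge -C(1+\|x\|^2)$ for some constant $C$ and all $x$, then $z\in D_T$ for all $T\ge0$; 2. (energy conservation) for every $T$ with $z\in D_T$, the inertia of $\Psi_T(z)$ is nonnegative, and the augmented energy $H(x,v,p)=U_t(x)+\|v\|^2/2+p$ takes the same value at $\Psi_T(z)$ as at $z$; hence $\min\{1,e^{-H(F\Psi_T(z))}/e^{-H(z)}\}=1$; 3. (time-reversibility) for every $T$ with $z\in D_T$, the inertia of the trajectory vanishes at only finitely many times in $[0,T]$, and if it is nonzero at time $T$, then the dynamics started at $F(\Psi_T(z))$ are at $F(z)$ after time $T$. Moreover, for every $T\ge0$: for almost every $z\in D_T$, $F\Psi_T(z)\in D_T$ and $F\Psi_T(F\Psi_T(z))=z$; $D_T$ is Lebesgue measurable (that is, it differs from a Borel set by a null set), $\Psi_T$ is almost everywhere measurable on $D_T$, and $\Psi_T$ preserves volume: it pushes Lebesgue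 measure on $D_T$ forward to Lebesgue measure on $F(D_T)$. Consequently $F\circ\Psi_T$ is a rejection-free Metropolis proposal for the measure $\pi$ with density $e^{-H}$ on $\{p\ge 0\}$: the acceptance probability is $1$ as in item 2, and detailed balance $\pi(D_T\cap A\cap(F\Psi_T)^{-1}B)=\pi(D_T\cap B\cap(F\Psi_T)^{-1}A)$ holds for all Borel sets $A,B$. -/

import Mathlib

open MeasureTheory Set

noncomputable section

/-- Position space (and velocity space) with its Euclidean structure. -/
abbrev Pos (d : ℕ) : Type := EuclideanSpace ℝ (Fin d)

/-- States `(x, v, p)`: position, velocity, inertia; a copy of `ℝ^(2d+1)` carrying Lebesgue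
measure. The state space of the dynamics is the part where `0 ≤ p`. -/
abbrev BState (d : ℕ) : Type := Pos d × Pos d × ℝ

/-- The discrepancy `U_d = U_t - U_s` of the target and the surrogate potential. -/
def potDiff {d : ℕ} (Us Ut : Pos d → ℝ) : Pos d → ℝ := fun x => Ut x - Us x

/-- The reflection of `v` against the vector `g` (meaningful for `g ≠ 0`). -/
def reflectAgainst {d : ℕ} (g v : Pos d) : Pos d :=
  v - (2 * (inner ℝ v g / ‖g‖ ^ 2)) • g

/-- `γ` solves the surrogate Hamiltonian equations `x' = v`, `v' = -∇U_s(x)` on `[0, T]`. -/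
def IsSurrogateSol {d : ℕ} (Us : Pos d → ℝ) (T : ℝ) (γ : ℝ → Pos d × Pos d) : Prop :=
  ∀ t ∈ Icc 0 T, HasDerivWithinAt γ ((γ t).2, -gradient Us (γ t).1) (Icc 0 T) t

/-- `BouncyRun Us Ut T z z'`: the bouncy Hamiltonian dynamics started at `z` are at `z'` after
time `T`, having undergone finitely many bounces.
* `flow`: the inertia does not run out during `(0, T]`; position and velocity follow the surrogate
  dynamics and the inertia becomes `p + U_d(x) - U_d(x_T)`.
* `bounce`: the first time `s > 0` at which the inertia runs out is at most `T` (the last premise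
  forces `0 ≤ T - s`); the velocity is reflected against `∇U_d`, which must not vanish there, the
  inertia is set to `0`, and the dynamics are run for the remaining time. -/
inductive BouncyRun {d : ℕ} (Us Ut : Pos d → ℝ) : ℝ → BState d → BState d → Prop
  | flow {T : ℝ} {x v : Pos d} {p : ℝ} (γ : ℝ → Pos d × Pos d)
      (nonneg : 0 ≤ T)
      (sol : IsSurrogateSol Us T γ)
      (init : γ 0 = (x, v))
      (no_hit : ∀ t ∈ Ioc 0 T, potDiff Us Ut (γ t).1 - potDiff Us Ut x ≠ p) :
      BouncyRun Us Ut T (x, v, p)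
        ((γ T).1, (γ T).2, p + potDiff Us Ut x - potDiff Us Ut (γ T).1)
  | bounce {T s : ℝ} {x v : Pos d} {p : ℝ} {z : BState d} (γ : ℝ → Pos d × Pos d)
      (pos : 0 < s)
      (sol : IsSurrogateSol Us s γ)
      (init : γ 0 = (x, v))
      (no_hit : ∀ t ∈ Ioo 0 s, potDiff Us Ut (γ t).1 - potDiff Us Ut x ≠ p)
      (hit : potDiff Us Ut (γ s).1 - potDiff Us Ut x = p)
      (grad_ne : gradient (potDiff Us Ut) (γ s).1 ≠ 0)
      (rest : BouncyRun Us Ut (T - s)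
        ((γ s).1, reflectAgainst (gradient (potDiff Us Ut) (γ s).1) (γ s).2, 0) z) :
      BouncyRun Us Ut T (x, v, p) z

/-- The states with `0 ≤ p` from which the bouncy dynamics exist up to time `T`. -/
def bouncyDomain {d : ℕ} (Us Ut : Pos d → ℝ) (T : ℝ) : Set (BState d) :=
  {z | 0 ≤ z.2.2 ∧ ∃ z', BouncyRun Us Ut T z z'}

open Classical in
/-- The time-`T` map of the bouncy dynamics; only its values on `bouncyDomain` matter. -/
def bouncyMap {d : ℕ} (Us Ut : Pos d → ℝ) (T : ℝ) (z : BState d) : BState d :=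
  if h : ∃ z', BouncyRun Us Ut T z z' then h.choose else z

/-- Velocity flip. -/
def flipVel {d : ℕ} (z : BState d) : BState d := (z.1, -z.2.1, z.2.2)

/-- The augmented energy `U_t(x) + ‖v‖² / 2 + p`. -/
def augEnergy {d : ℕ} (Ut : Pos d → ℝ) (z : BState d) : ℝ :=
  Ut z.1 + ‖z.2.1‖ ^ 2 / 2 + z.2.2

/-- The (unnormalized) target on `ℝ^d × ℝ^d × [0, ∞)`, with density `exp (-augEnergy)`. -/
def augTarget {d : ℕ} (Ut : Pos d → ℝ) : Measure (BState d) :=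
  (volume.restrict {z : BState d | 0 ≤ z.2.2}).withDensity
    (fun z => ENNReal.ofReal (Real.exp (-augEnergy Ut z)))

/-- The proposal: run the bouncy dynamics for time `T`, then flip the velocity. -/
def bouncyProposal {d : ℕ} (Us Ut : Pos d → ℝ) (T : ℝ) (z : BState d) : BState d :=
  flipVel (bouncyMap Us Ut T z)

end

/-! The quantity `c = p + U_d(x)` is conserved. In the coordinates `(x, v, c)`, reached by the
volume-preserving shear `toLevel`, the inertia disappears: at fixed `c` a phase point follows the
surrogate flow inside the sublevel set `U_d < c` and is reflected at its boundary, as in a billiard.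
Determinism is uniqueness for the surrogate ODE, and energy conservation is the conservation of `c`
and of `U_s + ‖v‖²/2`. The real content is that almost every trajectory makes only finitely many
bounces, all transversal, unless it escapes, and that volume is preserved.

Volume. Inside a ball the surrogate flow agrees with a global flow that preserves volume
(`exists_localFlow`, by Liouville's theorem). Time is cut into short steps of length `δ`. States
that bounce in a step are described by the hit point `y` and the hit time `τ`, and Lebesgue measure
then reads `⟪v, ∇U_d⟫ dy dτ` (`lintegral_hitDomain`). A step with one bounce, followed by the
velocity flip, is `(y, τ) ↦ (flipped reflection of y, δ - τ)` in these coordinates, which preserves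
that measure. So the preimage of a set under a step has at most the volume of the set
(`volume_stepDomain_inter_le`), and the same holds for iterated steps.

Existence. Let `ε` bound the oscillation of the rate `⟪v, ∇U_d⟫` along the flow over time `δ`. If
the inertia exceeds `2δε`, a first hit must happen at rate more than `ε`, and after the reflection
the rate stays negative for the rest of the step; so there is one bounce at most, and it is
transversal (`mem_stepDomain_or_exitsBy`). The exceptional states of one step have volume `O(δε)`.
Pulled back through the earlier steps and summed over `T/δ` steps, they have volume `O(Tε)`, which
tends to `0` (`exists_chain_approximation`). Hence `irregularSet` is null.

Conclusion. While the position is bounded, energy bounds the velocity, so only the position can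
escape; under the growth condition Gronwall's inequality forbids this. Transversal runs can be
traversed backwards (`GoodRun.reverse`), so the proposal is almost everywhere an involution.
Together with the one-sided volume estimate this yields exact volume preservation (`map_bouncyMap`),
and with energy conservation detailed balance. -/

section Flow

open Filter Function Topology
open scoped NNReal ENNReal

/-- `φ` is the global flow of the vector field `F`. -/
structure IsFlowOf {W : Type*} [NormedAddCommGroup W] [NormedSpace ℝ W]
    (F : W → W) (φ : ℝ → W → W) : Prop where
  zero : ∀ w, φ 0 w = w
  deriv : ∀ w t, HasDerivAt (fun s => φ s w) (F (φ t w)) t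

/-! ### Global flows of bounded Lipschitz vector fields -/

section General

variable {W : Type*} [NormedAddCommGroup W] [NormedSpace ℝ W] {F : W → W} {φ : ℝ → W → W}
  {K : ℝ≥0} {M : ℝ}

/-- A field bounded by `M` cannot move a solution further than `M * (n + 1)` in time `n + 1`. With
this radius the Picard–Lindelöf condition holds on the whole interval, however long. -/
theorem exists_solution_Ioo_of_bounded_lipschitz [CompleteSpace W] (hF : LipschitzWith K F)
    (hb : ∀ w, ‖F w‖ ≤ M) (w : W) (n : ℕ) :
    ∃ α : ℝ → W, α 0 = w ∧
      ∀ t ∈ Ioo (-(n + 1 : ℝ)) (n + 1), HasDerivAt α (F (α t)) t := by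
  lift M to ℝ≥0 using (norm_nonneg _).trans (hb w)
  have h0 : (0 : ℝ) ∈ Icc (-(n + 1 : ℝ)) (n + 1) := ⟨by linarith [n.cast_nonneg (α := ℝ)],
    by positivity⟩
  have hpl : IsPicardLindelof (fun _ => F) (⟨0, h0⟩ : Icc (-(n + 1 : ℝ)) (n + 1)) w
      (M * (n + 1)) 0 M K :=
    { lipschitzOnWith := fun _ _ => hF.lipschitzOnWith
      continuousOn := fun _ _ => continuousOn_const
      norm_le := fun _ _ x _ => hb x
      mul_max_le := by simp }
  obtain ⟨α, hα0, hα⟩ := hpl.exists_eq_forall_mem_Icc_hasDerivWithinAt₀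
  exact ⟨α, hα0, fun t ht => (hα t (Ioo_subset_Icc_self ht)).hasDerivAt (Icc_mem_nhds ht.1 ht.2)⟩

theorem exists_isFlowOf [CompleteSpace W] (hF : LipschitzWith K F) (hb : ∀ w, ‖F w‖ ≤ M) :
    ∃ φ, IsFlowOf F φ := by
  choose α hα0 hα using fun w n => exists_solution_Ioo_of_bounded_lipschitz hF hb w n
  have huniq : ∀ w m n, m ≤ n → EqOn (α w m) (α w n) (Ioo (-(m + 1 : ℝ)) (m + 1)) := by
    intro w m n hmn
    have hmn' : (m : ℝ) ≤ n := by exact_mod_cast hmn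
    refine ODE_solution_unique_of_mem_Ioo (v := fun _ => F) (s := fun _ => univ) (K := K) (t₀ := 0)
      (fun _ _ => hF.lipschitzOnWith) ⟨by linarith [m.cast_nonneg (α := ℝ)], by positivity⟩
      (fun t ht => ⟨hα w m t ht, trivial⟩)
      (fun t ht => ⟨hα w n t ⟨by linarith [ht.1], by linarith [ht.2]⟩, trivial⟩) ?_
    rw [hα0, hα0]
  -- The interval attached to `⌈|t|⌉₊` is open with half-length `⌈|t|⌉₊ + 1`, so it contains `t`.
  -- Near `t` all these choices agree with the single solution of index `⌈|t|⌉₊ + 1`.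
  refine ⟨fun t w => α w ⌈|t|⌉₊ t, fun w => by simp [hα0], fun w t => ?_⟩
  set n := ⌈|t|⌉₊ + 1 with hn
  have hle : ∀ s : ℝ, s ∈ Ioo (-(⌈|s|⌉₊ + 1 : ℝ)) (⌈|s|⌉₊ + 1) := by
    intro s
    have := abs_le.1 (Nat.le_ceil |s|)
    constructor <;> linarith
  have heq : ∀ s, |s| < |t| + 1 → α w ⌈|s|⌉₊ s = α w n s := by
    intro s hs
    refine huniq w _ _ ?_ (hle s)
    rw [hn, Nat.ceil_le]
    push_cast
    linarith [Nat.le_ceil |t|]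
  have ht : HasDerivAt (α w n) (F (α w n t)) t := by
    refine hα w n t ?_
    have := abs_le.1 (Nat.le_ceil |t|)
    rw [hn]
    push_cast
    constructor <;> linarith
  have hev : (fun s => α w ⌈|s|⌉₊ s) =ᶠ[𝓝 t] α w n := by
    have : ∀ᶠ s in 𝓝 t, |s| < |t| + 1 :=
      (continuous_abs.tendsto t).eventually (gt_mem_nhds (by linarith))
    exact this.mono heq
  have h2 := ht.congr_of_eventuallyEq hev
  rwa [← heq t (by linarith)] at h2

namespace IsFlowOf

theorem continuous_time (h : IsFlowOf F φ) (w : W) : Continuous fun t => φ t w :=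
  continuous_iff_continuousAt.2 fun t => (h.deriv w t).continuousAt

theorem eq_of_solution (h : IsFlowOf F φ) (hF : LipschitzWith K F) {γ : ℝ → W}
    (hγ : ∀ t, HasDerivAt γ (F (γ t)) t) (t : ℝ) : γ t = φ t (γ 0) := by
  have := ODE_solution_unique_univ (v := fun _ => F) (s := fun _ => univ) (K := K) (t₀ := 0)
    (fun _ => hF.lipschitzOnWith) (fun t => ⟨hγ t, trivial⟩)
    (fun t => ⟨h.deriv (γ 0) t, trivial⟩) (by simp [h.zero])
  exact congrFun this t

theorem add (h : IsFlowOf F φ) (hF : LipschitzWith K F) (s t : ℝ) (w : W) :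
    φ (s + t) w = φ s (φ t w) := by
  have := h.eq_of_solution hF (γ := fun s => φ (s + t) w)
    (fun s => (h.deriv w (s + t)).comp_add_const s t) s
  simpa using this

theorem neg (h : IsFlowOf F φ) : IsFlowOf (fun w => -F w) fun t => φ (-t) := by
  refine ⟨fun w => by simp [h.zero], fun w t => ?_⟩
  have := HasDerivAt.scomp t (h.deriv w (-t)) (hasDerivAt_neg t)
  simpa [Function.comp_def] using this

theorem norm_sub_le (h : IsFlowOf F φ) (hb : ∀ w, ‖F w‖ ≤ M) (w : W) (s t : ℝ) :
    ‖φ s w - φ t w‖ ≤ M * |s - t| := by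
  have := convex_univ.norm_image_sub_le_of_norm_hasDerivWithin_le (f := fun s => φ s w)
    (fun x _ => (h.deriv w x).hasDerivWithinAt) (fun x _ => hb _) (mem_univ t) (mem_univ s)
  simpa using this

theorem dist_le (h : IsFlowOf F φ) (hF : LipschitzWith K F) {t : ℝ} (ht : 0 ≤ t) (a b : W) :
    dist (φ t a) (φ t b) ≤ dist a b * Real.exp (K * t) := by
  have := dist_le_of_trajectories_ODE (v := fun _ => F) (K := K) (a := 0) (b := t)
    (f := fun s => φ s a) (g := fun s => φ s b) (δ := dist a b)
    (fun _ => hF) (h.continuous_time a).continuousOn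
    (fun s _ => (h.deriv a s).hasDerivWithinAt) (h.continuous_time b).continuousOn
    (fun s _ => (h.deriv b s).hasDerivWithinAt) (by simp [h.zero]) t ⟨ht, le_rfl⟩
  simpa using this

/-- The flow is Lipschitz in time uniformly in the starting point, so continuity of each `φ t`
suffices. For `t ≥ 0` that is Gronwall's inequality; for `t ≤ 0` it is the same for the field `-F`.
-/
theorem continuous_uncurry (h : IsFlowOf F φ) (hF : LipschitzWith K F) (hb : ∀ w, ‖F w‖ ≤ M) :
    Continuous (uncurry φ) := by
  have hspace : ∀ t, Continuous (φ t) := by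
    intro t
    rcases le_total 0 t with ht | ht
    · exact (LipschitzWith.of_dist_le_mul (K := (Real.exp (K * t)).toNNReal)
        fun a b => by
          rw [mul_comm, Real.coe_toNNReal _ (Real.exp_pos _).le]
          exact h.dist_le hF ht a b).continuous
    · have h2 := h.neg
      refine (LipschitzWith.of_dist_le_mul (K := (Real.exp (K * -t)).toNNReal)
        fun a b => ?_).continuous
      have := h2.dist_le (K := K) hF.neg (t := -t) (by linarith) a b
      rw [mul_comm, Real.coe_toNNReal _ (Real.exp_pos _).le]
      simpa using this
  rw [continuous_iff_continuousAt]
  rintro ⟨t₀, w₀⟩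
  have hM : 0 ≤ M := (norm_nonneg _).trans (hb w₀)
  rw [ContinuousAt, tendsto_iff_norm_sub_tendsto_zero]
  have hlim : Tendsto (fun p : ℝ × W => M * |p.1 - t₀| + ‖φ t₀ p.2 - φ t₀ w₀‖) (𝓝 (t₀, w₀))
      (𝓝 0) := by
    have hc : Continuous fun p : ℝ × W => M * |p.1 - t₀| + ‖φ t₀ p.2 - φ t₀ w₀‖ := by
      have := (hspace t₀).comp (continuous_snd (X := ℝ) (Y := W))
      have h2 : Continuous fun p : ℝ × W => φ t₀ p.2 := this
      fun_prop
    have := hc.tendsto (t₀, w₀)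
    simpa using this
  refine squeeze_zero (fun _ => norm_nonneg _) (fun p => ?_) hlim
  calc ‖uncurry φ p - uncurry φ (t₀, w₀)‖
      = ‖(φ p.1 p.2 - φ t₀ p.2) + (φ t₀ p.2 - φ t₀ w₀)‖ := by
        simp only [uncurry]; congr 1; abel
    _ ≤ _ := (norm_add_le _ _).trans (by gcongr; exact h.norm_sub_le hb _ _ _)

end IsFlowOf

end General

/-! ### Liouville's theorem by the symplectic Euler scheme -/

section Split

variable {E : Type*} [NormedAddCommGroup E] {f g : E → E} {K : ℝ≥0} {M : ℝ}

/-- The vector field of the system `x' = f v`, `v' = g x`. -/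
def splitField (f g : E → E) (w : E × E) : E × E := (f w.2, g w.1)

theorem splitField_lipschitz (hf : LipschitzWith K f) (hg : LipschitzWith K g) :
    LipschitzWith K (splitField f g) := by
  have h1 := hf.comp (LipschitzWith.prod_snd (α := E) (β := E))
  have h2 := hg.comp (LipschitzWith.prod_fst (α := E) (β := E))
  have := h1.prodMk h2
  simpa [splitField, Function.comp_def] using! this

theorem norm_splitField_le (bf : ∀ v, ‖f v‖ ≤ M) (bg : ∀ x, ‖g x‖ ≤ M) (w : E × E) :
    ‖splitField f g w‖ ≤ M :=
  max_le (bf _) (bg _)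

variable [NormedSpace ℝ E]

/-- One step of the symplectic Euler scheme for `x' = f v`, `v' = g x`. -/
noncomputable def symplecticEuler (f g : E → E) (h : ℝ) (w : E × E) : E × E :=
  (w.1 + h • f w.2, w.2 + h • g (w.1 + h • f w.2))

/-- In time `h` the flow moves by at most `M * h`, so freezing a `K`-Lipschitz field costs `K * M *
h` in velocity and `K * M * h ^ 2` in position. The factor `2` comes from `g` being evaluated at the
already updated position. No derivative of the field is needed. -/
theorem norm_symplecticEuler_sub_le {φ : ℝ → E × E → E × E} (hφ : IsFlowOf (splitField f g) φ)
    (hf : LipschitzWith K f) (hg : LipschitzWith K g)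
    (bf : ∀ v, ‖f v‖ ≤ M) (bg : ∀ x, ‖g x‖ ≤ M) {h : ℝ} (hh : 0 ≤ h) (w : E × E) :
    ‖symplecticEuler f g h w - φ h w‖ ≤ 2 * K * M * h ^ 2 := by
  have hM : 0 ≤ M := (norm_nonneg _).trans (bf 0)
  have hmove : ∀ s ∈ Ico (0 : ℝ) h, ‖φ s w - w‖ ≤ M * h := by
    intro s hs
    have := hφ.norm_sub_le (norm_splitField_le bf bg) w s 0
    rw [hφ.zero, sub_zero, abs_of_nonneg hs.1] at this
    exact this.trans (by gcongr; exact hs.2.le)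
  have hfst : ∀ t, HasDerivAt (fun s => (φ s w).1) (f (φ t w).2) t := fun t =>
    HasFDerivAt.comp_hasDerivAt (f := fun s => φ s w) t (hasFDerivAt_fst (𝕜 := ℝ)) (hφ.deriv w t)
  have hsnd : ∀ t, HasDerivAt (fun s => (φ s w).2) (g (φ t w).1) t := fun t =>
    HasFDerivAt.comp_hasDerivAt (f := fun s => φ s w) t (hasFDerivAt_snd (𝕜 := ℝ)) (hφ.deriv w t)
  have hlin : ∀ (a : E) (t : ℝ), HasDerivAt (fun s : ℝ => s • a) a t := fun a t => by
    simpa using (hasDerivAt_id t).smul_const a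
  have h1 := norm_image_sub_le_of_norm_deriv_le_segment' (a := 0) (b := h)
    (f := fun s => (φ s w).1 - s • f w.2) (C := K * (M * h))
    (fun s _ => ((hfst s).sub (hlin _ s)).hasDerivWithinAt) (fun s hs => by
      refine (hf.norm_sub_le _ _).trans ?_
      gcongr
      exact (norm_snd_le (φ s w - w)).trans (hmove s hs)) h ⟨hh, le_rfl⟩
  have h2 := norm_image_sub_le_of_norm_deriv_le_segment' (a := 0) (b := h)
    (f := fun s => (φ s w).2 - s • g (w.1 + h • f w.2)) (C := K * (M * h + h * M))
    (fun s _ => ((hsnd s).sub (hlin _ s)).hasDerivWithinAt) (fun s hs => by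
      refine (hg.norm_sub_le _ _).trans ?_
      gcongr
      rw [← sub_sub]
      refine (norm_sub_le _ _).trans (add_le_add ?_ ?_)
      · exact (norm_fst_le (φ s w - w)).trans (hmove s hs)
      · rw [norm_smul, Real.norm_of_nonneg hh]
        gcongr
        exact bf _) h ⟨hh, le_rfl⟩
  simp only [hφ.zero, zero_smul, sub_zero] at h1 h2
  refine max_le ?_ ?_
  · have e : (symplecticEuler f g h w - φ h w).1 = -((φ h w).1 - h • f w.2 - w.1) := by
      simp only [symplecticEuler, Prod.fst_sub]; abel
    rw [e, norm_neg]
    refine h1.trans ?_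
    have : 0 ≤ K * M * h ^ 2 := by positivity
    nlinarith
  · have e : (symplecticEuler f g h w - φ h w).2
        = -((φ h w).2 - h • g (w.1 + h • f w.2) - w.2) := by
      simp only [symplecticEuler, Prod.snd_sub]; abel
    rw [e, norm_neg]
    refine h2.trans (le_of_eq ?_)
    ring

/-- The local errors add up, each amplified by the flow by at most the Gronwall factor. -/
theorem norm_iterate_symplecticEuler_sub_le {φ : ℝ → E × E → E × E}
    (hφ : IsFlowOf (splitField f g) φ) (hf : LipschitzWith K f) (hg : LipschitzWith K g)
    (bf : ∀ v, ‖f v‖ ≤ M) (bg : ∀ x, ‖g x‖ ≤ M) {h : ℝ} (hh : 0 ≤ h) (w : E × E) (n : ℕ) :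
    ‖(symplecticEuler f g h)^[n] w - φ (n * h) w‖
      ≤ n * (2 * K * M * h ^ 2) * Real.exp (K * (n * h)) := by
  have hM : 0 ≤ M := (norm_nonneg _).trans (bf 0)
  have hF := splitField_lipschitz hf hg
  induction n with
  | zero => simp [hφ.zero]
  | succ n ih =>
    rw [iterate_succ_apply']
    set u := (symplecticEuler f g h)^[n] w
    have e1 : φ ((n + 1 : ℕ) * h) w = φ h (φ (n * h) w) := by
      rw [← hφ.add hF]; congr 1; push_cast; ring
    have e2 := hφ.dist_le hF hh u (φ (n * h) w)
    rw [dist_eq_norm, dist_eq_norm] at e2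
    have e3 := norm_symplecticEuler_sub_le hφ hf hg bf bg hh u
    have hexp : Real.exp (K * ((n + 1 : ℕ) * h)) = Real.exp (K * (n * h)) * Real.exp (K * h) := by
      rw [← Real.exp_add]; congr 1; push_cast; ring
    have hone : 1 ≤ Real.exp (K * ((n + 1 : ℕ) * h)) := Real.one_le_exp (by positivity)
    have hC : 0 ≤ 2 * K * M * h ^ 2 := by positivity
    calc ‖symplecticEuler f g h u - φ ((n + 1 : ℕ) * h) w‖
        = ‖(symplecticEuler f g h u - φ h u) + (φ h u - φ h (φ (n * h) w))‖ := by
          rw [e1]; congr 1; abel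
      _ ≤ 2 * K * M * h ^ 2 + ‖u - φ (n * h) w‖ * Real.exp (K * h) :=
          (norm_add_le _ _).trans (add_le_add e3 e2)
      _ ≤ 2 * K * M * h ^ 2 * Real.exp (K * ((n + 1 : ℕ) * h)) +
          (n * (2 * K * M * h ^ 2) * Real.exp (K * (n * h))) * Real.exp (K * h) := by
          exact add_le_add (le_mul_of_one_le_right hC hone) (by gcongr)
      _ = _ := by rw [hexp]; push_cast; ring

theorem tendsto_iterate_symplecticEuler {φ : ℝ → E × E → E × E}
    (hφ : IsFlowOf (splitField f g) φ) (hf : LipschitzWith K f) (hg : LipschitzWith K g)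
    (bf : ∀ v, ‖f v‖ ≤ M) (bg : ∀ x, ‖g x‖ ≤ M) {t : ℝ} (ht : 0 ≤ t) (w : E × E) :
    Tendsto (fun n : ℕ => (symplecticEuler f g (t / (n + 1 : ℕ)))^[n + 1] w) atTop
      (𝓝 (φ t w)) := by
  rw [tendsto_iff_norm_sub_tendsto_zero]
  have hlim : Tendsto (fun n : ℕ => (2 * K * M * t ^ 2 * Real.exp (K * t)) * (1 / ((n : ℝ) + 1)))
      atTop (𝓝 0) := by
    simpa only [mul_zero] using (tendsto_one_div_add_atTop_nhds_zero_nat (𝕜 := ℝ)).const_mul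
      (2 * K * M * t ^ 2 * Real.exp (K * t))
  refine squeeze_zero (fun _ => norm_nonneg _) (fun n => ?_) hlim
  have := norm_iterate_symplecticEuler_sub_le hφ hf hg bf bg (h := t / (n + 1 : ℕ))
    (by positivity) w (n + 1)
  have hn : ((n + 1 : ℕ) : ℝ) ≠ 0 := by positivity
  rw [mul_div_cancel₀ _ hn] at this
  refine this.trans (le_of_eq ?_)
  push_cast
  field_simp

variable [MeasureSpace E] [BorelSpace E] [FiniteDimensional ℝ E]
  [(volume : Measure E).IsAddHaarMeasure]

/-- Each half of the step is a shear, translating one component by a function of the other. -/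
theorem measurePreserving_symplecticEuler (hf : Measurable f) (hg : Measurable g) (h : ℝ) :
    MeasurePreserving (symplecticEuler f g h) := by
  have shear : ∀ {k : E → E}, Measurable k →
      MeasurePreserving fun w : E × E => (w.1, w.2 + h • k w.1) := by
    intro k hk
    refine MeasurePreserving.skew_product (f := id) (g := fun x v => v + h • k x)
      (MeasurePreserving.id _) ?_ (ae_of_all _ fun x => (measurePreserving_add_right _ _).map_eq)
    simp only [uncurry_def]
    exact measurable_snd.add ((hk.comp measurable_fst).const_smul h)
  have hswap : MeasurePreserving (Prod.swap : E × E → E × E) := Measure.measurePreserving_swap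
  exact (shear hg).comp (hswap.comp ((shear hf).comp hswap))

/-- Outer regularity reduces to open `U`. By convergence of the scheme, a point of `φ t ⁻¹' U` is
eventually in the preimages of `U` under the Euler iterates, all of volume `volume U`; Fatou's lemma
concludes. The reverse inequality follows later by applying this to time `-t`. -/
theorem IsFlowOf.volume_preimage_le {φ : ℝ → E × E → E × E}
    (hφ : IsFlowOf (splitField f g) φ) (hf : LipschitzWith K f) (hg : LipschitzWith K g)
    (bf : ∀ v, ‖f v‖ ≤ M) (bg : ∀ x, ‖g x‖ ≤ M) {t : ℝ} (ht : 0 ≤ t) (A : Set (E × E)) :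
    volume (φ t ⁻¹' A) ≤ volume A := by
  rw [A.measure_eq_iInf_isOpen]
  refine le_iInf fun U => le_iInf fun hAU => le_iInf fun hU => ?_
  refine (measure_mono (preimage_mono hAU)).trans ?_
  have hmp : ∀ n : ℕ, MeasurePreserving ((symplecticEuler f g (t / (n + 1 : ℕ)))^[n + 1]) :=
    fun n => (measurePreserving_symplecticEuler hf.continuous.measurable
      hg.continuous.measurable _).iterate _
  set S : ℕ → Set (E × E) := fun n => (symplecticEuler f g (t / (n + 1 : ℕ)))^[n + 1] ⁻¹' U
  have hS : ∀ n, MeasurableSet (S n) := fun n => (hmp n).measurable hU.measurableSet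
  have hcont : Continuous (φ t) :=
    (hφ.continuous_uncurry (splitField_lipschitz hf hg) (norm_splitField_le bf bg)).comp
      (Continuous.prodMk_right t)
  calc volume (φ t ⁻¹' U)
      = ∫⁻ w, (φ t ⁻¹' U).indicator 1 w :=
        (lintegral_indicator_one (hU.preimage hcont).measurableSet).symm
    _ ≤ ∫⁻ w, liminf (fun n => (S n).indicator (1 : E × E → ℝ≥0∞) w) atTop := by
        refine lintegral_mono fun w => ?_
        by_cases hw : w ∈ φ t ⁻¹' U
        · have hev : ∀ᶠ n in atTop, w ∈ S n :=
            (tendsto_iterate_symplecticEuler hφ hf hg bf bg ht w).eventually (hU.mem_nhds hw)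
          refine le_liminf_of_le (by isBoundedDefault) ?_
          filter_upwards [hev] with n hn
          simp [hw, hn]
        · simp [hw]
    _ ≤ liminf (fun n => ∫⁻ w, (S n).indicator (1 : E × E → ℝ≥0∞) w) atTop :=
        lintegral_liminf_le fun n => measurable_one.indicator (hS n)
    _ = volume U := by
        simp only [lintegral_indicator_one (hS _)]
        simp only [S, (hmp _).measure_preimage hU.measurableSet.nullMeasurableSet]
        simp

/-- **Liouville's theorem** for separable Hamiltonian-like systems. -/
theorem IsFlowOf.measurePreserving {φ : ℝ → E × E → E × E}
    (hφ : IsFlowOf (splitField f g) φ) (hf : LipschitzWith K f) (hg : LipschitzWith K g)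
    (bf : ∀ v, ‖f v‖ ≤ M) (bg : ∀ x, ‖g x‖ ≤ M) (t : ℝ) :
    MeasurePreserving (φ t) := by
  have hF := splitField_lipschitz hf hg
  have hcont : ∀ t, Continuous (φ t) := fun t =>
    (hφ.continuous_uncurry hF (norm_splitField_le bf bg)).comp (Continuous.prodMk_right t)
  have hle : ∀ (t : ℝ) (A : Set (E × E)), volume (φ t ⁻¹' A) ≤ volume A := by
    intro t A
    rcases le_total 0 t with ht | ht
    · exact hφ.volume_preimage_le hf hg bf bg ht A
    · have hneg : IsFlowOf (splitField (fun v => -f v) (fun x => -g x)) fun t => φ (-t) := hφ.neg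
      have := hneg.volume_preimage_le (K := K) (M := M) hf.neg hg.neg (by simpa using bf)
        (by simpa using bg) (t := -t) (by linarith) A
      simpa using this
  refine ⟨(hcont t).measurable, Measure.ext fun A hA => ?_⟩
  rw [Measure.map_apply (hcont t).measurable hA]
  refine le_antisymm (hle t A) ?_
  calc volume A = volume (φ (-t) ⁻¹' (φ t ⁻¹' A)) := by
        congr 1; ext w
        simp [← hφ.add hF, hφ.zero]
    _ ≤ _ := hle _ _

end Split

end Flow

/-! ### A global flow that agrees with the surrogate dynamics on a ball -/

section Clamped

open Filter Function Topology
open scoped NNReal ENNReal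

/-- Coordinatewise truncation to `[-R, R]`. -/
noncomputable def clampPos {d : ℕ} (R : ℝ) (x : Pos d) : Pos d :=
  WithLp.toLp 2 fun i => max (-R) (min R (x i))

theorem clampPos_lipschitz {d : ℕ} (R : ℝ) : LipschitzWith 1 (clampPos R : Pos d → Pos d) := by
  refine LipschitzWith.of_dist_le_mul fun x y => ?_
  rw [NNReal.coe_one, one_mul, EuclideanSpace.dist_eq, EuclideanSpace.dist_eq]
  refine Real.sqrt_le_sqrt (Finset.sum_le_sum fun i _ => ?_)
  simp only [clampPos, Real.dist_eq]
  refine pow_le_pow_left₀ (abs_nonneg _) ?_ 2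
  exact (abs_max_sub_max_le_abs _ _ (-R)).trans' (by rw [max_comm (-R), max_comm (-R)]) |>.trans
    (abs_min_sub_min_le_max _ _ _ _ |>.trans (by simp))

/-- Oddness is what keeps the truncated dynamics reversible under the velocity flip. -/
theorem clampPos_neg {d : ℕ} {R : ℝ} (hR : 0 ≤ R) (x : Pos d) :
    clampPos R (-x) = -clampPos R x := by
  ext i
  simp only [clampPos, PiLp.neg_apply]
  rcases le_total R (x i) with h | h <;> rcases le_total (-R) (x i) with h' | h' <;>
    simp [max_def, min_def] <;> split_ifs <;> linarith

theorem clampPos_of_norm_le {d : ℕ} {R : ℝ} {x : Pos d} (hx : ‖x‖ ≤ R) : clampPos R x = x := by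
  ext i
  have := abs_le.1 ((PiLp.norm_apply_le x i).trans hx)
  simp [clampPos, this.1, this.2]

theorem norm_clampPos_le {d : ℕ} {R : ℝ} (hR : 0 ≤ R) (x : Pos d) :
    ‖clampPos R x‖ ≤ Real.sqrt (d * R ^ 2) := by
  rw [EuclideanSpace.norm_eq]
  refine Real.sqrt_le_sqrt ?_
  have : ∀ i ∈ Finset.univ, ‖clampPos R x i‖ ^ 2 ≤ R ^ 2 := by
    intro i _
    refine pow_le_pow_left₀ (norm_nonneg _) ?_ 2
    rw [Real.norm_eq_abs, abs_le]
    simp only [clampPos]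
    exact ⟨le_max_left _ _, max_le (by linarith) (min_le_left _ _)⟩
  simpa using Finset.sum_le_sum this

theorem continuous_gradient {d : ℕ} {U : Pos d → ℝ} (hU : ContDiff ℝ 1 U) :
    Continuous (gradient U) :=
  (InnerProductSpace.toDual ℝ (Pos d)).symm.continuous.comp (hU.continuous_fderiv one_ne_zero)

theorem contDiff_gradient {d : ℕ} {U : Pos d → ℝ} (hU : ContDiff ℝ 2 U) :
    ContDiff ℝ 1 (gradient U) :=
  (InnerProductSpace.toDual ℝ (Pos d)).symm.contDiff.comp (hU.fderiv_right (m := 1) (by norm_num))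

theorem exists_lipschitzOnWith_gradient {d : ℕ} {U : Pos d → ℝ} (hU : ContDiff ℝ 2 U) (B : ℝ) :
    ∃ K : ℝ≥0, LipschitzOnWith K (gradient U) (Metric.closedBall 0 B) :=
  LocallyLipschitzOn.exists_lipschitzOnWith_of_compact (isCompact_closedBall _ _)
    (contDiff_gradient hU).locallyLipschitz.locallyLipschitzOn

/-- Flip of the velocity component of a phase point. -/
def phaseFlip {d : ℕ} (w : Pos d × Pos d) : Pos d × Pos d := (w.1, -w.2)

@[simp] theorem phaseFlip_fst {d : ℕ} (w : Pos d × Pos d) : (phaseFlip w).1 = w.1 := rfl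
@[simp] theorem phaseFlip_snd {d : ℕ} (w : Pos d × Pos d) : (phaseFlip w).2 = -w.2 := rfl
@[simp] theorem phaseFlip_phaseFlip {d : ℕ} (w : Pos d × Pos d) :
    phaseFlip (phaseFlip w) = w := by simp [phaseFlip]

theorem continuous_phaseFlip {d : ℕ} : Continuous (phaseFlip : Pos d × Pos d → _) := by
  unfold phaseFlip; fun_prop

/-- A global, volume preserving, time reversible flow that agrees with the surrogate Hamiltonian
dynamics as long as position and velocity have norm at most `R`. -/
structure LocalFlow {d : ℕ} (Us : Pos d → ℝ) (R : ℝ)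
    (φ : ℝ → Pos d × Pos d → Pos d × Pos d) : Prop where
  zero : ∀ w, φ 0 w = w
  add : ∀ s t w, φ (s + t) w = φ s (φ t w)
  cont : Continuous (uncurry φ)
  rev : ∀ t w, φ t (phaseFlip w) = phaseFlip (φ (-t) w)
  mp : ∀ t, MeasurePreserving (φ t)
  lip : ∃ L, ∀ w s t, ‖φ s w - φ t w‖ ≤ L * |s - t|
  deriv : ∀ w t, ‖(φ t w).1‖ ≤ R → ‖(φ t w).2‖ ≤ R →
    HasDerivAt (fun s => φ s w) ((φ t w).2, -gradient Us (φ t w).1) t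

/-- Clamp both arguments: `x' = clampPos R v`, `v' = -∇U_s(clampPos R x)`. The field is bounded and
Lipschitz because the clamp has bounded range, on which the `C¹` gradient is Lipschitz; it is still
separable, so Liouville's theorem applies. Reversibility holds because the flipped, time-reversed
curve solves the same equation. -/
theorem exists_localFlow {d : ℕ} {Us : Pos d → ℝ} (hUs : ContDiff ℝ 2 Us) {R : ℝ} (hR : 0 ≤ R) :
    ∃ φ, LocalFlow Us R φ := by
  set f : Pos d → Pos d := clampPos R with hf_def
  set g : Pos d → Pos d := fun x => -gradient Us (clampPos R x) with hg_def
  obtain ⟨K, hK⟩ := exists_lipschitzOnWith_gradient hUs (Real.sqrt (d * R ^ 2))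
  have hf : LipschitzWith (max 1 K) f := (clampPos_lipschitz R).weaken (le_max_left _ _)
  have hg : LipschitzWith (max 1 K) g := by
    have h1 : LipschitzWith (K * 1) fun x => gradient Us (clampPos R x) := by
      refine lipschitzOnWith_univ.1 (hK.comp (clampPos_lipschitz R).lipschitzOnWith ?_)
      exact fun x _ => by simpa using norm_clampPos_le hR x
    rw [mul_one] at h1
    exact (h1.weaken (le_max_right _ _)).neg
  obtain ⟨C, hC⟩ := (isCompact_closedBall (0 : Pos d) (Real.sqrt (d * R ^ 2))).exists_bound_of_continuousOn
    (continuous_gradient (hUs.of_le one_le_two)).continuousOn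
  set M := max (Real.sqrt (d * R ^ 2)) C
  have bf : ∀ v, ‖f v‖ ≤ M := fun v => (norm_clampPos_le hR v).trans (le_max_left _ _)
  have bg : ∀ x, ‖g x‖ ≤ M := fun x => by
    rw [hg_def, norm_neg]
    exact (hC _ (by simpa using norm_clampPos_le hR x)).trans (le_max_right _ _)
  have hF := splitField_lipschitz hf hg
  have hb := norm_splitField_le bf bg
  obtain ⟨φ, hφ⟩ := exists_isFlowOf hF hb
  refine ⟨φ, hφ.zero, hφ.add hF, hφ.continuous_uncurry hF hb, fun t w => ?_,
    hφ.measurePreserving hf hg bf bg, ⟨M, hφ.norm_sub_le hb⟩, fun w t h1 h2 => ?_⟩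
  · have hsol : ∀ t, HasDerivAt (fun t => phaseFlip (φ (-t) w))
        (splitField f g (phaseFlip (φ (-t) w))) t := by
      intro t
      have h := hφ.neg.deriv w t
      have h1 : HasDerivAt (fun s => (φ (-s) w).1) (-f (φ (-t) w).2) t :=
        HasFDerivAt.comp_hasDerivAt (f := fun s => φ (-s) w) t (hasFDerivAt_fst (𝕜 := ℝ)) h
      have h2 : HasDerivAt (fun s => (φ (-s) w).2) (-g (φ (-t) w).1) t :=
        HasFDerivAt.comp_hasDerivAt (f := fun s => φ (-s) w) t (hasFDerivAt_snd (𝕜 := ℝ)) h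
      have h3 := h1.prodMk h2.neg
      simpa [splitField, phaseFlip, hf_def, clampPos_neg hR] using! h3
    have := hφ.eq_of_solution hF hsol t
    simpa [hφ.zero] using this.symm
  · have := hφ.deriv w t
    simpa [splitField, hf_def, hg_def, clampPos_of_norm_le h1, clampPos_of_norm_le h2] using this

end Clamped

/-! ### Determinism, conservation laws and reversal of runs -/

section Dynamics

open Filter Function Topology
open scoped NNReal ENNReal RealInnerProductSpace

variable {d : ℕ} {Us Ut : Pos d → ℝ}

theorem contDiff_potDiff (hUs : ContDiff ℝ 2 Us) (hUt : ContDiff ℝ 1 Ut) :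
    ContDiff ℝ 1 (potDiff Us Ut) :=
  hUt.sub (hUs.of_le one_le_two)

theorem inner_reflectAgainst (g v : Pos d) : ⟪reflectAgainst g v, g⟫ = -⟪v, g⟫ := by
  rcases eq_or_ne g 0 with rfl | hg
  · simp
  · have : ‖g‖ ^ 2 ≠ 0 := by positivity
    rw [reflectAgainst, inner_sub_left, inner_smul_left, real_inner_self_eq_norm_sq]
    simp only [conj_trivial]
    field_simp
    ring

theorem reflectAgainst_reflectAgainst (g v : Pos d) :
    reflectAgainst g (reflectAgainst g v) = v := by
  conv_lhs => rw [reflectAgainst, inner_reflectAgainst]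
  rw [reflectAgainst]
  module

theorem reflectAgainst_neg (g v : Pos d) : reflectAgainst g (-v) = -reflectAgainst g v := by
  simp only [reflectAgainst, inner_neg_left]
  module

theorem norm_reflectAgainst (g v : Pos d) : ‖reflectAgainst g v‖ = ‖v‖ := by
  rcases eq_or_ne g 0 with rfl | hg
  · simp [reflectAgainst]
  · have hg2 : ‖g‖ ^ 2 ≠ 0 := by positivity
    have : ‖reflectAgainst g v‖ ^ 2 = ‖v‖ ^ 2 := by
      rw [reflectAgainst, @norm_sub_sq_real, inner_smul_right, norm_smul, mul_pow,
        Real.norm_eq_abs, sq_abs]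
      field_simp
      ring
    exact (pow_left_inj₀ (norm_nonneg _) (norm_nonneg _) two_ne_zero).1 this

theorem hasDerivWithinAt_potential_comp_fst {γ : ℝ → Pos d × Pos d}
    {U : Pos d → ℝ} (hU : ContDiff ℝ 1 U) {t : ℝ} {s : Set ℝ} {γ' : Pos d × Pos d}
    (hγ : HasDerivWithinAt γ γ' s t) :
    HasDerivWithinAt (fun r => U (γ r).1) ⟪γ'.1, gradient U (γ t).1⟫ s t := by
  have h1 : HasDerivWithinAt (fun r => (γ r).1) γ'.1 s t :=
    HasFDerivAt.comp_hasDerivWithinAt (f := γ) t (hasFDerivAt_fst (𝕜 := ℝ)) hγ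
  have h2 := ((hU.differentiable one_ne_zero) (γ t).1).hasFDerivAt.comp_hasDerivWithinAt t h1
  rwa [← inner_gradient_left, real_inner_comm] at h2

namespace IsSurrogateSol

theorem mono {S T : ℝ} {γ : ℝ → Pos d × Pos d} (h : IsSurrogateSol Us T γ) (hST : S ≤ T) :
    IsSurrogateSol Us S γ := fun t ht =>
  (h t ⟨ht.1, ht.2.trans hST⟩).mono (Icc_subset_Icc_right hST)

theorem continuousOn {T : ℝ} {γ : ℝ → Pos d × Pos d} (h : IsSurrogateSol Us T γ) :
    ContinuousOn γ (Icc 0 T) := fun t ht => (h t ht).continuousWithinAt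

theorem hasDerivWithinAt_Ici {T : ℝ} {γ : ℝ → Pos d × Pos d} (h : IsSurrogateSol Us T γ)
    {t : ℝ} (ht : t ∈ Ico 0 T) :
    HasDerivWithinAt γ ((γ t).2, -gradient Us (γ t).1) (Ici t) t :=
  (h t (Ico_subset_Icc_self ht)).mono_of_mem_nhdsWithin (Icc_mem_nhdsGE_of_mem ht)

theorem exists_bound {T : ℝ} {γ : ℝ → Pos d × Pos d} (h : IsSurrogateSol Us T γ) :
    ∃ B, ∀ t ∈ Icc 0 T, ‖γ t‖ ≤ B :=
  isCompact_Icc.exists_bound_of_continuousOn h.continuousOn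

/-- On a compact interval both solutions stay in a common ball, where the field is Lipschitz,
although it need not be so globally. -/
theorem eqOn (hUs : ContDiff ℝ 2 Us) {T : ℝ} {γ₁ γ₂ : ℝ → Pos d × Pos d}
    (h₁ : IsSurrogateSol Us T γ₁) (h₂ : IsSurrogateSol Us T γ₂) (h0 : γ₁ 0 = γ₂ 0) :
    EqOn γ₁ γ₂ (Icc 0 T) := by
  obtain ⟨B₁, hB₁⟩ := h₁.exists_bound
  obtain ⟨B₂, hB₂⟩ := h₂.exists_bound
  obtain ⟨K, hK⟩ := exists_lipschitzOnWith_gradient hUs (max B₁ B₂)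
  set s : Set (Pos d × Pos d) := Metric.closedBall 0 (max B₁ B₂)
  have hlip : LipschitzOnWith (max (1 * 1) (K * 1))
      (fun w : Pos d × Pos d => (w.2, -gradient Us w.1)) s := by
    have a1 : LipschitzOnWith (1 * 1) (fun w : Pos d × Pos d => w.2) s :=
      (by simpa using LipschitzWith.prod_snd : LipschitzWith (1 * 1) _).lipschitzOnWith
    have a2 : LipschitzOnWith (K * 1) (fun w : Pos d × Pos d => gradient Us w.1) s := by
      refine hK.comp LipschitzWith.prod_fst.lipschitzOnWith fun w hw => ?_
      rw [mem_closedBall_zero_iff] at hw ⊢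
      exact (norm_fst_le w).trans hw
    have a3 : LipschitzOnWith (K * 1) (fun w : Pos d × Pos d => -gradient Us w.1) s :=
      fun x hx y hy => by simpa [edist_neg_neg] using a2 hx hy
    exact a1.prodMk a3
  refine ODE_solution_unique_of_mem_Icc_right (v := fun _ w => (w.2, -gradient Us w.1))
    (s := fun _ => s) (fun _ _ => hlip) h₁.continuousOn (fun t ht => h₁.hasDerivWithinAt_Ici ht)
    (fun t ht => ?_) h₂.continuousOn (fun t ht => h₂.hasDerivWithinAt_Ici ht) (fun t ht => ?_) h0
  · exact mem_closedBall_zero_iff.2 ((hB₁ t (Ico_subset_Icc_self ht)).trans (le_max_left _ _))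
  · exact mem_closedBall_zero_iff.2 ((hB₂ t (Ico_subset_Icc_self ht)).trans (le_max_right _ _))

theorem energy_eq (hUs : ContDiff ℝ 2 Us) {T : ℝ} {γ : ℝ → Pos d × Pos d}
    (h : IsSurrogateSol Us T γ) {t : ℝ} (ht : t ∈ Icc 0 T) :
    Us (γ t).1 + ‖(γ t).2‖ ^ 2 / 2 = Us (γ 0).1 + ‖(γ 0).2‖ ^ 2 / 2 := by
  have hc : ContinuousOn (fun t => Us (γ t).1 + ‖(γ t).2‖ ^ 2 / 2) (Icc 0 T) := by
    have h1 := h.continuousOn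
    have h2 := hUs.continuous.comp_continuousOn (continuous_fst.comp_continuousOn h1)
    have h3 := (continuous_snd.comp_continuousOn h1).norm
    exact h2.add ((h3.pow 2).div_const 2)
  refine constant_of_has_deriv_right_zero hc (fun s hs => ?_) t ht
  have hd := h.hasDerivWithinAt_Ici hs
  have h1 := hasDerivWithinAt_potential_comp_fst (hUs.of_le one_le_two) hd
  have h2 : HasDerivWithinAt (fun r => (γ r).2) (-gradient Us (γ s).1) (Ici s) s :=
    HasFDerivAt.comp_hasDerivWithinAt (f := γ) s (hasFDerivAt_snd (𝕜 := ℝ)) hd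
  have h3 := h1.add (h2.norm_sq.div_const 2)
  refine h3.congr_deriv ?_
  simp only [inner_neg_right]
  ring

theorem glue {S T : ℝ} (hS : 0 ≤ S) (hT : 0 ≤ T) {γ₁ γ₂ : ℝ → Pos d × Pos d}
    (h₁ : IsSurrogateSol Us S γ₁) (h₂ : IsSurrogateSol Us T γ₂) (h0 : γ₂ 0 = γ₁ S) :
    ∃ γ, IsSurrogateSol Us (S + T) γ ∧ (∀ t ∈ Icc 0 S, γ t = γ₁ t) ∧
      ∀ t ∈ Icc 0 T, γ (S + t) = γ₂ t := by
  set γ : ℝ → Pos d × Pos d := fun t => if t ≤ S then γ₁ t else γ₂ (t - S) with hγ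
  have e1 : ∀ t ≤ S, γ t = γ₁ t := fun t ht => by simp [hγ, ht]
  have e2 : ∀ t, S ≤ t → γ t = γ₂ (t - S) := fun t ht => by
    rcases ht.eq_or_lt with rfl | h
    · simp [hγ, h0]
    · simp [hγ, h]
  refine ⟨γ, fun t ht => ?_, fun t ht => e1 t ht.2, fun t ht => ?_⟩
  · have hU : Icc 0 (S + T) = Icc 0 S ∪ Icc S (S + T) := (Icc_union_Icc_eq_Icc hS (by linarith)).symm
    rw [hU]
    refine HasDerivWithinAt.union ?_ ?_
    · by_cases hts : t ≤ S
      · rw [e1 t hts]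
        exact (h₁ t ⟨ht.1, hts⟩).congr (fun r hr => e1 r hr.2) (e1 t hts)
      · refine HasFDerivWithinAt.of_notMem_closure ?_
        rw [closure_Icc]
        exact fun h => hts h.2
    · by_cases hts : S ≤ t
      · rw [e2 t hts]
        have h3 : HasDerivWithinAt (fun r => γ₂ (r - S))
            ((γ₂ (t - S)).2, -gradient Us (γ₂ (t - S)).1) (Icc S (S + T)) t := by
          have := HasDerivWithinAt.scomp (t' := Icc 0 T) t
            (h₂ (t - S) ⟨by linarith, by linarith [ht.2]⟩)
            (((hasDerivAt_id t).sub_const S).hasDerivWithinAt (s := Icc S (S + T)))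
            (fun r hr => ⟨by simpa using hr.1, by simp only [id]; linarith [hr.2]⟩)
          simpa [Function.comp_def] using this
        exact h3.congr (fun r hr => e2 r hr.1) (e2 t hts)
      · refine HasFDerivWithinAt.of_notMem_closure ?_
        rw [closure_Icc]
        exact fun h => hts h.1
  · rw [e2 _ (by linarith [ht.1])]
    simp

theorem reverse {T : ℝ} {γ : ℝ → Pos d × Pos d} (h : IsSurrogateSol Us T γ) :
    IsSurrogateSol Us T fun t => phaseFlip (γ (T - t)) := by
  intro t ht
  have h1 := HasDerivWithinAt.scomp (t' := Icc 0 T) t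
    (h (T - t) ⟨by linarith [ht.2], by linarith [ht.1]⟩)
    (((hasDerivAt_id t).const_sub T).hasDerivWithinAt (s := Icc 0 T))
    (fun r hr => ⟨by simpa using hr.2, by simpa using hr.1⟩)
  have h2 : HasDerivWithinAt (fun r => (γ (T - r)).1) (-(γ (T - t)).2) (Icc 0 T) t := by
    have := HasFDerivAt.comp_hasDerivWithinAt (f := γ ∘ (fun r => T - r)) t
      (hasFDerivAt_fst (𝕜 := ℝ)) h1
    simpa [Function.comp_def] using! this
  have h3 : HasDerivWithinAt (fun r => (γ (T - r)).2) (gradient Us (γ (T - t)).1) (Icc 0 T) t := by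
    have := HasFDerivAt.comp_hasDerivWithinAt (f := γ ∘ (fun r => T - r)) t
      (hasFDerivAt_snd (𝕜 := ℝ)) h1
    simpa [Function.comp_def] using! this
  exact h2.prodMk h3.neg

end IsSurrogateSol

/-- The phase point with its velocity reflected against the gradient of the discrepancy. -/
noncomputable def bounceAt (Us Ut : Pos d → ℝ) (w : Pos d × Pos d) : Pos d × Pos d :=
  (w.1, reflectAgainst (gradient (potDiff Us Ut) w.1) w.2)

/-- The rate of change of the discrepancy along the dynamics. -/
noncomputable def discRate (Us Ut : Pos d → ℝ) (w : Pos d × Pos d) : ℝ :=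
  ⟪w.2, gradient (potDiff Us Ut) w.1⟫

@[simp] theorem bounceAt_fst (w : Pos d × Pos d) : (bounceAt Us Ut w).1 = w.1 := rfl

theorem norm_bounceAt_snd (w : Pos d × Pos d) : ‖(bounceAt Us Ut w).2‖ = ‖w.2‖ :=
  norm_reflectAgainst _ _

@[simp] theorem discRate_bounceAt (w : Pos d × Pos d) :
    discRate Us Ut (bounceAt Us Ut w) = -discRate Us Ut w := inner_reflectAgainst _ _

@[simp] theorem discRate_phaseFlip (w : Pos d × Pos d) :
    discRate Us Ut (phaseFlip w) = -discRate Us Ut w := inner_neg_left _ _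

@[simp] theorem bounceAt_bounceAt (w : Pos d × Pos d) :
    bounceAt Us Ut (bounceAt Us Ut w) = w :=
  Prod.ext rfl (reflectAgainst_reflectAgainst _ _)

theorem bounceAt_phaseFlip (w : Pos d × Pos d) :
    bounceAt Us Ut (phaseFlip w) = phaseFlip (bounceAt Us Ut w) :=
  Prod.ext rfl (reflectAgainst_neg _ _)

theorem continuous_discRate (hD : ContDiff ℝ 1 (potDiff Us Ut)) :
    Continuous (discRate Us Ut) :=
  continuous_snd.inner ((continuous_gradient hD).comp continuous_fst)

/-- Runs of the bouncy dynamics at the conserved level `c = p + U_d(x)` all of whose bounces are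
transversal. -/
inductive GoodRun (Us Ut : Pos d → ℝ) (c : ℝ) : ℝ → Pos d × Pos d → Pos d × Pos d → Prop
  | flow {T : ℝ} {w w' : Pos d × Pos d} (γ : ℝ → Pos d × Pos d)
      (nonneg : 0 ≤ T) (sol : IsSurrogateSol Us T γ) (init : γ 0 = w) (final : γ T = w')
      (inside : ∀ t ∈ Ioc 0 T, potDiff Us Ut (γ t).1 < c) : GoodRun Us Ut c T w w'
  | bounce {T s : ℝ} {w w' : Pos d × Pos d} (γ : ℝ → Pos d × Pos d)
      (pos : 0 < s) (sol : IsSurrogateSol Us s γ) (init : γ 0 = w)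
      (inside : ∀ t ∈ Ioo 0 s, potDiff Us Ut (γ t).1 < c)
      (hit : potDiff Us Ut (γ s).1 = c) (out : 0 < discRate Us Ut (γ s))
      (rest : GoodRun Us Ut c (T - s) (bounceAt Us Ut (γ s)) w') : GoodRun Us Ut c T w w'

/-- The state with phase point `w` on the level `c`. -/
noncomputable def stateAt (Us Ut : Pos d → ℝ) (c : ℝ) (w : Pos d × Pos d) : BState d :=
  (w.1, w.2, c - potDiff Us Ut w.1)

namespace BouncyRun

theorem nonneg {T : ℝ} {z z' : BState d} (h : BouncyRun Us Ut T z z') : 0 ≤ T := by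
  induction h with
  | flow γ nonneg => exact nonneg
  | bounce γ pos _ _ _ _ _ _ ih => linarith

/-- ODE uniqueness forces any run from the same state to follow `γ` up to its first hit. A competing
`flow`, or a bounce earlier or later than `s`, contradicts one of the first-hit conditions. -/
theorem bounce_inv (hUs : ContDiff ℝ 2 Us) {T s : ℝ} {x v : Pos d} {p : ℝ} {z : BState d}
    {γ : ℝ → Pos d × Pos d} (pos : 0 < s) (sol : IsSurrogateSol Us s γ) (init : γ 0 = (x, v))
    (no_hit : ∀ t ∈ Ioo 0 s, potDiff Us Ut (γ t).1 - potDiff Us Ut x ≠ p)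
    (hit : potDiff Us Ut (γ s).1 - potDiff Us Ut x = p) (hsT : s ≤ T)
    (h : BouncyRun Us Ut T (x, v, p) z) :
    BouncyRun Us Ut (T - s)
      ((γ s).1, reflectAgainst (gradient (potDiff Us Ut) (γ s).1) (γ s).2, 0) z := by
  cases h with
  | flow γ' nonneg sol' init' no_hit' =>
    have := (sol'.mono hsT).eqOn hUs sol (init'.trans init.symm) ⟨pos.le, le_rfl⟩
    exact absurd (by rw [this]; exact hit) (no_hit' s ⟨pos, hsT⟩)
  | @bounce _ s' _ _ _ _ γ' pos' sol' init' no_hit' hit' grad_ne' rest' =>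
    rcases lt_trichotomy s s' with hlt | rfl | hlt
    · have := (sol'.mono hlt.le).eqOn hUs sol (init'.trans init.symm) ⟨pos.le, le_rfl⟩
      exact absurd (by rw [this]; exact hit) (no_hit' s ⟨pos, hlt⟩)
    · have := sol'.eqOn hUs sol (init'.trans init.symm) ⟨pos.le, le_rfl⟩
      rwa [this] at rest'
    · have := sol'.eqOn hUs (sol.mono hlt.le) (init'.trans init.symm) ⟨pos'.le, le_rfl⟩
      exact absurd (by rw [← this]; exact hit') (no_hit s' ⟨pos', hlt⟩)

theorem eq_of_flow (hUs : ContDiff ℝ 2 Us) {T : ℝ} {x v : Pos d} {p : ℝ} {z : BState d}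
    {γ : ℝ → Pos d × Pos d} (sol : IsSurrogateSol Us T γ) (init : γ 0 = (x, v))
    (no_hit : ∀ t ∈ Ioc 0 T, potDiff Us Ut (γ t).1 - potDiff Us Ut x ≠ p)
    (h : BouncyRun Us Ut T (x, v, p) z) :
    z = ((γ T).1, (γ T).2, p + potDiff Us Ut x - potDiff Us Ut (γ T).1) := by
  cases h with
  | flow γ' nonneg sol' init' no_hit' =>
    rw [sol'.eqOn hUs sol (init'.trans init.symm) ⟨nonneg, le_rfl⟩]
  | @bounce _ s' _ _ _ _ γ' pos' sol' init' no_hit' hit' grad_ne' rest' =>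
    have hsT : s' ≤ T := by linarith [rest'.nonneg]
    have := sol'.eqOn hUs (sol.mono hsT) (init'.trans init.symm) ⟨pos'.le, le_rfl⟩
    exact absurd (by rw [← this]; exact hit') (no_hit s' ⟨pos', hsT⟩)

theorem deterministic (hUs : ContDiff ℝ 2 Us) {T : ℝ} {z z₁ z₂ : BState d}
    (h₁ : BouncyRun Us Ut T z z₁) (h₂ : BouncyRun Us Ut T z z₂) : z₁ = z₂ := by
  induction h₁ with
  | flow γ nonneg sol init no_hit => exact (h₂.eq_of_flow hUs sol init no_hit).symm
  | bounce γ pos sol init no_hit hit grad_ne rest ih =>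
    exact ih (h₂.bounce_inv hUs pos sol init no_hit hit (by linarith [rest.nonneg]))

theorem map_eq (hUs : ContDiff ℝ 2 Us) {T : ℝ} {z z' : BState d}
    (h : BouncyRun Us Ut T z z') : bouncyMap Us Ut T z = z' := by
  have hex : ∃ z', BouncyRun Us Ut T z z' := ⟨z', h⟩
  rw [bouncyMap, dif_pos hex]
  exact hex.choose_spec.deterministic hUs h

/-- A run consists of finitely many compact arcs. This is what rules out `ExitsBy` for large `R`. -/
theorem exists_bound (hUs : ContDiff ℝ 2 Us) {T : ℝ} {z z' : BState d}
    (h : BouncyRun Us Ut T z z') :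
    ∃ B, ∀ t ∈ Icc 0 T, ∀ w, BouncyRun Us Ut t z w → ‖w.1‖ ≤ B ∧ ‖w.2.1‖ ≤ B := by
  induction h with
  | flow γ nonneg sol init no_hit =>
    obtain ⟨B, hB⟩ := sol.exists_bound
    refine ⟨B, fun t ht w hw => ?_⟩
    rw [hw.eq_of_flow hUs (sol.mono ht.2) init fun r hr => no_hit r ⟨hr.1, hr.2.trans ht.2⟩]
    exact ⟨(norm_fst_le (γ t)).trans (hB t ht), (norm_snd_le (γ t)).trans (hB t ht)⟩
  | @bounce T s x v p z' γ pos sol init no_hit hit grad_ne rest ih =>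
    obtain ⟨B, hB⟩ := sol.exists_bound
    obtain ⟨B', hB'⟩ := ih
    refine ⟨max B B', fun t ht w hw => ?_⟩
    rcases lt_or_ge t s with hts | hts
    · rw [hw.eq_of_flow hUs (sol.mono hts.le) init fun r hr => no_hit r ⟨hr.1, hr.2.trans_lt hts⟩]
      exact ⟨((norm_fst_le (γ t)).trans (hB t ⟨ht.1, hts.le⟩)).trans (le_max_left _ _),
        ((norm_snd_le (γ t)).trans (hB t ⟨ht.1, hts.le⟩)).trans (le_max_left _ _)⟩
    · have := hB' (t - s) ⟨by linarith, by linarith [ht.2]⟩ w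
        (hw.bounce_inv hUs pos sol init no_hit hit hts)
      exact ⟨this.1.trans (le_max_right _ _), this.2.trans (le_max_right _ _)⟩

theorem surrogate_energy_eq (hUs : ContDiff ℝ 2 Us) {T : ℝ} {z z' : BState d}
    (h : BouncyRun Us Ut T z z') :
    Us z'.1 + ‖z'.2.1‖ ^ 2 / 2 = Us z.1 + ‖z.2.1‖ ^ 2 / 2 := by
  induction h with
  | flow γ nonneg sol init no_hit =>
    have := sol.energy_eq hUs ⟨nonneg, le_rfl⟩
    rwa [init] at this
  | bounce γ pos sol init no_hit hit grad_ne rest ih =>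
    have := sol.energy_eq hUs ⟨pos.le, le_rfl⟩
    rw [init] at this
    rw [ih, ← this]
    simp [norm_reflectAgainst]

theorem level_eq {T : ℝ} {z z' : BState d} (h : BouncyRun Us Ut T z z') :
    z'.2.2 + potDiff Us Ut z'.1 = z.2.2 + potDiff Us Ut z.1 := by
  induction h with
  | flow γ nonneg sol init no_hit => simp
  | bounce γ pos sol init no_hit hit grad_ne rest ih =>
    rw [ih, ← hit]
    simp

/-- `augEnergy` is the surrogate energy `U_s + ‖v‖²/2` plus the level `p + U_d`, and each is
conserved separately. -/
theorem augEnergy_eq (hUs : ContDiff ℝ 2 Us) {T : ℝ} {z z' : BState d}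
    (h : BouncyRun Us Ut T z z') : augEnergy Ut z' = augEnergy Ut z := by
  have h1 := h.surrogate_energy_eq hUs
  have h2 := h.level_eq
  simp only [potDiff] at h2
  simp only [augEnergy]
  linarith

end BouncyRun

namespace GoodRun

variable {c : ℝ}

theorem nonneg {T : ℝ} {w w' : Pos d × Pos d} (h : GoodRun Us Ut c T w w') : 0 ≤ T := by
  induction h with
  | flow γ nonneg => exact nonneg
  | bounce γ pos _ _ _ _ _ _ ih => linarith

theorem toBouncyRun {T : ℝ} {w w' : Pos d × Pos d} (h : GoodRun Us Ut c T w w') :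
    BouncyRun Us Ut T (stateAt Us Ut c w) (stateAt Us Ut c w') := by
  induction h with
  | @flow T w w' γ nonneg sol init final inside =>
    have := BouncyRun.flow (Ut := Ut) (x := w.1) (v := w.2) (p := c - potDiff Us Ut w.1) γ nonneg
      sol init fun t ht => by have := inside t ht; intro h; linarith
    rw [final] at this
    simpa [stateAt] using this
  | @bounce T s w w' γ pos sol init inside hit out rest ih =>
    refine BouncyRun.bounce γ pos sol init (fun t ht => ?_) (by rw [hit]) ?_ ?_
    · have := inside t ht
      intro h
      linarith
    · intro h
      simp [discRate, h] at out
    · simpa [stateAt, bounceAt, hit] using ih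

theorem le_level {T : ℝ} {w w' : Pos d × Pos d} (h : GoodRun Us Ut c T w w')
    (hw : potDiff Us Ut w.1 ≤ c) : potDiff Us Ut w'.1 ≤ c := by
  induction h with
  | flow γ nonneg sol init final inside =>
    rcases nonneg.eq_or_lt with rfl | h
    · rwa [← final, init]
    · rw [← final]
      exact (inside _ ⟨h, le_rfl⟩).le
  | bounce γ pos sol init inside hit out rest ih => exact ih (by simp [hit])

theorem append {S T : ℝ} {w w₁ w₂ : Pos d × Pos d} (h₁ : GoodRun Us Ut c S w w₁)
    (h₂ : GoodRun Us Ut c T w₁ w₂) : GoodRun Us Ut c (S + T) w w₂ := by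
  induction h₁ with
  | @flow S w w₁ γ nonneg sol init final inside =>
    -- A trivial first arc is separated off because its end may lie on the level `c`, as it does
    -- just after a bounce. If `S > 0`, the junction is strictly below `c`, and gluing the arcs
    -- creates no hit there.
    rcases nonneg.eq_or_lt with rfl | hS
    · rw [← final, init] at h₂
      simpa using h₂
    cases h₂ with
    | flow γ₂ nonneg₂ sol₂ init₂ final₂ inside₂ =>
      obtain ⟨γ', sol', e1, e2⟩ := sol.glue nonneg nonneg₂ sol₂ (init₂.trans final.symm)
      refine .flow γ' (by linarith) sol' ((e1 0 ⟨le_rfl, nonneg⟩).trans init)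
        ((e2 T ⟨nonneg₂, le_rfl⟩).trans final₂) fun t ht => ?_
      rcases le_or_gt t S with hts | hts
      · rw [e1 t ⟨ht.1.le, hts⟩]
        exact inside t ⟨ht.1, hts⟩
      · have := e2 (t - S) ⟨by linarith, by linarith [ht.2]⟩
        rw [add_sub_cancel] at this
        rw [this]
        exact inside₂ _ ⟨by linarith, by linarith [ht.2]⟩
    | @bounce _ s _ _ γ₂ pos₂ sol₂ init₂ inside₂ hit₂ out₂ rest₂ =>
      obtain ⟨γ', sol', e1, e2⟩ := sol.glue nonneg pos₂.le sol₂ (init₂.trans final.symm)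
      have e3 := e2 s ⟨pos₂.le, le_rfl⟩
      refine .bounce γ' (by linarith) sol' ((e1 0 ⟨le_rfl, nonneg⟩).trans init) (fun t ht => ?_)
        (by rw [e3, hit₂]) (by rw [e3]; exact out₂) (by rw [e3, add_sub_add_left_eq_sub]; exact rest₂)
      rcases le_or_gt t S with hts | hts
      · rw [e1 t ⟨ht.1.le, hts⟩]
        exact inside t ⟨ht.1, hts⟩
      · have := e2 (t - S) ⟨by linarith, by linarith [ht.2]⟩
        rw [add_sub_cancel] at this
        rw [this]
        exact inside₂ _ ⟨by linarith, by linarith [ht.2]⟩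
  | bounce γ pos sol init inside hit out rest ih =>
    refine .bounce γ pos sol init inside hit out ?_
    have := ih h₂
    rwa [← sub_add_eq_add_sub]

/-- `Z` consists of time `0` and the bounce times; on every arc the inertia is positive away from
these. -/
theorem exists_subruns {T : ℝ} {w w' : Pos d × Pos d} (h : GoodRun Us Ut c T w w') :
    ∃ Z : Set ℝ, Z.Finite ∧ ∀ t ∈ Icc 0 T, ∃ u, GoodRun Us Ut c t w u ∧
      (t ∉ Z → potDiff Us Ut u.1 < c) := by
  induction h with
  | flow γ nonneg sol init final inside =>
    refine ⟨{0}, finite_singleton 0, fun t ht => ⟨γ t, .flow γ ht.1 (sol.mono ht.2) init rfl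
      fun r hr => inside r ⟨hr.1, hr.2.trans ht.2⟩, fun h0 => ?_⟩⟩
    exact inside t ⟨lt_of_le_of_ne ht.1 fun h => h0 h.symm, ht.2⟩
  | @bounce T s w w' γ pos sol init inside hit out rest ih =>
    obtain ⟨Z, hZ, hsub⟩ := ih
    refine ⟨{0} ∪ (fun t => s + t) '' Z, (finite_singleton 0).union (hZ.image _), fun t ht => ?_⟩
    rcases lt_or_ge t s with hts | hts
    · refine ⟨γ t, .flow γ ht.1 (sol.mono hts.le) init rfl
        fun r hr => inside r ⟨hr.1, hr.2.trans_lt hts⟩, fun h0 => ?_⟩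
      exact inside t ⟨lt_of_le_of_ne ht.1 fun h => h0 (Or.inl h.symm), hts⟩
    · obtain ⟨u, hu, hu'⟩ := hsub (t - s) ⟨by linarith, by linarith [ht.2]⟩
      refine ⟨u, .bounce γ pos sol init inside hit out hu, fun h0 => hu' fun h => h0 (Or.inr ?_)⟩
      exact ⟨t - s, h, by ring⟩

/-- The second clause treats a remainder that starts just after a bounce, on the level and moving
inwards. Traversed backwards, it reaches that point moving outwards, hence bounces transversally,
and since reflection is an involution commuting with the flip it continues along the preceding arc
backwards. The continuation `S`, `u` is left general so that the induction can prepend arcs. -/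
theorem reverse_aux {T : ℝ} {w w' : Pos d × Pos d} (h : GoodRun Us Ut c T w w')
    (hw' : potDiff Us Ut w'.1 < c) :
    (potDiff Us Ut w.1 < c → GoodRun Us Ut c T (phaseFlip w') (phaseFlip w)) ∧
    (potDiff Us Ut w.1 = c → discRate Us Ut w < 0 → ∀ (S : ℝ) (u : Pos d × Pos d),
      GoodRun Us Ut c S (bounceAt Us Ut (phaseFlip w)) u →
        GoodRun Us Ut c (T + S) (phaseFlip w') u) := by
  induction h with
  | @flow T w w' γ nonneg sol init final inside =>
    refine ⟨fun hw => ?_, fun hw hr S u hu => ?_⟩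
    · refine .flow _ nonneg sol.reverse (by simp [final]) (by simp [init]) fun t ht => ?_
      rcases ht.2.eq_or_lt with rfl | htT
      · simpa [init] using hw
      · exact inside (T - t) ⟨by linarith, by linarith [ht.1]⟩
    · have hT : 0 < T := by
        refine lt_of_le_of_ne nonneg fun h0 => ?_
        rw [← final, ← h0, init] at hw'
        exact hw'.ne hw
      refine .bounce _ hT sol.reverse (by simp [final]) (fun t ht => ?_) ?_ ?_ ?_
      · exact inside (T - t) ⟨by linarith [ht.2], by linarith [ht.1]⟩
      · simpa [init] using hw
      · simpa [init] using hr
      · simpa [init] using hu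
  | @bounce T s w w' γ pos sol init inside hit out rest ih =>
    obtain ⟨-, ih⟩ := ih hw'
    have ih := fun S u hu => ih (by simpa using hit) (by simpa using out) S u hu
    simp only [bounceAt_phaseFlip, bounceAt_bounceAt] at ih
    refine ⟨fun hw => ?_, fun hw hr S u hu => ?_⟩
    · have h1 : GoodRun Us Ut c s (phaseFlip (γ s)) (phaseFlip w) := by
        refine .flow _ pos.le sol.reverse (by simp) (by simp [init]) fun t ht => ?_
        rcases ht.2.eq_or_lt with rfl | htT
        · simpa [init] using hw
        · exact inside (s - t) ⟨by linarith, by linarith [ht.1]⟩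
      simpa using ih s _ h1
    · have h1 : GoodRun Us Ut c (s + S) (phaseFlip (γ s)) u := by
        refine .bounce _ pos sol.reverse (by simp) (fun t ht => ?_) ?_ ?_ ?_
        · exact inside (s - t) ⟨by linarith [ht.2], by linarith [ht.1]⟩
        · simpa [init] using hw
        · simpa [init] using hr
        · simpa [init] using hu
      have := ih _ _ h1
      rwa [show T - s + (s + S) = T + S by ring] at this

theorem reverse {T : ℝ} {w w' : Pos d × Pos d} (h : GoodRun Us Ut c T w w')
    (hw : potDiff Us Ut w.1 < c) (hw' : potDiff Us Ut w'.1 < c) :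
    GoodRun Us Ut c T (phaseFlip w') (phaseFlip w) :=
  (h.reverse_aux hw').1 hw

end GoodRun

end Dynamics

/-! ### Exit times, and Lebesgue measure in terms of hit point and hit time -/

section Step

open Filter Function Topology
open scoped NNReal ENNReal RealInnerProductSpace

variable {d : ℕ} {Us Ut : Pos d → ℝ} {R δ : ℝ} {φ : ℝ → Pos d × Pos d → Pos d × Pos d}

/-- Phase points and levels with positive inertia and with position and velocity of norm less
than `R`. -/
def runRegion (Us Ut : Pos d → ℝ) (R : ℝ) : Set ((Pos d × Pos d) × ℝ) :=
  {q | potDiff Us Ut q.1.1 < q.2 ∧ ‖q.1.1‖ < R ∧ ‖q.1.2‖ < R}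

theorem isOpen_runRegion (hD : ContDiff ℝ 1 (potDiff Us Ut)) : IsOpen (runRegion Us Ut R) := by
  have hc := hD.continuous
  have h1 : IsOpen {q : (Pos d × Pos d) × ℝ | potDiff Us Ut q.1.1 < q.2} :=
    isOpen_lt (by fun_prop) (by fun_prop)
  have h2 : IsOpen {q : (Pos d × Pos d) × ℝ | ‖q.1.1‖ < R} := isOpen_lt (by fun_prop) (by fun_prop)
  have h3 : IsOpen {q : (Pos d × Pos d) × ℝ | ‖q.1.2‖ < R} := isOpen_lt (by fun_prop) (by fun_prop)
  exact h1.inter (h2.inter h3)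

theorem phaseFlip_mem_runRegion {w : Pos d × Pos d} {c : ℝ} :
    (phaseFlip w, c) ∈ runRegion Us Ut R ↔ (w, c) ∈ runRegion Us Ut R := by
  simp [runRegion]

/-- The first time at which the flow leaves `O`, truncated at `δ`. -/
noncomputable def exitTime (φ : ℝ → Pos d × Pos d → Pos d × Pos d)
    (O : Set ((Pos d × Pos d) × ℝ)) (δ : ℝ) (q : (Pos d × Pos d) × ℝ) : ℝ :=
  sInf {t | t ∈ Icc 0 δ ∧ (t = δ ∨ (φ t q.1, q.2) ∉ O)}

/-- The points that stay in `O` during `[0, δ]`. -/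
def stayDomain (φ : ℝ → Pos d × Pos d → Pos d × Pos d)
    (O : Set ((Pos d × Pos d) × ℝ)) (δ : ℝ) : Set ((Pos d × Pos d) × ℝ) :=
  {q | ∀ s ∈ Icc 0 δ, (φ s q.1, q.2) ∈ O}

namespace LocalFlow

variable {O : Set ((Pos d × Pos d) × ℝ)}

theorem continuous_time (hφ : LocalFlow Us R φ) (w : Pos d × Pos d) : Continuous fun t => φ t w :=
  hφ.cont.comp (continuous_id.prodMk continuous_const)

theorem neg_apply_apply (hφ : LocalFlow Us R φ)
    (t : ℝ) (w : Pos d × Pos d) : φ (-t) (φ t w) = w := by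
  rw [← hφ.add, neg_add_cancel, hφ.zero]

theorem exitTime_mem (hφ : LocalFlow Us R φ)
    (hO : IsOpen O) (hδ : 0 ≤ δ) (q : (Pos d × Pos d) × ℝ) :
    exitTime φ O δ q ∈ Icc 0 δ ∧ (exitTime φ O δ q = δ ∨ (φ (exitTime φ O δ q) q.1, q.2) ∉ O) := by
  have hcl : IsClosed {t | t ∈ Icc 0 δ ∧ (t = δ ∨ (φ t q.1, q.2) ∉ O)} := by
    have h1 : Continuous fun t => (φ t q.1, q.2) := (hφ.continuous_time q.1).prodMk continuous_const
    exact isClosed_Icc.inter ((isClosed_eq continuous_id continuous_const).union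
      (hO.preimage h1).isClosed_compl)
  exact hcl.csInf_mem ⟨δ, ⟨hδ, le_rfl⟩, Or.inl rfl⟩ ⟨0, fun t ht => ht.1.1⟩

theorem mem_of_lt_exitTime {q : (Pos d × Pos d) × ℝ} {t : ℝ} (h0 : 0 ≤ t)
    (ht : t < exitTime φ O δ q) (hδ : t ≤ δ) : (φ t q.1, q.2) ∈ O := by
  by_contra h
  have hmem : t ∈ {t | t ∈ Icc 0 δ ∧ (t = δ ∨ (φ t q.1, q.2) ∉ O)} := ⟨⟨h0, hδ⟩, Or.inr h⟩
  exact absurd (csInf_le ⟨0, fun t ht => ht.1.1⟩ hmem) (not_le.2 ht)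

theorem lt_exitTime_iff (hφ : LocalFlow Us R φ)
    (hO : IsOpen O) (hδ : 0 ≤ δ) {q : (Pos d × Pos d) × ℝ} {t : ℝ} :
    t < exitTime φ O δ q ↔ t < δ ∧ q ∈ stayDomain φ O t := by
  have hm := hφ.exitTime_mem hO hδ q
  constructor
  · intro h
    have htδ := h.trans_le hm.1.2
    exact ⟨htδ, fun s hs => mem_of_lt_exitTime hs.1 (hs.2.trans_lt h) (hs.2.trans htδ.le)⟩
  · rintro ⟨h1, h2⟩
    by_contra! h
    rcases hm.2 with h3 | h3
    · linarith
    · exact h3 (h2 _ ⟨hm.1.1, h⟩)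

theorem isOpen_stayDomain (hφ : LocalFlow Us R φ)
    (hO : IsOpen O) (δ : ℝ) : IsOpen (stayDomain φ O δ) := by
  rw [isOpen_iff_eventually]
  intro q hq
  refine isCompact_Icc.eventually_forall_of_forall_eventually fun s hs => ?_
  have h1 : Continuous fun p : ((Pos d × Pos d) × ℝ) × ℝ => (φ p.2 p.1.1, p.1.2) :=
    (hφ.cont.comp (continuous_snd.prodMk (continuous_fst.comp continuous_fst))).prodMk
      (continuous_snd.comp continuous_fst)
  exact (hO.preimage h1).mem_nhds (hq s hs)

/-- Staying in an open set during a compact time interval is an open condition on the starting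
point, so the exit time is lower semicontinuous. -/
theorem measurable_exitTime (hφ : LocalFlow Us R φ)
    (hO : IsOpen O) (hδ : 0 ≤ δ) : Measurable (exitTime φ O δ) := by
  refine measurable_of_Ioi fun t => ?_
  have : exitTime φ O δ ⁻¹' Ioi t = {q | t < δ ∧ q ∈ stayDomain φ O t} := by
    ext q
    exact hφ.lt_exitTime_iff hO hδ
  rw [this]
  exact (MeasurableSet.const _).inter (hφ.isOpen_stayDomain hO t).measurableSet

end LocalFlow

/-- Phase points of norm less than `R` moving transversally out of the sublevel set of the
discrepancy. -/
def outRegion (Us Ut : Pos d → ℝ) (R : ℝ) : Set (Pos d × Pos d) :=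
  {w | ‖w.1‖ < R ∧ ‖w.2‖ < R ∧ 0 < discRate Us Ut w}

/-- The points of the region at which the inertia runs out transversally before time `δ`. -/
def hitDomain (Us Ut : Pos d → ℝ) (R : ℝ) (φ : ℝ → Pos d × Pos d → Pos d × Pos d) (δ : ℝ) :
    Set ((Pos d × Pos d) × ℝ) :=
  {q | q ∈ runRegion Us Ut R ∧ exitTime φ (runRegion Us Ut R) δ q < δ ∧
    φ (exitTime φ (runRegion Us Ut R) δ q) q.1 ∈ outRegion Us Ut R}

theorem isOpen_outRegion (hD : ContDiff ℝ 1 (potDiff Us Ut)) : IsOpen (outRegion Us Ut R) := by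
  have := continuous_discRate hD
  have h1 : IsOpen {w : Pos d × Pos d | ‖w.1‖ < R} := isOpen_lt (by fun_prop) (by fun_prop)
  have h2 : IsOpen {w : Pos d × Pos d | ‖w.2‖ < R} := isOpen_lt (by fun_prop) (by fun_prop)
  have h3 : IsOpen {w : Pos d × Pos d | 0 < discRate Us Ut w} :=
    isOpen_lt (by fun_prop) (by fun_prop)
  exact h1.inter (h2.inter h3)

theorem measurable_bounceAt (hD : ContDiff ℝ 1 (potDiff Us Ut)) :
    Measurable (bounceAt Us Ut) := by
  have hg : Measurable fun w : Pos d × Pos d => gradient (potDiff Us Ut) w.1 :=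
    ((continuous_gradient hD).comp continuous_fst).measurable
  have hr : Measurable fun w : Pos d × Pos d =>
      2 * (⟪w.2, gradient (potDiff Us Ut) w.1⟫ / ‖gradient (potDiff Us Ut) w.1‖ ^ 2) :=
    ((measurable_snd.inner hg).div (hg.norm.pow_const 2)).const_mul 2
  exact measurable_fst.prodMk (measurable_snd.sub (hr.smul hg))

/-- For each position this is a linear isometry of the velocities, including where the gradient
vanishes and the reflection degenerates to the identity. The composite with the flip also preserves
`discRate`, as both factors change its sign. -/
theorem measurePreserving_phaseFlip_bounceAt (hD : ContDiff ℝ 1 (potDiff Us Ut)) :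
    MeasurePreserving fun w => phaseFlip (bounceAt Us Ut w) := by
  have hm : Measurable fun w => phaseFlip (bounceAt Us Ut w) :=
    continuous_phaseFlip.measurable.comp (measurable_bounceAt hD)
  refine MeasurePreserving.skew_product (f := id)
    (g := fun x v => -reflectAgainst (gradient (potDiff Us Ut) x) v) (MeasurePreserving.id _)
    (measurable_snd.comp hm) (ae_of_all _ fun x => ?_)
  set g := gradient (potDiff Us Ut) x
  let L : Pos d →ₗᵢ[ℝ] Pos d :=
    { toFun := fun v => -reflectAgainst g v
      map_add' := fun u v => by
        simp only [reflectAgainst, inner_add_left]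
        module
      map_smul' := fun a v => by
        simp only [reflectAgainst, inner_smul_left, RingHom.id_apply, conj_trivial]
        module
      norm_map' := fun v => by
        change ‖-reflectAgainst g v‖ = ‖v‖
        rw [norm_neg, norm_reflectAgainst] }
  exact (L.toLinearIsometryEquiv rfl).measurePreserving.map_eq

namespace LocalFlow

theorem measurable_flow_comp (hφ : LocalFlow Us R φ)
    {α : Type*} [MeasurableSpace α] {s : α → ℝ} {w : α → Pos d × Pos d}
    (hs : Measurable s) (hw : Measurable w) : Measurable fun a => φ (s a) (w a) :=
  hφ.cont.measurable.comp (hs.prodMk hw)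

theorem exitTime_pos (hφ : LocalFlow Us R φ) (hD : ContDiff ℝ 1 (potDiff Us Ut)) (hδ : 0 < δ)
    {q : (Pos d × Pos d) × ℝ} : 0 < exitTime φ (runRegion Us Ut R) δ q ↔
      q ∈ runRegion Us Ut R := by
  rw [hφ.lt_exitTime_iff (isOpen_runRegion hD) hδ.le]
  constructor
  · intro h
    simpa [hφ.zero] using h.2 0 ⟨le_rfl, le_rfl⟩
  · refine fun h => ⟨hδ, fun s hs => ?_⟩
    rw [le_antisymm hs.2 hs.1, hφ.zero]
    exact h

/-- An exit before time `δ` with both norms still below `R` can only be caused by the level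
condition. -/
theorem level_at_hit (hφ : LocalFlow Us R φ)
    (hD : ContDiff ℝ 1 (potDiff Us Ut)) (hδ : 0 < δ) {q : (Pos d × Pos d) × ℝ}
    (hq : q ∈ hitDomain Us Ut R φ δ) :
    potDiff Us Ut (φ (exitTime φ (runRegion Us Ut R) δ q) q.1).1 = q.2 := by
  obtain ⟨h1, h2, h3⟩ := hq
  set σ := exitTime φ (runRegion Us Ut R) δ q with hσ
  have hpos : 0 < σ := (hφ.exitTime_pos hD hδ).2 h1
  refine le_antisymm ?_ ?_
  · have hc : Continuous fun t => potDiff Us Ut (φ t q.1).1 :=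
      hD.continuous.comp (continuous_fst.comp (hφ.continuous_time q.1))
    have hcl : IsClosed {t | potDiff Us Ut (φ t q.1).1 ≤ q.2} := isClosed_le hc continuous_const
    have hsub : Ioo 0 σ ⊆ {t | potDiff Us Ut (φ t q.1).1 ≤ q.2} := fun t ht =>
      (mem_of_lt_exitTime (O := runRegion Us Ut R) (δ := δ) (q := q) ht.1.le ht.2
        (ht.2.trans h2).le).1.le
    have := hcl.closure_subset_iff.2 hsub
    rw [closure_Ioo hpos.ne] at this
    exact this ⟨hpos.le, le_rfl⟩
  · by_contra! h
    rcases (hφ.exitTime_mem (isOpen_runRegion (R := R) hD) hδ.le q).2 with h4 | h4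
    · exact h2.ne h4
    · exact h4 ⟨h, h3.1, h3.2.1⟩

theorem measurableSet_hitDomain (hφ : LocalFlow Us R φ)
    (hD : ContDiff ℝ 1 (potDiff Us Ut)) (hδ : 0 ≤ δ) :
    MeasurableSet (hitDomain Us Ut R φ δ) := by
  have hσ := hφ.measurable_exitTime (isOpen_runRegion (R := R) hD) hδ
  exact (isOpen_runRegion hD).measurableSet.inter ((measurableSet_lt hσ measurable_const).inter
    ((isOpen_outRegion hD).measurableSet.preimage (hφ.measurable_flow_comp hσ measurable_fst)))

/-- Points of `outRegion`, paired with a time `τ`, such that the flow from time `-τ` up to now hits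
the current level of the discrepancy only now. -/
theorem measurableSet_firstHit (hφ : LocalFlow Us R φ)
    (hD : ContDiff ℝ 1 (potDiff Us Ut)) (hδ : 0 ≤ δ) :
    MeasurableSet {p : (Pos d × Pos d) × ℝ | p.1 ∈ outRegion Us Ut R ∧
      exitTime φ (runRegion Us Ut R) δ (φ (-p.2) p.1, potDiff Us Ut p.1.1) = p.2} := by
  have hσ := hφ.measurable_exitTime (isOpen_runRegion (R := R) hD) hδ
  refine ((isOpen_outRegion hD).measurableSet.preimage measurable_fst).inter
    (measurableSet_eq_fun (hσ.comp ?_) measurable_snd)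
  exact (hφ.measurable_flow_comp measurable_snd.neg measurable_fst).prodMk
    (hD.continuous.measurable.comp (measurable_fst.comp measurable_fst))

/-- The disintegration of Lebesgue measure on the states that hit, along hit state and hit time. -/
theorem lintegral_hitDomain (hφ : LocalFlow Us R φ) (hD : ContDiff ℝ 1 (potDiff Us Ut)) (hδ : 0 < δ)
    {G : (Pos d × Pos d) × ℝ → ℝ≥0∞} (hG : Measurable G) :
    ∫⁻ q in hitDomain Us Ut R φ δ, G (φ (exitTime φ (runRegion Us Ut R) δ q) q.1,
        exitTime φ (runRegion Us Ut R) δ q) =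
      ∫⁻ τ in Ioo 0 δ, ∫⁻ y, {p : (Pos d × Pos d) × ℝ | p.1 ∈ outRegion Us Ut R ∧
        exitTime φ (runRegion Us Ut R) δ (φ (-p.2) p.1, potDiff Us Ut p.1.1) = p.2}.indicator
        (fun p => ENNReal.ofReal (discRate Us Ut p.1) * G p) (y, τ) := by
  set O := runRegion Us Ut R with hO_def
  have hO : IsOpen O := isOpen_runRegion hD
  set σ := exitTime φ O δ with hσ_def
  have hσ : Measurable σ := hφ.measurable_exitTime hO hδ.le
  set A := {p : (Pos d × Pos d) × ℝ | p.1 ∈ outRegion Us Ut R ∧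
        σ (φ (-p.2) p.1, potDiff Us Ut p.1.1) = p.2} with hA_def
  have hA : MeasurableSet A := hφ.measurableSet_firstHit hD hδ.le
  have hH : MeasurableSet (hitDomain Us Ut R φ δ) := hφ.measurableSet_hitDomain hD hδ.le
  set k := A.indicator (fun p => ENNReal.ofReal (discRate Us Ut p.1) * G p) with hk_def
  have hk : Measurable k :=
    (((continuous_discRate hD).measurable.comp measurable_fst).ennreal_ofReal.mul hG).indicator hA
  -- For fixed `w`, the levels that hit are parametrized by the hit time through `c = U_d(φ_τ w)`.
  -- This is injective because the exit time recovers `τ`, and its derivative is `discRate`, so the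
  -- one-dimensional change of variables gives `dc = discRate dτ`.
  have hfiber : ∀ w : Pos d × Pos d,
      ∫⁻ c, (hitDomain Us Ut R φ δ).indicator (fun q => G (φ (σ q) q.1, σ q)) (w, c) =
        ∫⁻ τ in Ioo 0 δ, k (φ τ w, τ) := by
    intro w
    set h : ℝ → ℝ := fun τ => potDiff Us Ut (φ τ w).1 with hh
    set S : Set ℝ := {τ | τ ∈ Ioo 0 δ ∧ (φ τ w, τ) ∈ A} with hS_def
    have hcurve : Measurable fun τ => (φ τ w, τ) :=
      ((hφ.continuous_time w).prodMk continuous_id).measurable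
    have hA' : MeasurableSet {τ | (φ τ w, τ) ∈ A} := hcurve hA
    have hS : MeasurableSet S := measurableSet_Ioo.inter hA'
    have hSσ : ∀ τ ∈ S, σ (w, h τ) = τ := fun τ hτ => by
      have := hτ.2.2
      simpa only [hφ.neg_apply_apply] using this
    have himage : h '' S = {c | (w, c) ∈ hitDomain Us Ut R φ δ} := by
      ext c
      constructor
      · rintro ⟨τ, hτ, rfl⟩
        have h1 := hSσ τ hτ
        refine ⟨?_, ?_, ?_⟩
        · rw [← hφ.exitTime_pos hD hδ, ← hO_def, ← hσ_def, h1]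
          exact hτ.1.1
        · rw [← hO_def, ← hσ_def, h1]
          exact hτ.1.2
        · rw [← hO_def, ← hσ_def, h1]
          exact hτ.2.1
      · intro hc
        have hlev := hφ.level_at_hit hD hδ hc
        refine ⟨σ (w, c), ⟨⟨(hφ.exitTime_pos hD hδ).2 hc.1, hc.2.1⟩, hc.2.2, ?_⟩, hlev⟩
        simp only [hφ.neg_apply_apply]
        change σ (w, h (σ (w, c))) = σ (w, c)
        have : h (σ (w, c)) = c := hlev
        rw [this]
    have hderiv : ∀ τ ∈ S, HasDerivWithinAt h (discRate Us Ut (φ τ w)) S τ := fun τ hτ =>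
      hasDerivWithinAt_potential_comp_fst hD
        (hφ.deriv w τ hτ.2.1.1.le hτ.2.1.2.1.le).hasDerivWithinAt
    have hinj : InjOn h S := fun a ha b hb hab => by
      rw [← hSσ a ha, ← hSσ b hb, hab]
    calc ∫⁻ c, (hitDomain Us Ut R φ δ).indicator (fun q => G (φ (σ q) q.1, σ q)) (w, c)
        = ∫⁻ c, (h '' S).indicator (fun c => G (φ (σ (w, c)) w, σ (w, c))) c := by
          rw [himage]
          rfl
      _ = ∫⁻ c in h '' S, G (φ (σ (w, c)) w, σ (w, c)) := by
          refine lintegral_indicator ?_ _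
          rw [himage]
          exact measurable_prodMk_left hH
      _ = ∫⁻ τ in S, ENNReal.ofReal |discRate Us Ut (φ τ w)| *
            G (φ (σ (w, h τ)) w, σ (w, h τ)) :=
          lintegral_image_eq_lintegral_abs_deriv_mul hS hderiv hinj _
      _ = ∫⁻ τ in S, ENNReal.ofReal (discRate Us Ut (φ τ w)) * G (φ τ w, τ) := by
          refine setLIntegral_congr_fun hS fun τ hτ => ?_
          rw [hSσ τ hτ, abs_of_pos hτ.2.1.2.2]
      _ = ∫⁻ τ in Ioo 0 δ, k (φ τ w, τ) := by
          have : S = {τ | (φ τ w, τ) ∈ A} ∩ Ioo 0 δ := by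
            rw [inter_comm]
            rfl
          rw [this, ← Measure.restrict_restrict hA', ← lintegral_indicator hA']
          rfl
  have hm : Measurable ((hitDomain Us Ut R φ δ).indicator (fun q => G (φ (σ q) q.1, σ q))) :=
    (hG.comp ((hφ.measurable_flow_comp hσ measurable_fst).prodMk hσ)).indicator hH
  calc ∫⁻ q in hitDomain Us Ut R φ δ, G (φ (σ q) q.1, σ q)
      = ∫⁻ q, (hitDomain Us Ut R φ δ).indicator (fun q => G (φ (σ q) q.1, σ q)) q :=
        (lintegral_indicator hH _).symm
    _ = ∫⁻ w, ∫⁻ c, (hitDomain Us Ut R φ δ).indicator (fun q => G (φ (σ q) q.1, σ q)) (w, c) :=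
        lintegral_prod _ hm.aemeasurable
    _ = ∫⁻ w, ∫⁻ τ in Ioo 0 δ, k (φ τ w, τ) := lintegral_congr hfiber
    -- After Tonelli, `τ` is fixed and the hit point `y = φ τ w` can replace `w` by Liouville's
    -- theorem.
    _ = ∫⁻ τ in Ioo 0 δ, ∫⁻ w, k (φ τ w, τ) := by
        refine lintegral_lintegral_swap (Measurable.aemeasurable ?_)
        exact hk.comp ((hφ.measurable_flow_comp measurable_snd measurable_fst).prodMk measurable_snd)
    _ = ∫⁻ τ in Ioo 0 δ, ∫⁻ y, k (y, τ) := by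
        refine lintegral_congr fun τ => ?_
        exact (hφ.mp τ).lintegral_comp (f := fun y => k (y, τ)) (hk.comp measurable_prodMk_right)

end LocalFlow

end Step

/-! ### Steps with at most one bounce do not increase the volume of preimages -/

section StepVolume

open Filter Function Topology
open scoped NNReal ENNReal RealInnerProductSpace

variable {d : ℕ} {Us Ut : Pos d → ℝ} {R δ : ℝ} {φ : ℝ → Pos d × Pos d → Pos d × Pos d}

/-- The phase point at time `δ` after a single bounce at the exit time. -/
noncomputable def afterBounce (Us Ut : Pos d → ℝ) (R : ℝ)
    (φ : ℝ → Pos d × Pos d → Pos d × Pos d) (δ : ℝ) (q : (Pos d × Pos d) × ℝ) : Pos d × Pos d :=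
  φ (δ - exitTime φ (runRegion Us Ut R) δ q)
    (bounceAt Us Ut (φ (exitTime φ (runRegion Us Ut R) δ q) q.1))

/-- The states that bounce exactly once before time `δ`, and transversally. -/
def bounceDomain (Us Ut : Pos d → ℝ) (R : ℝ) (φ : ℝ → Pos d × Pos d → Pos d × Pos d) (δ : ℝ) :
    Set ((Pos d × Pos d) × ℝ) :=
  {q | q ∈ hitDomain Us Ut R φ δ ∧ (afterBounce Us Ut R φ δ q, q.2) ∈ runRegion Us Ut R ∧
    exitTime φ (runRegion Us Ut R) δ (phaseFlip (afterBounce Us Ut R φ δ q), q.2) =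
      δ - exitTime φ (runRegion Us Ut R) δ q}

/-- The states whose dynamics up to time `δ` have at most one bounce. -/
def stepDomain (Us Ut : Pos d → ℝ) (R : ℝ) (φ : ℝ → Pos d × Pos d → Pos d × Pos d) (δ : ℝ) :
    Set ((Pos d × Pos d) × ℝ) :=
  stayDomain φ (runRegion Us Ut R) δ ∪ bounceDomain Us Ut R φ δ

open Classical in
/-- The dynamics for time `δ` on `stepDomain`. -/
noncomputable def stepMap (Us Ut : Pos d → ℝ) (R : ℝ)
    (φ : ℝ → Pos d × Pos d → Pos d × Pos d) (δ : ℝ) (q : (Pos d × Pos d) × ℝ) :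
    (Pos d × Pos d) × ℝ :=
  (if q ∈ stayDomain φ (runRegion Us Ut R) δ then φ δ q.1 else afterBounce Us Ut R φ δ q, q.2)

theorem stepMap_of_mem_stayDomain {q : (Pos d × Pos d) × ℝ}
    (hq : q ∈ stayDomain φ (runRegion Us Ut R) δ) : stepMap Us Ut R φ δ q = (φ δ q.1, q.2) := by
  rw [stepMap, if_pos hq]

/-- Velocity flip on the product of phase space and levels. -/
def levelFlip (q : (Pos d × Pos d) × ℝ) : (Pos d × Pos d) × ℝ := (phaseFlip q.1, q.2)

theorem measurePreserving_phaseFlip :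
    MeasurePreserving (phaseFlip : Pos d × Pos d → Pos d × Pos d) :=
  (MeasurePreserving.id volume).prod (Measure.measurePreserving_neg volume)

theorem measurePreserving_levelFlip :
    MeasurePreserving (levelFlip : (Pos d × Pos d) × ℝ → _) :=
  measurePreserving_phaseFlip.prod (MeasurePreserving.id volume)

namespace LocalFlow

theorem exitTime_eq_of_mem_stayDomain (hφ : LocalFlow Us R φ) (hD : ContDiff ℝ 1 (potDiff Us Ut))
    (hδ : 0 ≤ δ) {q : (Pos d × Pos d) × ℝ} (hq : q ∈ stayDomain φ (runRegion Us Ut R) δ) :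
    exitTime φ (runRegion Us Ut R) δ q = δ := by
  have h := hφ.exitTime_mem (isOpen_runRegion (R := R) hD) hδ q
  exact h.2.resolve_right fun h' => h' (hq _ h.1)

theorem notMem_stayDomain_of_mem_hitDomain (hφ : LocalFlow Us R φ)
    (hD : ContDiff ℝ 1 (potDiff Us Ut)) (hδ : 0 ≤ δ) {q : (Pos d × Pos d) × ℝ}
    (hq : q ∈ hitDomain Us Ut R φ δ) : q ∉ stayDomain φ (runRegion Us Ut R) δ := fun h =>
  hq.2.1.ne (hφ.exitTime_eq_of_mem_stayDomain hD hδ h)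

theorem stepMap_of_mem_hitDomain (hφ : LocalFlow Us R φ)
    (hD : ContDiff ℝ 1 (potDiff Us Ut)) (hδ : 0 ≤ δ) {q : (Pos d × Pos d) × ℝ}
    (hq : q ∈ hitDomain Us Ut R φ δ) :
    stepMap Us Ut R φ δ q = (afterBounce Us Ut R φ δ q, q.2) := by
  rw [stepMap, if_neg (hφ.notMem_stayDomain_of_mem_hitDomain hD hδ hq)]

theorem measurable_afterBounce (hφ : LocalFlow Us R φ) (hD : ContDiff ℝ 1 (potDiff Us Ut))
    (hδ : 0 ≤ δ) : Measurable (afterBounce Us Ut R φ δ) := by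
  have hσ := hφ.measurable_exitTime (isOpen_runRegion (R := R) hD) hδ
  exact hφ.measurable_flow_comp (hσ.const_sub δ)
    ((measurable_bounceAt hD).comp (hφ.measurable_flow_comp hσ measurable_fst))

theorem measurableSet_stepDomain (hφ : LocalFlow Us R φ) (hD : ContDiff ℝ 1 (potDiff Us Ut))
    (hδ : 0 ≤ δ) : MeasurableSet (stepDomain Us Ut R φ δ) := by
  have hσ := hφ.measurable_exitTime (isOpen_runRegion (R := R) hD) hδ
  have hb := hφ.measurable_afterBounce hD hδ
  refine (hφ.isOpen_stayDomain (isOpen_runRegion hD) δ).measurableSet.union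
    ((hφ.measurableSet_hitDomain hD hδ).inter (MeasurableSet.inter ?_ ?_))
  · exact (isOpen_runRegion hD).measurableSet.preimage (hb.prodMk measurable_snd)
  · exact measurableSet_eq_fun
      (hσ.comp ((continuous_phaseFlip.measurable.comp hb).prodMk measurable_snd)) (hσ.const_sub δ)

theorem measurable_stepMap (hφ : LocalFlow Us R φ) (hD : ContDiff ℝ 1 (potDiff Us Ut))
    (hδ : 0 ≤ δ) : Measurable (stepMap Us Ut R φ δ) := by
  refine Measurable.prodMk (Measurable.ite ?_ ?_ (hφ.measurable_afterBounce hD hδ)) measurable_snd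
  · exact (hφ.isOpen_stayDomain (isOpen_runRegion hD) δ).measurableSet
  · exact hφ.measurable_flow_comp measurable_const measurable_fst

/-- The flow for time `δ` followed by the flip preserves volume and, by reversibility, maps the stay
domain into itself. Keeping this domain on the right makes the estimate disjoint from the one for
bounces. -/
theorem volume_stayDomain_inter_le (hφ : LocalFlow Us R φ) (hD : ContDiff ℝ 1 (potDiff Us Ut))
    {B : Set ((Pos d × Pos d) × ℝ)} (hB : MeasurableSet B) :
    volume (stayDomain φ (runRegion Us Ut R) δ ∩ stepMap Us Ut R φ δ ⁻¹' B) ≤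
      volume (levelFlip ⁻¹' B ∩ stayDomain φ (runRegion Us Ut R) δ) := by
  set D := stayDomain φ (runRegion Us Ut R) δ
  have hDm : MeasurableSet D := (hφ.isOpen_stayDomain (isOpen_runRegion hD) δ).measurableSet
  have hmp : MeasurePreserving fun q : (Pos d × Pos d) × ℝ => (φ δ q.1, q.2) :=
    (hφ.mp δ).prod (MeasurePreserving.id volume)
  have hflip := measurePreserving_levelFlip (d := d)
  have hmeas : MeasurableSet (levelFlip ⁻¹' B ∩ D) := (hflip.measurable hB).inter hDm
  have hsub : D ∩ stepMap Us Ut R φ δ ⁻¹' B ⊆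
      (fun q => levelFlip (φ δ q.1, q.2)) ⁻¹' (levelFlip ⁻¹' B ∩ D) := by
    rintro q ⟨hq, hqB⟩
    rw [mem_preimage, stepMap_of_mem_stayDomain hq] at hqB
    refine ⟨by simpa [levelFlip] using hqB, fun s hs => ?_⟩
    have := hq (δ - s) ⟨by linarith [hs.2], by linarith [hs.1]⟩
    simp only [levelFlip, hφ.rev, phaseFlip_mem_runRegion]
    rwa [← hφ.add, neg_add_eq_sub]
  calc volume (D ∩ stepMap Us Ut R φ δ ⁻¹' B) ≤ _ := measure_mono hsub
    _ = volume (levelFlip ⁻¹' B ∩ D) :=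
      (hflip.comp hmp).measure_preimage hmeas.nullMeasurableSet

/-- In hit coordinates `(y, τ)` the measure is `discRate dy dτ`, and the step followed by the flip
becomes `(y, τ) ↦ (phaseFlip (bounceAt y), δ - τ)`, which preserves the rate, `dy` and `dτ`. The
condition on the backward exit time in `bounceDomain` says precisely that the image state has first
hit time `δ - τ`. -/
theorem volume_bounceDomain_inter_le (hφ : LocalFlow Us R φ) (hD : ContDiff ℝ 1 (potDiff Us Ut))
    (hδ : 0 < δ) {B : Set ((Pos d × Pos d) × ℝ)} (hB : MeasurableSet B) :
    volume (bounceDomain Us Ut R φ δ ∩ stepMap Us Ut R φ δ ⁻¹' B) ≤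
      volume (levelFlip ⁻¹' B ∩ hitDomain Us Ut R φ δ) := by
  set O := runRegion Us Ut R with hO_def
  have hO : IsOpen O := isOpen_runRegion hD
  set σ := exitTime φ O δ with hσ_def
  have hσ : Measurable σ := hφ.measurable_exitTime hO hδ.le
  set H := hitDomain Us Ut R φ δ with hH_def
  have hH : MeasurableSet H := hφ.measurableSet_hitDomain hD hδ.le
  have hlev : Measurable fun p : (Pos d × Pos d) × ℝ => potDiff Us Ut p.1.1 :=
    hD.continuous.measurable.comp (measurable_fst.comp measurable_fst)
  set after : (Pos d × Pos d) × ℝ → Pos d × Pos d :=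
    fun p => φ (δ - p.2) (bounceAt Us Ut p.1) with hafter_def
  have hafter : Measurable after := hφ.measurable_flow_comp (measurable_snd.const_sub δ)
    ((measurable_bounceAt hD).comp measurable_fst)
  set C₁ : Set ((Pos d × Pos d) × ℝ) := {p | (after p, potDiff Us Ut p.1.1) ∈ B ∧
    σ (phaseFlip (after p), potDiff Us Ut p.1.1) = δ - p.2} with hC₁_def
  have hC₁ : MeasurableSet C₁ := ((hafter.prodMk hlev) hB).inter (measurableSet_eq_fun
    (hσ.comp ((continuous_phaseFlip.measurable.comp hafter).prodMk hlev))
    (measurable_snd.const_sub δ))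
  set C₂ : Set ((Pos d × Pos d) × ℝ) :=
    {p | (phaseFlip (φ (-p.2) p.1), potDiff Us Ut p.1.1) ∈ B} with hC₂_def
  have hC₂ : MeasurableSet C₂ := ((continuous_phaseFlip.measurable.comp
    (hφ.measurable_flow_comp measurable_snd.neg measurable_fst)).prodMk hlev) hB
  set A := {p : (Pos d × Pos d) × ℝ | p.1 ∈ outRegion Us Ut R ∧
        σ (φ (-p.2) p.1, potDiff Us Ut p.1.1) = p.2} with hA_def
  have hA : MeasurableSet A := hφ.measurableSet_firstHit hD hδ.le
  have hrate : Measurable fun p : (Pos d × Pos d) × ℝ => ENNReal.ofReal (discRate Us Ut p.1) :=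
    ((continuous_discRate hD).measurable.comp measurable_fst).ennreal_ofReal
  have hhit : Measurable fun q : (Pos d × Pos d) × ℝ => (φ (σ q) q.1, σ q) :=
    (hφ.measurable_flow_comp hσ measurable_fst).prodMk hσ
  set ι : Pos d × Pos d → Pos d × Pos d := fun w => phaseFlip (bounceAt Us Ut w) with hι_def
  have hι : MeasurePreserving ι := measurePreserving_phaseFlip_bounceAt hD
  set k : (Pos d × Pos d) × ℝ → ℝ≥0∞ := A.indicator (fun p => ENNReal.ofReal
    (discRate Us Ut p.1) * C₂.indicator 1 p) with hk_def
  have hk : Measurable k := (hrate.mul (measurable_one.indicator hC₂)).indicator hA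
  calc volume (bounceDomain Us Ut R φ δ ∩ stepMap Us Ut R φ δ ⁻¹' B)
      ≤ volume (((fun q => (φ (σ q) q.1, σ q)) ⁻¹' C₁) ∩ H) := by
        refine measure_mono ?_
        rintro q ⟨⟨hq, hq1, hq2⟩, hqB⟩
        rw [mem_preimage, hφ.stepMap_of_mem_hitDomain hD hδ.le hq] at hqB
        have hl : potDiff Us Ut (φ (σ q) q.1).1 = q.2 := hφ.level_at_hit hD hδ hq
        refine ⟨⟨?_, ?_⟩, hq⟩
        · simpa only [hl] using! hqB
        · simpa only [hl] using! hq2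
    _ = ∫⁻ q in H, C₁.indicator 1 (φ (σ q) q.1, σ q) := by
        rw [← Measure.restrict_apply (hhit hC₁), ← lintegral_indicator_one (hhit hC₁)]
        rfl
    _ = ∫⁻ τ in Ioo 0 δ, ∫⁻ y, A.indicator (fun p => ENNReal.ofReal (discRate Us Ut p.1) *
          C₁.indicator 1 p) (y, τ) :=
        hφ.lintegral_hitDomain hD hδ (measurable_one.indicator hC₁)
    _ = ∫⁻ τ in Ioo 0 δ, ∫⁻ y, A.indicator (fun p => ENNReal.ofReal (discRate Us Ut p.1) *
          C₁.indicator 1 p) (ι y, τ) := by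
        refine lintegral_congr fun τ => (hι.lintegral_comp (f := fun y => A.indicator
          (fun p => ENNReal.ofReal (discRate Us Ut p.1) * C₁.indicator 1 p) (y, τ)) ?_).symm
        exact ((hrate.mul (measurable_one.indicator hC₁)).indicator hA).comp
          measurable_prodMk_right
    -- A pointwise inequality: if `(ι y, τ)` is the hit datum of a state whose step ends in `B`,
    -- then `(y, δ - τ)` is the hit datum of the flipped end state, and the two rates agree.
    _ ≤ ∫⁻ τ in Ioo 0 δ, ∫⁻ y, k (y, δ - τ) := by
        refine lintegral_mono fun τ => lintegral_mono fun y => ?_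
        by_cases h1 : (ι y, τ) ∈ A
        · by_cases h2 : (ι y, τ) ∈ C₁
          · have hback : after (ι y, τ) = phaseFlip (φ (-(δ - τ)) y) := by
              simp only [hafter_def, hι_def, bounceAt_phaseFlip, bounceAt_bounceAt, hφ.rev]
            have hrι : discRate Us Ut (ι y) = discRate Us Ut y := by simp [hι_def]
            have h3 : (y, δ - τ) ∈ A := by
              refine ⟨⟨h1.1.1, ?_, ?_⟩, ?_⟩
              · have := h1.1.2.1
                simpa [hι_def, norm_bounceAt_snd] using this
              · simpa only [hrι] using h1.1.2.2
              · have := h2.2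
                simpa only [hback, phaseFlip_phaseFlip] using! this
            have h4 : (y, δ - τ) ∈ C₂ := by
              have := h2.1
              simpa only [hback] using! this
            rw [hk_def, indicator_of_mem h1, indicator_of_mem h2, indicator_of_mem h3,
              indicator_of_mem h4]
            simp only [hrι, Pi.one_apply, le_refl]
          · rw [indicator_of_mem h1, indicator_of_notMem h2]
            simp
        · rw [indicator_of_notMem h1]
          exact bot_le
    _ = ∫⁻ τ in Ioo 0 δ, ∫⁻ y, k (y, τ) := by
        rw [← lintegral_indicator measurableSet_Ioo, ← lintegral_indicator measurableSet_Ioo,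
          ← lintegral_sub_left_eq_self _ δ]
        refine lintegral_congr fun τ => ?_
        by_cases hτ : τ ∈ Ioo 0 δ
        · have hτ' : δ - τ ∈ Ioo 0 δ := ⟨by linarith [hτ.2], by linarith [hτ.1]⟩
          rw [indicator_of_mem hτ, indicator_of_mem hτ', sub_sub_cancel]
        · have hτ' : δ - τ ∉ Ioo 0 δ := fun h => hτ ⟨by linarith [h.2], by linarith [h.1]⟩
          rw [indicator_of_notMem hτ, indicator_of_notMem hτ']
    _ = ∫⁻ q in H, C₂.indicator 1 (φ (σ q) q.1, σ q) :=
        (hφ.lintegral_hitDomain hD hδ (measurable_one.indicator hC₂)).symm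
    _ = volume (((fun q => (φ (σ q) q.1, σ q)) ⁻¹' C₂) ∩ H) := by
        rw [← Measure.restrict_apply (hhit hC₂), ← lintegral_indicator_one (hhit hC₂)]
        rfl
    _ ≤ volume (levelFlip ⁻¹' B ∩ H) := by
        refine measure_mono ?_
        rintro q ⟨hq, hqH⟩
        have hl : potDiff Us Ut (φ (σ q) q.1).1 = q.2 := hφ.level_at_hit hD hδ hqH
        refine ⟨?_, hqH⟩
        simpa only [hC₂_def, mem_preimage, mem_ofPred_eq, hφ.neg_apply_apply, hl] using! hq

/-- The bounds for staying and for bouncing refer to disjoint parts of the flipped set, so they add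
up to at most its volume. -/
theorem volume_stepDomain_inter_le (hφ : LocalFlow Us R φ) (hD : ContDiff ℝ 1 (potDiff Us Ut))
    (hδ : 0 < δ) {B : Set ((Pos d × Pos d) × ℝ)} (hB : MeasurableSet B) :
    volume (stepDomain Us Ut R φ δ ∩ stepMap Us Ut R φ δ ⁻¹' B) ≤ volume B := by
  have hflip := measurePreserving_levelFlip (d := d)
  have hdisj : Disjoint (levelFlip ⁻¹' B ∩ stayDomain φ (runRegion Us Ut R) δ)
      (levelFlip ⁻¹' B ∩ hitDomain Us Ut R φ δ) := by
    rw [Set.disjoint_left]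
    exact fun q h1 h2 => hφ.notMem_stayDomain_of_mem_hitDomain hD hδ.le h2.2 h1.2
  rw [stepDomain, union_inter_distrib_right]
  calc _ ≤ _ := measure_union_le _ _
    _ ≤ _ := add_le_add (hφ.volume_stayDomain_inter_le hD hB)
      (hφ.volume_bounceDomain_inter_le hD hδ hB)
    _ = _ := (measure_union hdisj
      ((hflip.measurable hB).inter (hφ.measurableSet_hitDomain hD hδ.le))).symm
    _ ≤ volume (levelFlip ⁻¹' B) :=
      measure_mono (union_subset inter_subset_left inter_subset_left)
    _ = volume B := hflip.measure_preimage hB.nullMeasurableSet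

end LocalFlow

/-- The states from which `k` successive steps of length `δ` can be made. -/
def chainDomain (Us Ut : Pos d → ℝ) (R : ℝ) (φ : ℝ → Pos d × Pos d → Pos d × Pos d) (δ : ℝ) :
    ℕ → Set ((Pos d × Pos d) × ℝ)
  | 0 => univ
  | k + 1 => stepDomain Us Ut R φ δ ∩ stepMap Us Ut R φ δ ⁻¹' chainDomain Us Ut R φ δ k

namespace LocalFlow

theorem measurableSet_chainDomain (hφ : LocalFlow Us R φ) (hD : ContDiff ℝ 1 (potDiff Us Ut))
    (hδ : 0 ≤ δ) (k : ℕ) : MeasurableSet (chainDomain Us Ut R φ δ k) := by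
  induction k with
  | zero => exact MeasurableSet.univ
  | succ k ih => exact (hφ.measurableSet_stepDomain hD hδ).inter (hφ.measurable_stepMap hD hδ ih)

/-- This lets an exceptional set met at step `k` be pulled back to the initial states without gain
in volume. -/
theorem volume_chainDomain_inter_le (hφ : LocalFlow Us R φ) (hD : ContDiff ℝ 1 (potDiff Us Ut))
    (hδ : 0 < δ) (k : ℕ) {B : Set ((Pos d × Pos d) × ℝ)} (hB : MeasurableSet B) :
    volume (chainDomain Us Ut R φ δ k ∩ (stepMap Us Ut R φ δ)^[k] ⁻¹' B) ≤ volume B := by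
  induction k with
  | zero => simp [chainDomain]
  | succ k ih =>
    refine (le_of_eq ?_).trans ((hφ.volume_stepDomain_inter_le hD hδ
      ((hφ.measurableSet_chainDomain hD hδ.le k).inter
        ((hφ.measurable_stepMap hD hδ.le).iterate k hB))).trans ih)
    congr 1
    rw [chainDomain, inter_assoc, preimage_inter, iterate_succ, preimage_comp]

end LocalFlow

/-- The definition peels off the first step; extending a run requires peeling off the last. -/
theorem mem_chainDomain_succ {k : ℕ} {q : (Pos d × Pos d) × ℝ} :
    q ∈ chainDomain Us Ut R φ δ (k + 1) ↔ q ∈ chainDomain Us Ut R φ δ k ∧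
      (stepMap Us Ut R φ δ)^[k] q ∈ stepDomain Us Ut R φ δ := by
  induction k generalizing q with
  | zero => simp [chainDomain]
  | succ k ih =>
    rw [chainDomain, mem_inter_iff, mem_preimage, ih]
    conv_rhs => rw [chainDomain]
    rw [mem_inter_iff, mem_preimage, iterate_succ, comp_apply, and_assoc]

end StepVolume

/-! ### Steps fail only on sets of small volume -/

section StepExistence

open Filter Function Topology
open scoped NNReal ENNReal RealInnerProductSpace

variable {d : ℕ} {Us Ut : Pos d → ℝ} {R δ : ℝ} {φ : ℝ → Pos d × Pos d → Pos d × Pos d}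

theorem exists_first_mem {C : Set ℝ} (hC : IsClosed C) (T : ℝ) :
    (∀ t ∈ Icc 0 T, t ∉ C) ∨ ∃ s ∈ Icc 0 T, s ∈ C ∧ ∀ t ∈ Ico 0 s, t ∉ C := by
  by_cases h : ∀ t ∈ Icc 0 T, t ∉ C
  · exact Or.inl h
  · push Not at h
    have hne : (Icc 0 T ∩ C).Nonempty := h
    have hbdd : BddBelow (Icc 0 T ∩ C) := ⟨0, fun t ht => ht.1.1⟩
    have hmem := (isClosed_Icc.inter hC).csInf_mem hne hbdd
    refine Or.inr ⟨_, hmem.1, hmem.2, fun t ht htC => ?_⟩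
    exact absurd (csInf_le hbdd ⟨⟨ht.1, ht.2.le.trans hmem.1.2⟩, htC⟩) (not_le.2 ht.2)

/-- The run reaches position or velocity of norm at least `R` by time `T`. -/
def ExitsBy (Us Ut : Pos d → ℝ) (R c T : ℝ) (w : Pos d × Pos d) : Prop :=
  ∃ s ∈ Icc 0 T, ∃ w', GoodRun Us Ut c s w w' ∧ (R ≤ ‖w'.1‖ ∨ R ≤ ‖w'.2‖)

theorem ExitsBy.mono {S T c : ℝ} {w : Pos d × Pos d} (h : ExitsBy Us Ut R c S w) (hST : S ≤ T) :
    ExitsBy Us Ut R c T w := by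
  obtain ⟨s, hs, h⟩ := h
  exact ⟨s, ⟨hs.1, hs.2.trans hST⟩, h⟩

theorem GoodRun.append_exitsBy {S T c : ℝ} {w w₁ : Pos d × Pos d} (h₁ : GoodRun Us Ut c S w w₁)
    (h₂ : ExitsBy Us Ut R c T w₁) : ExitsBy Us Ut R c (S + T) w := by
  obtain ⟨s, hs, w', h, hw'⟩ := h₂
  exact ⟨S + s, ⟨add_nonneg h₁.nonneg hs.1, by linarith [hs.2]⟩, w', h₁.append h, hw'⟩

namespace LocalFlow

theorem isSurrogateSol (hφ : LocalFlow Us R φ) {T : ℝ} {w : Pos d × Pos d}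
    (h : ∀ t ∈ Icc 0 T, ‖(φ t w).1‖ ≤ R ∧ ‖(φ t w).2‖ ≤ R) :
    IsSurrogateSol Us T fun t => φ t w := fun t ht =>
  (hφ.deriv w t (h t ht).1 (h t ht).2).hasDerivWithinAt

/-- `discRate` is uniformly continuous on the ball and the flow is uniformly Lipschitz in time, so
`δ₀` does not depend on the trajectory. -/
theorem exists_oscillation_le (hφ : LocalFlow Us R φ) (hD : ContDiff ℝ 1 (potDiff Us Ut)) {ε : ℝ}
    (hε : 0 < ε) : ∃ δ₀ > 0, ∀ w s t, |s - t| < δ₀ → ‖(φ s w).1‖ ≤ R → ‖(φ s w).2‖ ≤ R →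
      ‖(φ t w).1‖ ≤ R → ‖(φ t w).2‖ ≤ R →
      |discRate Us Ut (φ s w) - discRate Us Ut (φ t w)| ≤ ε := by
  have hu := (isCompact_closedBall (0 : Pos d × Pos d) R).uniformContinuousOn_of_continuous
    (continuous_discRate hD).continuousOn
  obtain ⟨η, hη, hη'⟩ := Metric.uniformContinuousOn_iff.1 hu ε hε
  obtain ⟨L, hL⟩ := hφ.lip
  refine ⟨η / (|L| + 1), by positivity, fun w s t hst h1 h2 h3 h4 => ?_⟩
  refine (hη' (φ s w) (mem_closedBall_zero_iff.2 (max_le h1 h2)) (φ t w)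
    (mem_closedBall_zero_iff.2 (max_le h3 h4)) ?_).le
  rw [dist_eq_norm]
  calc ‖φ s w - φ t w‖ ≤ L * |s - t| := hL _ _ _
    _ ≤ (|L| + 1) * |s - t| := by
        gcongr
        linarith [le_abs_self L]
    _ < η := by
        rwa [lt_div_iff₀ (by positivity), mul_comm] at hst

theorem exists_discRate_eq_slope (hφ : LocalFlow Us R φ) (hD : ContDiff ℝ 1 (potDiff Us Ut))
    {s : ℝ} (hs : 0 < s) {w : Pos d × Pos d}
    (h : ∀ t ∈ Icc 0 s, ‖(φ t w).1‖ ≤ R ∧ ‖(φ t w).2‖ ≤ R) :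
    ∃ ξ ∈ Ioo 0 s, potDiff Us Ut (φ s w).1 - potDiff Us Ut w.1 = discRate Us Ut (φ ξ w) * s := by
  have hc : Continuous fun t => potDiff Us Ut (φ t w).1 :=
    hD.continuous.comp (continuous_fst.comp (hφ.continuous_time w))
  obtain ⟨ξ, hξ, heq⟩ := exists_hasDerivAt_eq_slope (fun t => potDiff Us Ut (φ t w).1)
    (fun t => discRate Us Ut (φ t w)) hs hc.continuousOn fun t ht => by
      have h1 := h t (Ioo_subset_Icc_self ht)
      have := hasDerivWithinAt_potential_comp_fst hD (s := univ)
        (hφ.deriv w t h1.1 h1.2).hasDerivWithinAt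
      exact hasDerivWithinAt_univ.1 this
  refine ⟨ξ, hξ, ?_⟩
  rw [heq, hφ.zero, sub_zero]
  field_simp

theorem exitTime_eq (hφ : LocalFlow Us R φ) {O : Set ((Pos d × Pos d) × ℝ)} (hO : IsOpen O)
    {q : (Pos d × Pos d) × ℝ} {s : ℝ} (hs : s ∈ Icc 0 δ) (hin : ∀ t ∈ Ico 0 s, (φ t q.1, q.2) ∈ O)
    (hout : (φ s q.1, q.2) ∉ O) : exitTime φ O δ q = s := by
  have hm := hφ.exitTime_mem hO (hs.1.trans hs.2) q
  rcases lt_trichotomy (exitTime φ O δ q) s with h | h | h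
  · rcases hm.2 with h' | h'
    · linarith [hs.2]
    · exact absurd (hin _ ⟨hm.1.1, h⟩) h'
  · exact h
  · exact absurd (mem_of_lt_exitTime hs.1 h hs.2) hout

theorem goodRun_of_mem_stepDomain (hφ : LocalFlow Us R φ) (hD : ContDiff ℝ 1 (potDiff Us Ut))
    (hδ : 0 < δ) {q : (Pos d × Pos d) × ℝ} (hq : q ∈ stepDomain Us Ut R φ δ) :
    GoodRun Us Ut q.2 δ q.1 (stepMap Us Ut R φ δ q).1 ∧
      stepMap Us Ut R φ δ q ∈ runRegion Us Ut R := by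
  have hO : IsOpen (runRegion Us Ut R) := isOpen_runRegion hD
  rcases hq with hq | ⟨hq, hend, hback⟩
  · rw [stepMap_of_mem_stayDomain hq]
    refine ⟨.flow (fun t => φ t q.1) hδ.le (hφ.isSurrogateSol fun t ht => ?_) (hφ.zero _) rfl
      fun t ht => (hq t (Ioc_subset_Icc_self ht)).1, hq δ ⟨hδ.le, le_rfl⟩⟩
    exact ⟨(hq t ht).2.1.le, (hq t ht).2.2.le⟩
  · rw [hφ.stepMap_of_mem_hitDomain hD hδ.le hq]
    refine ⟨?_, hend⟩
    have hlev := hφ.level_at_hit hD hδ hq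
    obtain ⟨hq1, hq2, hq3⟩ := hq
    set σ := exitTime φ (runRegion Us Ut R) δ q with hσ
    have hpos : 0 < σ := (hφ.exitTime_pos hD hδ).2 hq1
    have hin : ∀ t ∈ Ico 0 σ, (φ t q.1, q.2) ∈ runRegion Us Ut R := fun t ht =>
      mem_of_lt_exitTime ht.1 ht.2 (ht.2.trans hq2).le
    have hreg : ∀ t ∈ Icc 0 σ, ‖(φ t q.1).1‖ ≤ R ∧ ‖(φ t q.1).2‖ ≤ R := by
      intro t ht
      rcases ht.2.eq_or_lt with rfl | h
      · exact ⟨hq3.1.le, hq3.2.1.le⟩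
      · have := hin t ⟨ht.1, h⟩
        exact ⟨this.2.1.le, this.2.2.le⟩
    set w₁ := bounceAt Us Ut (φ σ q.1) with hw₁
    -- The flipped end point stays in the region before time `δ - σ`; read backwards, this is the
    -- arc after the bounce. Time `0` is excluded because that arc starts on the level.
    have hin₂ : ∀ t ∈ Ioc 0 (δ - σ), (φ t w₁, q.2) ∈ runRegion Us Ut R := by
      intro t ht
      have h1 : (φ (δ - σ - t) (phaseFlip (afterBounce Us Ut R φ δ q)), q.2) ∈
          runRegion Us Ut R := by
        refine mem_of_lt_exitTime (O := runRegion Us Ut R) (δ := δ)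
          (q := (phaseFlip (afterBounce Us Ut R φ δ q), q.2)) (by linarith [ht.2]) ?_
          (by linarith [ht.1])
        rw [hback]
        linarith [ht.1]
      rw [hφ.rev, phaseFlip_mem_runRegion, afterBounce, ← hφ.add] at h1
      rwa [show -(δ - σ - t) + (δ - σ) = t by ring] at h1
    refine .bounce (fun t => φ t q.1) hpos (hφ.isSurrogateSol hreg) (hφ.zero _)
      (fun t ht => (hin t (Ioo_subset_Ico_self ht)).1) hlev hq3.2.2
      (.flow (fun t => φ t w₁) (by linarith) (hφ.isSurrogateSol fun t ht => ?_) (hφ.zero _) rfl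
        fun t ht => (hin₂ t ht).1)
    rcases ht.1.eq_or_lt with rfl | h
    · rw [hφ.zero]
      exact ⟨hq3.1.le, (norm_bounceAt_snd _).trans_le hq3.2.1.le⟩
    · have := hin₂ t ⟨h, ht.2⟩
      exact ⟨this.2.1.le, this.2.2.le⟩

/-- If the inertia is large compared to the oscillation of the rate of change of the discrepancy
over time `δ`, then at most one bounce happens before time `δ`, and it is transversal. -/
theorem mem_stepDomain_or_exitsBy (hφ : LocalFlow Us R φ) (hD : ContDiff ℝ 1 (potDiff Us Ut))
    {ε : ℝ} (hε : 0 < ε)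
    (hosc : ∀ w s t, |s - t| ≤ δ → ‖(φ s w).1‖ ≤ R → ‖(φ s w).2‖ ≤ R →
      ‖(φ t w).1‖ ≤ R → ‖(φ t w).2‖ ≤ R →
      |discRate Us Ut (φ s w) - discRate Us Ut (φ t w)| ≤ ε)
    {q : (Pos d × Pos d) × ℝ} (hq : q ∈ runRegion Us Ut R)
    (hp : 2 * δ * ε < q.2 - potDiff Us Ut q.1.1)
    (hend : potDiff Us Ut (φ δ q.1).1 ≠ q.2) :
    q ∈ stepDomain Us Ut R φ δ ∨ ExitsBy Us Ut R q.2 δ q.1 := by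
  obtain ⟨w, c⟩ := q
  simp only at hp hend ⊢
  set O := runRegion Us Ut R
  have hO : IsOpen O := isOpen_runRegion hD
  have hcurve : ∀ w : Pos d × Pos d, Continuous fun t => (φ t w, c) := fun w =>
    (hφ.continuous_time w).prodMk continuous_const
  rcases exists_first_mem (hO.preimage (hcurve w)).isClosed_compl δ with h | ⟨s₀, hs₀, hout, hin⟩
  · exact Or.inl (Or.inl fun t ht => not_not.1 (h t ht))
  have hin : ∀ t ∈ Ico 0 s₀, (φ t w, c) ∈ O := fun t ht => not_not.1 (hin t ht)
  have hs₀pos : 0 < s₀ := by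
    refine lt_of_le_of_ne hs₀.1 ?_
    rintro rfl
    rw [mem_compl_iff, mem_preimage, hφ.zero] at hout
    exact hout hq
  have hclosed : potDiff Us Ut (φ s₀ w).1 ≤ c ∧ ‖(φ s₀ w).1‖ ≤ R ∧ ‖(φ s₀ w).2‖ ≤ R := by
    have hcl : IsClosed {t | potDiff Us Ut (φ t w).1 ≤ c ∧ ‖(φ t w).1‖ ≤ R ∧ ‖(φ t w).2‖ ≤ R} := by
      have h1 := hφ.continuous_time w
      have h2 := hD.continuous
      have c1 : IsClosed {t | potDiff Us Ut (φ t w).1 ≤ c} :=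
        isClosed_le (by fun_prop) (by fun_prop)
      have c2 : IsClosed {t | ‖(φ t w).1‖ ≤ R} := isClosed_le (by fun_prop) (by fun_prop)
      have c3 : IsClosed {t | ‖(φ t w).2‖ ≤ R} := isClosed_le (by fun_prop) (by fun_prop)
      exact c1.inter (c2.inter c3)
    have hsub : Ico 0 s₀ ⊆ {t | potDiff Us Ut (φ t w).1 ≤ c ∧ ‖(φ t w).1‖ ≤ R ∧
        ‖(φ t w).2‖ ≤ R} := fun t ht =>
      ⟨(hin t ht).1.le, (hin t ht).2.1.le, (hin t ht).2.2.le⟩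
    have := hcl.closure_subset_iff.2 hsub
    rw [closure_Ico hs₀pos.ne] at this
    exact this ⟨hs₀.1, le_rfl⟩
  have hreg : ∀ t ∈ Icc 0 s₀, ‖(φ t w).1‖ ≤ R ∧ ‖(φ t w).2‖ ≤ R := by
    intro t ht
    rcases ht.2.eq_or_lt with rfl | h
    · exact hclosed.2
    · have := hin t ⟨ht.1, h⟩
      exact ⟨this.2.1.le, this.2.2.le⟩
  have hsol := hφ.isSurrogateSol hreg
  -- Either the ball is left while the inertia is still positive, or the inertia has run out.
  rcases hclosed.1.lt_or_eq with hlt | heq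
  · refine Or.inr ⟨s₀, hs₀, φ s₀ w, .flow (fun t => φ t w) hs₀.1 hsol (hφ.zero _) rfl
      fun t ht => ?_, ?_⟩
    · rcases ht.2.eq_or_lt with rfl | h
      · exact hlt
      · exact (hin t ⟨ht.1.le, h⟩).1
    · by_contra! h
      exact hout ⟨hlt, h⟩
  have hs₀δ : s₀ < δ := by
    refine lt_of_le_of_ne hs₀.2 ?_
    rintro rfl
    exact hend heq
  -- An increase of `U_d` by more than `2 * δ * ε` within time `s₀ ≤ δ` needs a rate above `2 * ε`
  -- somewhere; at `s₀` it then exceeds `ε`.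
  have hrate : ε < discRate Us Ut (φ s₀ w) := by
    by_contra! hle
    obtain ⟨ξ, hξ, hslope⟩ := hφ.exists_discRate_eq_slope hD hs₀pos hreg
    rw [heq] at hslope
    have h1 := hreg ξ (Ioo_subset_Icc_self hξ)
    have h2 := hosc w ξ s₀ (by rw [abs_le]; constructor <;> linarith [hξ.1, hξ.2]) h1.1 h1.2
      hclosed.2.1 hclosed.2.2
    have h3 : discRate Us Ut (φ ξ w) ≤ 2 * ε := by linarith [(abs_le.1 h2).2]
    have h4 : discRate Us Ut (φ ξ w) * s₀ ≤ 2 * ε * δ :=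
      mul_le_mul h3 hs₀.2 hs₀.1 (by positivity)
    linarith
  set w₁ := bounceAt Us Ut (φ s₀ w) with hw₁
  have hrun : ∀ {T : ℝ} {w' : Pos d × Pos d}, GoodRun Us Ut c (T - s₀) w₁ w' →
      GoodRun Us Ut c T w w' := fun h =>
    .bounce (fun t => φ t w) hs₀pos hsol (hφ.zero _)
      (fun t ht => (hin t (Ioo_subset_Ico_self ht)).1) heq (hε.trans hrate) h
  by_cases hregs₀ : ‖(φ s₀ w).1‖ < R ∧ ‖(φ s₀ w).2‖ < R
  swap
  · refine Or.inr ⟨s₀, hs₀, w₁, hrun (.flow (fun t => φ t w₁) (by simp)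
      (hφ.isSurrogateSol fun t ht => ?_) (hφ.zero _) (by simp [hφ.zero])
      fun t ht => absurd ht.2 (by simpa using ht.1)), ?_⟩
    · have ht0 : t = 0 := le_antisymm (by simpa using ht.2) ht.1
      rw [ht0, hφ.zero, norm_bounceAt_snd]
      exact hclosed.2
    · rw [norm_bounceAt_snd]
      by_contra! h
      exact hregs₀ h
  -- The reflection makes the rate less than `-ε`. It oscillates by at most `ε`, so it stays
  -- negative and no second hit occurs within the step.
  have hbelow : ∀ s ∈ Ioc 0 (δ - s₀), (∀ t ∈ Icc 0 s, ‖(φ t w₁).1‖ ≤ R ∧ ‖(φ t w₁).2‖ ≤ R) →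
      potDiff Us Ut (φ s w₁).1 < c := by
    intro s hs hreg₁
    by_contra! hge
    obtain ⟨ξ, hξ, hslope⟩ := hφ.exists_discRate_eq_slope hD hs.1 hreg₁
    have h0 : potDiff Us Ut w₁.1 = c := heq
    rw [h0] at hslope
    have h1 : 0 ≤ discRate Us Ut (φ ξ w₁) := by
      by_contra! hneg
      nlinarith [mul_neg_of_neg_of_pos hneg hs.1]
    have h2 := hreg₁ ξ (Ioo_subset_Icc_self hξ)
    have h3 := hreg₁ 0 ⟨le_rfl, hs.1.le⟩
    have h4 := hosc w₁ ξ 0 (by rw [abs_le]; constructor <;> linarith [hξ.1, hξ.2, hs.2, hs₀.1])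
      h2.1 h2.2 h3.1 h3.2
    rw [hφ.zero, hw₁, discRate_bounceAt, ← hw₁] at h4
    linarith [(abs_le.1 h4).2]
  have hregC : IsClosed {t | ¬(‖(φ t w₁).1‖ < R ∧ ‖(φ t w₁).2‖ < R)} := by
    have h1 := hφ.continuous_time w₁
    have c2 : IsOpen {t | ‖(φ t w₁).1‖ < R} := isOpen_lt (by fun_prop) (by fun_prop)
    have c3 : IsOpen {t | ‖(φ t w₁).2‖ < R} := isOpen_lt (by fun_prop) (by fun_prop)
    exact (c2.inter c3).isClosed_compl
  rcases exists_first_mem hregC (δ - s₀) with hstay | ⟨s₁, hs₁, hs₁out, hs₁in⟩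
  · have hstay : ∀ t ∈ Icc 0 (δ - s₀), ‖(φ t w₁).1‖ < R ∧ ‖(φ t w₁).2‖ < R := fun t ht =>
      not_not.1 (hstay t ht)
    have hlow : ∀ t ∈ Ioc 0 (δ - s₀), (φ t w₁, c) ∈ O := fun t ht =>
      ⟨hbelow t ht fun r hr => by
        have := hstay r ⟨hr.1, hr.2.trans ht.2⟩
        exact ⟨this.1.le, this.2.le⟩, hstay t (Ioc_subset_Icc_self ht)⟩
    have hexit : exitTime φ O δ (w, c) = s₀ := hφ.exitTime_eq hO hs₀ hin hout
    have hafter : afterBounce Us Ut R φ δ (w, c) = φ (δ - s₀) w₁ := by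
      rw [afterBounce, hexit]
    refine Or.inl (Or.inr ⟨⟨hq, ?_, ?_⟩, ?_, ?_⟩)
    · rw [hexit]
      exact hs₀δ
    · rw [hexit]
      exact ⟨hregs₀.1, hregs₀.2, hε.trans hrate⟩
    · rw [hafter]
      exact hlow _ ⟨by linarith, le_rfl⟩
    · rw [hafter, hexit]
      refine hφ.exitTime_eq hO ⟨by linarith, by linarith⟩ (fun t ht => ?_) ?_
      · simp only [hφ.rev, phaseFlip_mem_runRegion, ← hφ.add, O]
        exact hlow _ ⟨by linarith [ht.2], by linarith [ht.1]⟩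
      · simp only [hφ.rev, phaseFlip_mem_runRegion, ← hφ.add, O, neg_add_cancel, hφ.zero]
        exact fun h => h.1.ne heq
  · have hs₁pos : 0 < s₁ := by
      refine lt_of_le_of_ne hs₁.1 ?_
      rintro rfl
      refine hs₁out ?_
      rw [hφ.zero, norm_bounceAt_snd]
      exact hregs₀
    have hreg₁ : ∀ t ∈ Icc 0 s₁, ‖(φ t w₁).1‖ ≤ R ∧ ‖(φ t w₁).2‖ ≤ R := by
      have hcl : IsClosed {t | ‖(φ t w₁).1‖ ≤ R ∧ ‖(φ t w₁).2‖ ≤ R} := by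
        have h1 := hφ.continuous_time w₁
        have c2 : IsClosed {t | ‖(φ t w₁).1‖ ≤ R} := isClosed_le (by fun_prop) (by fun_prop)
        have c3 : IsClosed {t | ‖(φ t w₁).2‖ ≤ R} := isClosed_le (by fun_prop) (by fun_prop)
        exact c2.inter c3
      have hsub : Ico 0 s₁ ⊆ {t | ‖(φ t w₁).1‖ ≤ R ∧ ‖(φ t w₁).2‖ ≤ R} := fun t ht => by
        have := not_not.1 (hs₁in t ht)
        exact ⟨this.1.le, this.2.le⟩
      have := hcl.closure_subset_iff.2 hsub
      rwa [closure_Ico hs₁pos.ne] at this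
    have hend₁ : GoodRun Us Ut c s₁ w₁ (φ s₁ w₁) :=
      .flow (fun t => φ t w₁) hs₁.1 (hφ.isSurrogateSol hreg₁) (hφ.zero _) rfl fun t ht =>
        hbelow t ⟨ht.1, ht.2.trans hs₁.2⟩ fun r hr => hreg₁ r ⟨hr.1, hr.2.trans ht.2⟩
    refine Or.inr ⟨s₀ + s₁, ⟨by linarith, by linarith [hs₁.2]⟩, φ s₁ w₁,
      hrun (by rwa [add_sub_cancel_left]), ?_⟩
    by_contra! h
    exact hs₁out h

theorem goodRun_of_mem_chainDomain (hφ : LocalFlow Us R φ) (hD : ContDiff ℝ 1 (potDiff Us Ut))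
    (hδ : 0 < δ) {q : (Pos d × Pos d) × ℝ} (hq : q ∈ runRegion Us Ut R) {k : ℕ}
    (h : q ∈ chainDomain Us Ut R φ δ k) :
    GoodRun Us Ut q.2 (k * δ) q.1 ((stepMap Us Ut R φ δ)^[k] q).1 ∧
      ((stepMap Us Ut R φ δ)^[k] q).2 = q.2 ∧
      (stepMap Us Ut R φ δ)^[k] q ∈ runRegion Us Ut R := by
  induction k with
  | zero =>
    refine ⟨.flow (fun t => φ t q.1) (by simp) (hφ.isSurrogateSol fun t ht => ?_) (hφ.zero _)
      (by simp [hφ.zero]) fun t ht => absurd ht.2 (by simpa using ht.1), rfl, hq⟩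
    have ht0 : t = 0 := le_antisymm (by simpa using ht.2) ht.1
    rw [ht0, hφ.zero]
    exact ⟨hq.2.1.le, hq.2.2.le⟩
  | succ k ih =>
    rw [mem_chainDomain_succ] at h
    obtain ⟨h1, h2, h3⟩ := ih h.1
    obtain ⟨h4, h5⟩ := hφ.goodRun_of_mem_stepDomain hD hδ h.2
    rw [iterate_succ_apply']
    refine ⟨?_, h2, h5⟩
    rw [h2] at h4
    have := h1.append h4
    rwa [show ((k + 1 : ℕ) : ℝ) * δ = k * δ + δ by push_cast; ring]

end LocalFlow

/-- States near the boundary of the region where a step may fail. -/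
def stepBad (Us Ut : Pos d → ℝ) (R : ℝ) (φ : ℝ → Pos d × Pos d → Pos d × Pos d) (δ ε : ℝ) :
    Set ((Pos d × Pos d) × ℝ) :=
  {q | q.1 ∈ Metric.closedBall 0 R ∧ q.2 - potDiff Us Ut q.1.1 ∈ Icc 0 (2 * δ * ε)} ∪
    {q | potDiff Us Ut (φ δ q.1).1 = q.2}

namespace LocalFlow

theorem measurableSet_stepBad (hφ : LocalFlow Us R φ) (hD : ContDiff ℝ 1 (potDiff Us Ut))
    (δ ε : ℝ) : MeasurableSet (stepBad Us Ut R φ δ ε) := by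
  have hlev : Measurable fun p : (Pos d × Pos d) × ℝ => potDiff Us Ut p.1.1 :=
    hD.continuous.measurable.comp (measurable_fst.comp measurable_fst)
  refine MeasurableSet.union (MeasurableSet.inter ?_ ?_) ?_
  · exact Metric.isClosed_closedBall.measurableSet.preimage measurable_fst
  · exact measurableSet_Icc.preimage (measurable_snd.sub hlev)
  · exact measurableSet_eq_fun (hD.continuous.measurable.comp
      (measurable_fst.comp (hφ.measurable_flow_comp measurable_const measurable_fst)))
      measurable_snd

/-- For fixed `w`, the bad levels form an interval of length `2 * δ * ε`, present only for `w` in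
the ball, and a single point for a hit exactly at time `δ`. -/
theorem volume_stepBad_le (hφ : LocalFlow Us R φ) (hD : ContDiff ℝ 1 (potDiff Us Ut))
    (δ ε : ℝ) : volume (stepBad Us Ut R φ δ ε) ≤
      ENNReal.ofReal (2 * δ * ε) * volume (Metric.closedBall (0 : Pos d × Pos d) R) := by
  have hm := hφ.measurableSet_stepBad hD (Ut := Ut) δ ε
  rw [Measure.volume_eq_prod, Measure.prod_apply hm]
  have hfib : ∀ w : Pos d × Pos d, volume (Prod.mk w ⁻¹' stepBad Us Ut R φ δ ε) ≤
      (Metric.closedBall (0 : Pos d × Pos d) R).indicator (fun _ => ENNReal.ofReal (2 * δ * ε)) w := by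
    intro w
    have hsing : volume {potDiff Us Ut (φ δ w).1} = 0 := Real.volume_singleton
    by_cases hw : w ∈ Metric.closedBall (0 : Pos d × Pos d) R
    · rw [indicator_of_mem hw]
      have hsub : Prod.mk w ⁻¹' stepBad Us Ut R φ δ ε ⊆
          Icc (potDiff Us Ut w.1) (potDiff Us Ut w.1 + 2 * δ * ε) ∪ {potDiff Us Ut (φ δ w).1} := by
        rintro c (⟨-, h1, h2⟩ | h)
        · exact Or.inl ⟨by linarith [h1], by linarith [h2]⟩
        · exact Or.inr (Eq.symm h)
      refine (measure_mono hsub).trans ((measure_union_le _ _).trans ?_)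
      rw [hsing, add_zero, Real.volume_Icc, add_sub_cancel_left]
    · rw [indicator_of_notMem hw]
      refine (measure_mono ?_).trans hsing.le
      rintro c (⟨h1, -⟩ | h)
      · exact absurd h1 hw
      · exact Eq.symm h
  refine (lintegral_mono hfib).trans ?_
  rw [lintegral_indicator_const Metric.isClosed_closedBall.measurableSet]

theorem chain_or_exits (hφ : LocalFlow Us R φ) (hD : ContDiff ℝ 1 (potDiff Us Ut)) (hδ : 0 < δ)
    {ε : ℝ} (hε : 0 < ε)
    (hosc : ∀ w s t, |s - t| ≤ δ → ‖(φ s w).1‖ ≤ R → ‖(φ s w).2‖ ≤ R →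
      ‖(φ t w).1‖ ≤ R → ‖(φ t w).2‖ ≤ R →
      |discRate Us Ut (φ s w) - discRate Us Ut (φ t w)| ≤ ε)
    {q : (Pos d × Pos d) × ℝ} (hq : q ∈ runRegion Us Ut R) (k : ℕ)
    (hbad : ∀ j < k, q ∈ chainDomain Us Ut R φ δ j →
      (stepMap Us Ut R φ δ)^[j] q ∉ stepBad Us Ut R φ δ ε) :
    q ∈ chainDomain Us Ut R φ δ k ∨ ExitsBy Us Ut R q.2 (k * δ) q.1 := by
  induction k with
  | zero => exact Or.inl trivial
  | succ k ih =>
    have hle : (k : ℝ) * δ ≤ (k + 1 : ℕ) * δ := by push_cast; nlinarith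
    rcases ih fun j hj => hbad j (by omega) with h | h
    · obtain ⟨h1, h2, h3⟩ := hφ.goodRun_of_mem_chainDomain hD hδ hq h
      have hnb := hbad k (by omega) h
      set q' := (stepMap Us Ut R φ δ)^[k] q
      have hp : 2 * δ * ε < q'.2 - potDiff Us Ut q'.1.1 := by
        by_contra! hle
        refine hnb (Or.inl ⟨?_, by linarith [h3.1], hle⟩)
        rw [mem_closedBall_zero_iff]
        exact max_le h3.2.1.le h3.2.2.le
      rcases hφ.mem_stepDomain_or_exitsBy hD hε hosc h3 hp fun h => hnb (Or.inr h) with h4 | h4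
      · exact Or.inl (mem_chainDomain_succ.2 ⟨h, h4⟩)
      · right
        rw [h2] at h4
        have := h1.append_exitsBy h4
        rwa [show ((k + 1 : ℕ) : ℝ) * δ = k * δ + δ by push_cast; ring]
    · exact Or.inr (h.mono hle)

/-- Up to a set of small measure, the dynamics can be run up to time `T` in finitely many steps,
unless they leave the region. -/
theorem exists_chain_approximation (hφ : LocalFlow Us R φ) (hD : ContDiff ℝ 1 (potDiff Us Ut))
    {T : ℝ} (hT : 0 ≤ T) {η : ℝ≥0∞} (hη : 0 < η) :
    ∃ (δ : ℝ) (k : ℕ) (A : Set ((Pos d × Pos d) × ℝ)), 0 < δ ∧ k * δ = T ∧ MeasurableSet A ∧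
      volume A ≤ η ∧ ∀ q ∈ runRegion Us Ut R, q ∉ A →
        q ∈ chainDomain Us Ut R φ δ k ∨ ExitsBy Us Ut R q.2 T q.1 := by
  rcases hT.eq_or_lt with rfl | hT
  · exact ⟨1, 0, ∅, one_pos, by simp, MeasurableSet.empty, by simp, fun q _ _ => Or.inl trivial⟩
  set V := volume (Metric.closedBall (0 : Pos d × Pos d) R) with hV
  have hVtop : V ≠ ∞ := (isCompact_closedBall _ _).measure_lt_top.ne
  -- `ε` is fixed before `δ`: the `T / δ` steps cost `2 * δ * ε * V` each, so `δ` cancels from the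
  -- total.
  obtain ⟨ε, hε, hεη⟩ : ∃ ε : ℝ, 0 < ε ∧ ENNReal.ofReal (2 * T * ε) * V ≤ η := by
    have hlim : Tendsto (fun ε : ℝ => ENNReal.ofReal (2 * T * ε) * V) (𝓝[>] 0) (𝓝 0) := by
      have h1 : Tendsto (fun ε : ℝ => ENNReal.ofReal (2 * T * ε)) (𝓝[>] 0) (𝓝 0) := by
        have h0 : Tendsto (fun ε : ℝ => 2 * T * ε) (𝓝[>] 0) (𝓝 0) := by
          have hc : Continuous fun ε : ℝ => 2 * T * ε := by fun_prop
          have := hc.tendsto 0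
          rw [mul_zero] at this
          exact this.mono_left nhdsWithin_le_nhds
        simpa using ENNReal.tendsto_ofReal h0
      simpa using ENNReal.Tendsto.mul_const h1 (Or.inr hVtop)
    obtain ⟨ε, h1, h2⟩ := ((hlim.eventually (gt_mem_nhds hη)).and self_mem_nhdsWithin).exists
    exact ⟨ε, h2, h1.le⟩
  obtain ⟨δ₀, hδ₀, hosc⟩ := hφ.exists_oscillation_le hD hε
  obtain ⟨k, hk⟩ := exists_nat_gt (T / δ₀)
  have hkpos : (0 : ℝ) < k := (by positivity : (0 : ℝ) < T / δ₀).trans hk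
  have hδpos : 0 < T / k := by positivity
  have hδlt : T / k < δ₀ := by
    rw [div_lt_iff₀ hδ₀] at hk
    rwa [div_lt_iff₀ hkpos, mul_comm]
  have hkδ : (k : ℝ) * (T / k) = T := by field_simp
  set δ := T / k with hδ
  have hbadm := hφ.measurableSet_stepBad hD (Ut := Ut) δ ε
  refine ⟨δ, k, ⋃ j ∈ Finset.range k, chainDomain Us Ut R φ δ j ∩
    (stepMap Us Ut R φ δ)^[j] ⁻¹' stepBad Us Ut R φ δ ε, hδpos, hkδ, ?_, ?_, fun q hq hqA => ?_⟩
  · exact Finset.measurableSet_biUnion _ fun j _ => (hφ.measurableSet_chainDomain hD hδpos.le j).inter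
      ((hφ.measurable_stepMap hD hδpos.le).iterate j hbadm)
  · calc _ ≤ ∑ j ∈ Finset.range k, _ := measure_biUnion_finset_le _ _
      _ ≤ ∑ j ∈ Finset.range k, ENNReal.ofReal (2 * δ * ε) * V := Finset.sum_le_sum fun j _ =>
          (hφ.volume_chainDomain_inter_le hD hδpos j hbadm).trans (hφ.volume_stepBad_le hD δ ε)
      _ = ENNReal.ofReal (2 * T * ε) * V := by
          rw [Finset.sum_const, Finset.card_range, nsmul_eq_mul, ← mul_assoc,
            ← ENNReal.ofReal_natCast, ← ENNReal.ofReal_mul hkpos.le]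
          congr 2
          rw [← hkδ]
          ring
      _ ≤ η := hεη
  · rw [← hkδ]
    refine hφ.chain_or_exits hD hδpos hε (fun w s t h => hosc w s t (h.trans_lt hδlt)) hq k
      fun j hj hjc hjb => hqA ?_
    simp only [mem_iUnion, Finset.mem_range]
    exact ⟨j, hj, hjc, hjb⟩

end LocalFlow

end StepExistence

/-! ### Null exceptional sets, non-explosion, volume preservation and detailed balance -/

section Main

open Filter Function Topology
open scoped NNReal ENNReal RealInnerProductSpace

variable {d : ℕ} {Us Ut : Pos d → ℝ}

/-- The phase point and the conserved level `p + U_d(x)` of a state. -/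
def toLevel (Us Ut : Pos d → ℝ) (z : BState d) : (Pos d × Pos d) × ℝ :=
  ((z.1, z.2.1), z.2.2 + potDiff Us Ut z.1)

theorem stateAt_toLevel (z : BState d) :
    stateAt Us Ut (toLevel Us Ut z).2 (toLevel Us Ut z).1 = z := by
  simp [stateAt, toLevel]

theorem potDiff_lt_toLevel {z : BState d} (hz : 0 < z.2.2) :
    potDiff Us Ut (toLevel Us Ut z).1.1 < (toLevel Us Ut z).2 := by
  simpa [toLevel] using hz

/-- Up to reassociation, this translates the inertia by a function of the position. -/
theorem measurePreserving_toLevel (hD : ContDiff ℝ 1 (potDiff Us Ut)) :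
    MeasurePreserving (toLevel Us Ut) := by
  have h1 : MeasurePreserving (MeasurableEquiv.prodAssoc.symm : BState d ≃ᵐ (Pos d × Pos d) × ℝ) :=
    (volume_preserving_prodAssoc (α₁ := Pos d) (β₁ := Pos d) (γ₁ := ℝ)).symm
  have h2 : MeasurePreserving fun q : (Pos d × Pos d) × ℝ => (q.1, q.2 + potDiff Us Ut q.1.1) := by
    refine MeasurePreserving.skew_product (f := id) (g := fun (w : Pos d × Pos d) p => p + potDiff Us Ut w.1)
      (MeasurePreserving.id _) ?_ (ae_of_all _ fun x => (measurePreserving_add_right _ _).map_eq)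
    exact measurable_snd.add (hD.continuous.measurable.comp (measurable_fst.comp measurable_fst))
  exact h2.comp h1

theorem measurable_stateAt (hD : ContDiff ℝ 1 (potDiff Us Ut)) :
    Measurable fun q : (Pos d × Pos d) × ℝ => stateAt Us Ut q.2 q.1 := by
  have : Measurable fun q : (Pos d × Pos d) × ℝ => potDiff Us Ut q.1.1 :=
    hD.continuous.measurable.comp (measurable_fst.comp measurable_fst)
  exact (measurable_fst.comp measurable_fst).prodMk
    ((measurable_snd.comp measurable_fst).prodMk (measurable_snd.sub this))

theorem flipVel_stateAt (c : ℝ) (w : Pos d × Pos d) :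
    flipVel (stateAt Us Ut c w) = stateAt Us Ut c (phaseFlip w) := rfl

@[simp] theorem flipVel_flipVel (z : BState d) : flipVel (flipVel z) = z := by
  simp [flipVel]

theorem augEnergy_flipVel (z : BState d) : augEnergy Ut (flipVel z) = augEnergy Ut z := by
  simp [augEnergy, flipVel]

theorem goodRun_zero (c : ℝ) (w : Pos d × Pos d) : GoodRun Us Ut c 0 w w := by
  refine .flow (fun t => (w.1 + t • w.2, w.2 - t • gradient Us w.1)) le_rfl (fun t ht => ?_)
    (by simp) (by simp) fun t ht => absurd ht.1 (not_lt.2 ht.2)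
  have ht0 : t = 0 := le_antisymm ht.2 ht.1
  have h1 : HasDerivAt (fun t : ℝ => w.1 + t • w.2) w.2 t := by
    simpa using ((hasDerivAt_id t).smul_const w.2).const_add w.1
  have h2 : HasDerivAt (fun t : ℝ => w.2 - t • gradient Us w.1) (-gradient Us w.1) t := by
    simpa using ((hasDerivAt_id t).smul_const (gradient Us w.1)).const_sub w.2
  have := (h1.prodMk h2).hasDerivWithinAt (s := Icc 0 0)
  simpa [ht0] using! this

/-- The states with positive inertia from which the dynamics up to time `T` neither run with
transversal bounces only, nor reach position or velocity of norm at least `R`. -/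
def irregularSet (Us Ut : Pos d → ℝ) (R T : ℝ) : Set (BState d) :=
  {z | 0 < z.2.2 ∧ ¬((∃ w', GoodRun Us Ut (toLevel Us Ut z).2 T (toLevel Us Ut z).1 w' ∧
    potDiff Us Ut w'.1 < (toLevel Us Ut z).2) ∨
    ExitsBy Us Ut R (toLevel Us Ut z).2 T (toLevel Us Ut z).1)}

/-- A large part of the domain of the dynamics is measurable, and there the dynamics are given by
a measurable map that does not shrink volumes. -/
theorem exists_measurable_approximation (hUs : ContDiff ℝ 2 Us) (hUt : ContDiff ℝ 1 Ut)
    {R T : ℝ} (hR : 0 ≤ R) (hT : 0 ≤ T) {η : ℝ≥0∞} (hη : 0 < η) :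
    ∃ (C A : Set (BState d)) (Ψ : BState d → BState d), MeasurableSet C ∧ Measurable Ψ ∧
      volume A ≤ η ∧
      (∀ z ∈ C, 0 < z.2.2 ∧ ∃ w', GoodRun Us Ut (toLevel Us Ut z).2 T (toLevel Us Ut z).1 w' ∧
        potDiff Us Ut w'.1 < (toLevel Us Ut z).2 ∧ Ψ z = stateAt Us Ut (toLevel Us Ut z).2 w') ∧
      (∀ B, MeasurableSet B → volume (C ∩ Ψ ⁻¹' B) ≤ volume B) ∧
      ∀ z : BState d, 0 < z.2.2 → z ∈ C ∨ z ∈ A ∨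
        ExitsBy Us Ut R (toLevel Us Ut z).2 T (toLevel Us Ut z).1 := by
  have hD := contDiff_potDiff hUs hUt
  obtain ⟨φ, hφ⟩ := exists_localFlow hUs hR
  obtain ⟨δ, k, A, hδ, hkδ, hAm, hA, hchain⟩ := hφ.exists_chain_approximation hD hT hη
  have hJ := measurePreserving_toLevel hD
  have hO := (isOpen_runRegion (R := R) hD).measurableSet
  have hCm := hφ.measurableSet_chainDomain hD hδ.le k
  have hSm := (hφ.measurable_stepMap hD hδ.le).iterate k
  refine ⟨toLevel Us Ut ⁻¹' (runRegion Us Ut R ∩ chainDomain Us Ut R φ δ k),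
    toLevel Us Ut ⁻¹' A, fun z => stateAt Us Ut ((stepMap Us Ut R φ δ)^[k] (toLevel Us Ut z)).2
      ((stepMap Us Ut R φ δ)^[k] (toLevel Us Ut z)).1, hJ.measurable (hO.inter hCm),
    (measurable_stateAt hD).comp (hSm.comp hJ.measurable), ?_, fun z hz => ?_, fun B hB => ?_,
    fun z hz => ?_⟩
  · rwa [hJ.measure_preimage hAm.nullMeasurableSet]
  · obtain ⟨h1, h2, h3⟩ := hφ.goodRun_of_mem_chainDomain hD hδ hz.1 hz.2
    refine ⟨by simpa [toLevel] using hz.1.1, _, hkδ ▸ h1, ?_, by simp only [h2]⟩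
    have := h3.1
    rwa [h2] at this
  · set B' := (fun q : (Pos d × Pos d) × ℝ => stateAt Us Ut q.2 q.1) ⁻¹' B
    have hB' : MeasurableSet B' := measurable_stateAt hD hB
    have hBB' : toLevel Us Ut ⁻¹' B' = B := by
      ext z
      simp only [B', mem_preimage, stateAt_toLevel]
    calc _ ≤ volume (toLevel Us Ut ⁻¹' (chainDomain Us Ut R φ δ k ∩
          (stepMap Us Ut R φ δ)^[k] ⁻¹' B')) :=
          measure_mono fun z hz => ⟨hz.1.2, hz.2⟩
      _ = volume (chainDomain Us Ut R φ δ k ∩ (stepMap Us Ut R φ δ)^[k] ⁻¹' B') :=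
          hJ.measure_preimage (hCm.inter (hSm hB')).nullMeasurableSet
      _ ≤ volume B' := hφ.volume_chainDomain_inter_le hD hδ k hB'
      _ = volume B := by rw [← hJ.measure_preimage hB'.nullMeasurableSet, hBB']
  · by_cases hreg : ‖z.1‖ < R ∧ ‖z.2.1‖ < R
    · have hmem : toLevel Us Ut z ∈ runRegion Us Ut R := ⟨potDiff_lt_toLevel hz, hreg⟩
      by_cases hzA : z ∈ toLevel Us Ut ⁻¹' A
      · exact Or.inr (Or.inl hzA)
      · rcases hchain _ hmem hzA with h | h
        · exact Or.inl ⟨hmem, h⟩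
        · exact Or.inr (Or.inr h)
    · refine Or.inr (Or.inr ⟨0, ⟨le_rfl, hT⟩, _, goodRun_zero _ _, ?_⟩)
      by_contra! h
      exact hreg h

/-- The irregular set lies in the exceptional set `A` of every approximation, whose volume is
arbitrarily small. -/
theorem volume_irregularSet (hUs : ContDiff ℝ 2 Us) (hUt : ContDiff ℝ 1 Ut) {R T : ℝ} (hR : 0 ≤ R)
    (hT : 0 ≤ T) : volume (irregularSet Us Ut R T) = 0 := by
  refine le_antisymm (le_of_forall_gt fun η hη => ?_) bot_le
  obtain ⟨η', hη', hlt⟩ := exists_between hη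
  obtain ⟨C, A, Ψ, -, -, hA, hC, -, hall⟩ := exists_measurable_approximation hUs hUt hR hT hη'
  refine ((measure_mono fun z hz => ?_).trans hA).trans_lt hlt
  rcases hall z hz.1 with h | h | h
  · obtain ⟨-, w', h1, h2, -⟩ := hC z h
    exact absurd (Or.inl ⟨w', h1, h2⟩) hz.2
  · exact h
  · exact absurd (Or.inr h) hz.2

theorem volume_inertia_eq_zero : volume {z : BState d | z.2.2 = 0} = 0 := by
  have h1 : {z : BState d | z.2.2 = 0} = univ ×ˢ (univ ×ˢ {0}) := by
    ext z
    simp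
  rw [h1, Measure.volume_eq_prod, Measure.prod_prod, Measure.volume_eq_prod (Pos d) ℝ,
    Measure.prod_prod, Real.volume_singleton, mul_zero, mul_zero]

theorem BouncyRun.exists_notMem_exitsBy (hUs : ContDiff ℝ 2 Us) {T : ℝ} {z z' : BState d}
    (h : BouncyRun Us Ut T z z') :
    ∃ B, ∀ R > B, ¬ExitsBy Us Ut R (toLevel Us Ut z).2 T (toLevel Us Ut z).1 := by
  obtain ⟨B, hB⟩ := h.exists_bound hUs
  refine ⟨B, fun R hR ⟨s, hs, w', hrun, hw'⟩ => ?_⟩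
  have h1 := hrun.toBouncyRun
  rw [stateAt_toLevel] at h1
  have h2 := hB s hs _ h1
  rcases hw' with h | h
  · exact absurd (h.trans h2.1) (not_le.2 hR)
  · exact absurd (h.trans h2.2) (not_le.2 hR)

theorem GoodRun.exists_subrun {c S T : ℝ} {w w' : Pos d × Pos d} (h : GoodRun Us Ut c T w w')
    (hS : S ∈ Icc 0 T) : ∃ u, GoodRun Us Ut c S w u := by
  obtain ⟨Z, -, hZ⟩ := h.exists_subruns
  obtain ⟨u, hu, -⟩ := hZ S hS
  exact ⟨u, hu⟩

/-- Regularity up to the integer times makes all runs transversal. -/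
theorem BouncyRun.exists_goodRun (hUs : ContDiff ℝ 2 Us) {T : ℝ} {z z' : BState d}
    (h : BouncyRun Us Ut T z z') (hz : 0 < z.2.2)
    (hreg : ∀ n R : ℕ, z ∉ irregularSet Us Ut R n) :
    ∃ w', GoodRun Us Ut (toLevel Us Ut z).2 T (toLevel Us Ut z).1 w' ∧
      z' = stateAt Us Ut (toLevel Us Ut z).2 w' := by
  obtain ⟨B, hB⟩ := h.exists_notMem_exitsBy hUs
  obtain ⟨R, hR⟩ := exists_nat_gt B
  obtain ⟨n, hn⟩ := exists_nat_ge T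
  have key : ∃ w', GoodRun Us Ut (toLevel Us Ut z).2 T (toLevel Us Ut z).1 w' := by
    have := hreg n R
    simp only [irregularSet, mem_ofPred_eq, hz, true_and, not_not] at this
    rcases this with ⟨w', hw', -⟩ | ⟨s, hs, w', hw', hout⟩
    · exact hw'.exists_subrun ⟨h.nonneg, hn⟩
    · rcases le_or_gt T s with hTs | hTs
      · exact hw'.exists_subrun ⟨h.nonneg, hTs⟩
      · exact absurd ⟨s, ⟨hs.1, hTs.le⟩, w', hw', hout⟩ (hB R hR)
  obtain ⟨w', hw'⟩ := key
  have h2 := hw'.toBouncyRun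
  rw [stateAt_toLevel] at h2
  exact ⟨w', hw', h.deterministic hUs h2⟩

/-- Regularity at `T` itself, unlike at integer times, also gives positive inertia at `T`, which
reversal needs. The price is a null set depending on `T`. -/
theorem BouncyRun.exists_goodRun_of_notMem (hUs : ContDiff ℝ 2 Us) {T : ℝ} {z z' : BState d}
    (h : BouncyRun Us Ut T z z') (hz : 0 < z.2.2)
    (hreg : ∀ R : ℕ, z ∉ irregularSet Us Ut R T) :
    ∃ w', GoodRun Us Ut (toLevel Us Ut z).2 T (toLevel Us Ut z).1 w' ∧
      potDiff Us Ut w'.1 < (toLevel Us Ut z).2 ∧ z' = stateAt Us Ut (toLevel Us Ut z).2 w' := by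
  obtain ⟨B, hB⟩ := h.exists_notMem_exitsBy hUs
  obtain ⟨R, hR⟩ := exists_nat_gt B
  have := hreg R
  simp only [irregularSet, mem_ofPred_eq, hz, true_and, not_not] at this
  rcases this with ⟨w', hw', hlt⟩ | hex
  · have h2 := hw'.toBouncyRun
    rw [stateAt_toLevel] at h2
    exact ⟨w', hw', hlt, h.deterministic hUs h2⟩
  · exact absurd hex (hB R hR)

theorem GoodRun.mem_bouncyDomain {T : ℝ} {z : BState d} (hz : 0 ≤ z.2.2) {w' : Pos d × Pos d}
    (h : GoodRun Us Ut (toLevel Us Ut z).2 T (toLevel Us Ut z).1 w') :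
    z ∈ bouncyDomain Us Ut T := by
  have h2 := h.toBouncyRun
  rw [stateAt_toLevel] at h2
  exact ⟨hz, _, h2⟩

/-- A regular state without a run up to `T` must exit every ball of phase space before `T`. If the
position stayed bounded, conservation of the surrogate energy would bound the velocity too. -/
theorem exists_run_norm_gt (hUs : ContDiff ℝ 2 Us) {T : ℝ} (hT : 0 ≤ T) {z : BState d}
    (hz : 0 < z.2.2) (hreg : ∀ n R : ℕ, z ∉ irregularSet Us Ut R n)
    (hzT : z ∉ bouncyDomain Us Ut T) (B : ℝ) :
    ∃ t ∈ Ico 0 T, ∃ z', BouncyRun Us Ut t z z' ∧ B < ‖z'.1‖ := by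
  by_contra! hcon
  obtain ⟨m, hm⟩ := (isCompact_closedBall (0 : Pos d) B).exists_bound_of_continuousOn
    hUs.continuous.continuousOn
  set e := Us z.1 + ‖z.2.1‖ ^ 2 / 2 with he
  -- With `‖x‖ ≤ B` and `-m ≤ U_s(x)`, energy gives `‖v‖ ^ 2 ≤ 2 * (e + m) < R < R ^ 2`, so neither
  -- norm reaches `R`.
  obtain ⟨R, hR⟩ := exists_nat_gt (max (max B 1) (2 * (e + m)))
  have hRB : B < R := ((le_max_left _ _).trans (le_max_left _ _)).trans_lt hR
  have hR1 : (1 : ℝ) < R := ((le_max_right _ _).trans (le_max_left _ _)).trans_lt hR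
  have hRe : 2 * (e + m) < R := (le_max_right _ _).trans_lt hR
  obtain ⟨n, hn⟩ := exists_nat_ge T
  have := hreg n R
  simp only [irregularSet, mem_ofPred_eq, hz, true_and, not_not] at this
  rcases this with ⟨w', hw', -⟩ | ⟨s, hs, w', hw', hout⟩
  · obtain ⟨u, hu⟩ := hw'.exists_subrun ⟨hT, hn⟩
    exact hzT (hu.mem_bouncyDomain hz.le)
  · rcases le_or_gt T s with hTs | hTs
    · obtain ⟨u, hu⟩ := hw'.exists_subrun ⟨hT, hTs⟩
      exact hzT (hu.mem_bouncyDomain hz.le)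
    · have hrun := hw'.toBouncyRun
      rw [stateAt_toLevel] at hrun
      have hx := hcon s ⟨hs.1, hTs⟩ _ hrun
      simp only [stateAt] at hx
      have hen := hrun.surrogate_energy_eq hUs
      rw [← he] at hen
      have hlow := (abs_le.1 (hm w'.1 (by simpa using hx))).1
      simp only [stateAt] at hen
      rcases hout with h | h
      · linarith
      · nlinarith [norm_nonneg w'.2]

/-- Gronwall's inequality: the derivative of `1 + ‖x‖²` is at most `‖x‖² + ‖v‖²` in absolute value,
and `‖v‖² = 2 (e - U_s(x)) ≤ 2|e| + 2|C| (1 + ‖x‖²)`. -/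
theorem IsSurrogateSol.one_add_norm_sq_le (hUs : ContDiff ℝ 2 Us) {C : ℝ}
    (hC : ∀ x, -(C * (1 + ‖x‖ ^ 2)) ≤ Us x) {T : ℝ} (hT : 0 ≤ T) {γ : ℝ → Pos d × Pos d}
    (h : IsSurrogateSol Us T γ) :
    1 + ‖(γ T).1‖ ^ 2 ≤ (1 + ‖(γ 0).1‖ ^ 2) *
      Real.exp ((1 + 2 * |Us (γ 0).1 + ‖(γ 0).2‖ ^ 2 / 2| + 2 * |C|) * T) := by
  set e := Us (γ 0).1 + ‖(γ 0).2‖ ^ 2 / 2 with he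
  have hc : ContinuousOn (fun t => 1 + ‖(γ t).1‖ ^ 2) (Icc 0 T) :=
    continuousOn_const.add ((continuous_fst.comp_continuousOn h.continuousOn).norm.pow 2)
  have hd : ∀ t ∈ Ico 0 T, HasDerivWithinAt (fun t => 1 + ‖(γ t).1‖ ^ 2)
      (2 * ⟪(γ t).1, (γ t).2⟫) (Ici t) t := by
    intro t ht
    have h1 : HasDerivWithinAt (fun r => (γ r).1) (γ t).2 (Ici t) t :=
      HasFDerivAt.comp_hasDerivWithinAt (f := γ) t (hasFDerivAt_fst (𝕜 := ℝ))
        (h.hasDerivWithinAt_Ici ht)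
    exact h1.norm_sq.const_add 1
  have := norm_le_gronwallBound_of_norm_deriv_right_le hc hd (δ := 1 + ‖(γ 0).1‖ ^ 2)
    (K := 1 + 2 * |e| + 2 * |C|) (ε := 0)
    (Real.norm_of_nonneg (by positivity)).le (fun t ht => ?_) T ⟨hT, le_rfl⟩
  · rw [gronwallBound_ε0, Real.norm_of_nonneg (by positivity), sub_zero] at this
    exact this
  · have hen := h.energy_eq hUs (Ico_subset_Icc_self ht)
    rw [← he] at hen
    have h1 := hC (γ t).1
    have h2 : |⟪(γ t).1, (γ t).2⟫| ≤ ‖(γ t).1‖ * ‖(γ t).2‖ := abs_real_inner_le_norm _ _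
    have h3 : C * (1 + ‖(γ t).1‖ ^ 2) ≤ |C| * (1 + ‖(γ t).1‖ ^ 2) := by
      gcongr
      exact le_abs_self C
    have h4 : |e| ≤ |e| * (1 + ‖(γ t).1‖ ^ 2) :=
      le_mul_of_one_le_right (abs_nonneg _) (by linarith [sq_nonneg ‖(γ t).1‖])
    have h5 := two_mul_le_add_sq ‖(γ t).1‖ ‖(γ t).2‖
    rw [Real.norm_eq_abs, Real.norm_of_nonneg (by positivity), abs_mul, abs_two, add_zero]
    nlinarith [le_abs_self e]

/-- Bounces change neither position nor surrogate energy, so the exponential rate is the same on all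
arcs and the bound does not depend on their number. -/
theorem BouncyRun.one_add_norm_sq_le (hUs : ContDiff ℝ 2 Us) {C : ℝ}
    (hC : ∀ x, -(C * (1 + ‖x‖ ^ 2)) ≤ Us x) {T : ℝ} {z z' : BState d}
    (h : BouncyRun Us Ut T z z') :
    1 + ‖z'.1‖ ^ 2 ≤ (1 + ‖z.1‖ ^ 2) *
      Real.exp ((1 + 2 * |Us z.1 + ‖z.2.1‖ ^ 2 / 2| + 2 * |C|) * T) := by
  induction h with
  | flow γ nonneg sol init no_hit =>
    have := sol.one_add_norm_sq_le hUs hC nonneg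
    rwa [init] at this
  | @bounce T s x v p z' γ pos sol init no_hit hit grad_ne rest ih =>
    have h1 := sol.one_add_norm_sq_le hUs hC pos.le
    have h2 := sol.energy_eq hUs ⟨pos.le, le_rfl⟩
    rw [init] at h1 h2
    simp only [norm_reflectAgainst, h2] at ih
    refine ih.trans ?_
    set K := 1 + 2 * |Us x + ‖v‖ ^ 2 / 2| + 2 * |C|
    calc _ ≤ (1 + ‖x‖ ^ 2) * Real.exp (K * s) * Real.exp (K * (T - s)) := by gcongr
      _ = _ := by
        rw [mul_assoc, ← Real.exp_add]
        congr 2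
        ring

theorem mem_bouncyDomain_of_growth (hUs : ContDiff ℝ 2 Us) {C : ℝ}
    (hC : ∀ x, -(C * (1 + ‖x‖ ^ 2)) ≤ Us x) {T : ℝ} (hT : 0 ≤ T) {z : BState d}
    (hz : 0 < z.2.2) (hreg : ∀ n R : ℕ, z ∉ irregularSet Us Ut R n) :
    z ∈ bouncyDomain Us Ut T := by
  by_contra hzT
  set K := 1 + 2 * |Us z.1 + ‖z.2.1‖ ^ 2 / 2| + 2 * |C|
  set Q := (1 + ‖z.1‖ ^ 2) * Real.exp (K * T) with hQ
  have hQpos : 0 ≤ Q := by positivity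
  obtain ⟨t, ht, z', hrun, hlt⟩ := exists_run_norm_gt hUs hT hz hreg hzT (max 1 Q)
  have h1 := hrun.one_add_norm_sq_le hUs hC
  have h2 : (1 + ‖z.1‖ ^ 2) * Real.exp (K * t) ≤ Q := by
    have hK : 0 ≤ K := by positivity
    rw [hQ]
    gcongr
    exact ht.2.le
  have h3 := (le_max_left 1 Q).trans_lt hlt
  have h4 := (le_max_right 1 Q).trans_lt hlt
  nlinarith

theorem ae_regular (hUs : ContDiff ℝ 2 Us) (hUt : ContDiff ℝ 1 Ut) {T : ℝ} (hT : 0 ≤ T) :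
    ∀ᵐ z : BState d, z.2.2 ≠ 0 ∧ ∀ R : ℕ, z ∉ irregularSet Us Ut R T := by
  refine Filter.Eventually.and ?_ (ae_all_iff.2 fun R => ?_)
  · rw [ae_iff]
    simpa using volume_inertia_eq_zero (d := d)
  · rw [ae_iff]
    simpa using volume_irregularSet hUs hUt R.cast_nonneg hT

theorem ae_proposal_involutive (hUs : ContDiff ℝ 2 Us) (hUt : ContDiff ℝ 1 Ut) {T : ℝ}
    (hT : 0 ≤ T) : ∀ᵐ z : BState d, z ∈ bouncyDomain Us Ut T →
      bouncyProposal Us Ut T z ∈ bouncyDomain Us Ut T ∧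
      bouncyProposal Us Ut T (bouncyProposal Us Ut T z) = z := by
  filter_upwards [ae_regular hUs hUt hT] with z hz hzD
  obtain ⟨hz0, z', hrun⟩ := hzD
  have hpos : 0 < z.2.2 := lt_of_le_of_ne hz0 (Ne.symm hz.1)
  obtain ⟨w', hw', hlt, rfl⟩ := hrun.exists_goodRun_of_notMem hUs hpos hz.2
  have hrev := (hw'.reverse (potDiff_lt_toLevel hpos) hlt).toBouncyRun
  rw [← flipVel_stateAt, ← flipVel_stateAt, stateAt_toLevel] at hrev
  rw [bouncyProposal, hrun.map_eq hUs]
  refine ⟨⟨?_, _, hrev⟩, ?_⟩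
  · simpa [flipVel, stateAt] using hlt.le
  · rw [bouncyProposal, hrev.map_eq hUs, flipVel_flipVel]

/-- The states not exiting the ball of radius `R` increase to the whole domain up to zero inertia,
and on each of these sets the map agrees with a measurable approximation outside a set of volume
`η`. All of this works for outer measure, before the domain is known to be measurable. -/
theorem volume_bouncyDomain_inter_preimage_le (hUs : ContDiff ℝ 2 Us) (hUt : ContDiff ℝ 1 Ut)
    {T : ℝ} (hT : 0 ≤ T) (B : Set (BState d)) :
    volume (bouncyDomain Us Ut T ∩ bouncyMap Us Ut T ⁻¹' B) ≤ volume B := by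
  rw [← measure_toMeasurable B]
  refine (measure_mono (inter_subset_inter_right _
    (preimage_mono (subset_toMeasurable volume B)))).trans ?_
  have hBm : MeasurableSet (toMeasurable volume B) := measurableSet_toMeasurable _ _
  generalize toMeasurable volume B = B' at hBm ⊢
  set D : ℕ → Set (BState d) := fun R => {z | z ∈ bouncyDomain Us Ut T ∧ 0 < z.2.2 ∧
    ¬ExitsBy Us Ut R (toLevel Us Ut z).2 T (toLevel Us Ut z).1} with hD
  have hmono : Monotone fun R => D R ∩ bouncyMap Us Ut T ⁻¹' B' := by
    refine fun R S hRS => inter_subset_inter_left _ fun z hz => ⟨hz.1, hz.2.1, fun hex => hz.2.2 ?_⟩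
    obtain ⟨s, hs, w', hw', hout⟩ := hex
    have hRS' : (R : ℝ) ≤ S := by exact_mod_cast hRS
    exact ⟨s, hs, w', hw', hout.imp hRS'.trans hRS'.trans⟩
  have hcover : bouncyDomain Us Ut T ∩ bouncyMap Us Ut T ⁻¹' B' ⊆
      {z : BState d | z.2.2 = 0} ∪ ⋃ R, D R ∩ bouncyMap Us Ut T ⁻¹' B' := by
    rintro z ⟨hz, hzB⟩
    rcases hz.1.eq_or_lt with h0 | hpos
    · exact Or.inl h0.symm
    · obtain ⟨B, hB⟩ := hz.2.choose_spec.exists_notMem_exitsBy hUs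
      obtain ⟨R, hR⟩ := exists_nat_gt B
      exact Or.inr (mem_iUnion.2 ⟨R, ⟨hz, hpos, hB R hR⟩, hzB⟩)
  refine (measure_mono hcover).trans ((measure_union_le _ _).trans ?_)
  rw [volume_inertia_eq_zero, zero_add, hmono.measure_iUnion]
  refine iSup_le fun R => ENNReal.le_of_forall_pos_le_add fun η hη _ => ?_
  obtain ⟨C, A, Ψ, -, -, hA, hC, hCB, hall⟩ :=
    exists_measurable_approximation hUs hUt R.cast_nonneg hT (ENNReal.coe_pos.2 hη)
  calc volume (D R ∩ bouncyMap Us Ut T ⁻¹' B') ≤ volume (C ∩ Ψ ⁻¹' B' ∪ A) := by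
        refine measure_mono ?_
        rintro z ⟨hz, hzB⟩
        rcases hall z hz.2.1 with h | h | h
        · obtain ⟨-, w', hw', -, hΨ⟩ := hC z h
          have hrun := hw'.toBouncyRun
          rw [stateAt_toLevel] at hrun
          rw [mem_preimage, hrun.map_eq hUs, ← hΨ] at hzB
          exact Or.inl ⟨h, hzB⟩
        · exact Or.inr h
        · exact absurd h hz.2.2
    _ ≤ volume B' + η := (measure_union_le _ _).trans (add_le_add (hCB _ hBm) hA)

/-- The index is the pair `(R, m)` of ball radius and error `1 / (m + 1)`. A state of positive
inertia missed by every `C i` lies, for some `R`, in `A (R, m)` for all `m`. -/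
theorem exists_measurable_exhaustion (hUs : ContDiff ℝ 2 Us) (hUt : ContDiff ℝ 1 Ut)
    {T : ℝ} (hT : 0 ≤ T) :
    ∃ (C : ℕ × ℕ → Set (BState d)) (Ψ : ℕ × ℕ → BState d → BState d),
      (∀ i, MeasurableSet (C i)) ∧ (∀ i, Measurable (Ψ i)) ∧
      (∀ i, EqOn (bouncyMap Us Ut T) (Ψ i) (C i)) ∧
      (⋃ i, C i : Set (BState d)) =ᵐ[volume] bouncyDomain Us Ut T := by
  have hη : ∀ m : ℕ, (0 : ℝ≥0∞) < ((m : ℝ≥0∞) + 1)⁻¹ := fun m =>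
    ENNReal.inv_pos.2 (by finiteness)
  choose C A Ψ hCm hΨ hA hC _ hall using fun i : ℕ × ℕ =>
    exists_measurable_approximation (d := d) hUs hUt i.1.cast_nonneg hT (hη i.2)
  have hrun : ∀ i, ∀ z ∈ C i, BouncyRun Us Ut T z (Ψ i z) := fun i z hz => by
    obtain ⟨-, w', hw', -, hΨz⟩ := hC i z hz
    have := hw'.toBouncyRun
    rwa [stateAt_toLevel, ← hΨz] at this
  refine ⟨C, Ψ, hCm, hΨ, fun i z hz => (hrun i z hz).map_eq hUs, ?_⟩
  have hsub : (⋃ i, C i) ⊆ bouncyDomain Us Ut T := iUnion_subset fun i z hz =>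
    ⟨(hC i z hz).1.le, _, hrun i z hz⟩
  refine ae_eq_set.2 ⟨by rw [sdiff_eq_empty.2 hsub, measure_empty], ?_⟩
  have hcover : bouncyDomain Us Ut T \ ⋃ i, C i ⊆
      {z : BState d | z.2.2 = 0} ∪ ⋃ R : ℕ, ⋂ m : ℕ, A (R, m) := by
    rintro z ⟨hz, hzC⟩
    rcases hz.1.eq_or_lt with h0 | hpos
    · exact Or.inl h0.symm
    · obtain ⟨B, hB⟩ := hz.2.choose_spec.exists_notMem_exitsBy hUs
      obtain ⟨R, hR⟩ := exists_nat_gt B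
      refine Or.inr (mem_iUnion.2 ⟨R, mem_iInter.2 fun m => ?_⟩)
      rcases hall (R, m) z hpos with h | h | h
      · exact absurd (mem_iUnion.2 ⟨_, h⟩) hzC
      · exact h
      · exact absurd h (hB R hR)
  refine measure_mono_null hcover (measure_union_null volume_inertia_eq_zero
    (measure_iUnion_null fun R => ?_))
  have hlim : Tendsto (fun m : ℕ => ((m : ℝ≥0∞) + 1)⁻¹) atTop (𝓝 0) := by
    have := (tendsto_add_atTop_iff_nat 1).2 ENNReal.tendsto_inv_nat_nhds_zero
    simpa using this
  exact le_antisymm (ge_of_tendsto' hlim fun m =>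
    (measure_mono (iInter_subset _ m)).trans (hA (R, m))) bot_le

theorem nullMeasurableSet_bouncyDomain (hUs : ContDiff ℝ 2 Us) (hUt : ContDiff ℝ 1 Ut)
    {T : ℝ} (hT : 0 ≤ T) :
    NullMeasurableSet (bouncyDomain Us Ut T) (volume : Measure (BState d)) := by
  obtain ⟨C, Ψ, hC, -, -, hae⟩ := exists_measurable_exhaustion hUs hUt hT
  exact (MeasurableSet.iUnion hC).nullMeasurableSet.congr hae

theorem aemeasurable_bouncyMap (hUs : ContDiff ℝ 2 Us) (hUt : ContDiff ℝ 1 Ut)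
    {T : ℝ} (hT : 0 ≤ T) :
    AEMeasurable (bouncyMap Us Ut T) (volume.restrict (bouncyDomain Us Ut T)) := by
  obtain ⟨C, Ψ, hC, hΨ, heq, hae⟩ := exists_measurable_exhaustion hUs hUt hT
  rw [← Measure.restrict_congr_set hae, aemeasurable_iUnion_iff]
  intro i
  refine (hΨ i).aemeasurable.congr ?_
  filter_upwards [ae_restrict_mem (hC i)] with z hz using (heq i hz).symm

/-- Velocity flip as a measurable equivalence. -/
noncomputable def flipVelEquiv (d : ℕ) : BState d ≃ᵐ BState d where
  toFun := flipVel
  invFun := flipVel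
  left_inv := flipVel_flipVel
  right_inv := flipVel_flipVel
  measurable_toFun := by
    change Measurable fun z : BState d => (z.1, -z.2.1, z.2.2)
    fun_prop
  measurable_invFun := by
    change Measurable fun z : BState d => (z.1, -z.2.1, z.2.2)
    fun_prop

theorem measurePreserving_flipVelEquiv : MeasurePreserving (flipVelEquiv d) :=
  (MeasurePreserving.id volume).prod
    ((Measure.measurePreserving_neg volume).prod (MeasurePreserving.id volume))

theorem volume_flipVel_preimage (S : Set (BState d)) : volume (flipVel ⁻¹' S) = volume S :=
  measurePreserving_flipVelEquiv.measure_preimage_equiv S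

/-- Only an inequality is known for preimages, but the proposal is almost everywhere an involution
of the domain. Applying the inequality to `B` and to the flipped preimage of `B` gives both
directions. -/
theorem map_bouncyMap (hUs : ContDiff ℝ 2 Us) (hUt : ContDiff ℝ 1 Ut) {T : ℝ} (hT : 0 ≤ T) :
    Measure.map (bouncyMap Us Ut T) (volume.restrict (bouncyDomain Us Ut T)) =
      volume.restrict (flipVel ⁻¹' bouncyDomain Us Ut T) := by
  set D := bouncyDomain Us Ut T
  have hD : NullMeasurableSet D volume := nullMeasurableSet_bouncyDomain hUs hUt hT
  have hinv := ae_proposal_involutive hUs hUt hT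
  have hle := volume_bouncyDomain_inter_preimage_le (d := d) hUs hUt hT
  have hΨ := aemeasurable_bouncyMap hUs hUt hT
  ext B hB
  rw [Measure.map_apply_of_aemeasurable hΨ hB, Measure.restrict_apply₀' hD,
    Measure.restrict_apply hB]
  refine le_antisymm ?_ ?_
  · refine (measure_mono_ae ?_).trans (hle (B ∩ flipVel ⁻¹' D))
    filter_upwards [hinv] with z hz hmem
    exact ⟨hmem.2, hmem.1, (hz hmem.2).1⟩
  · have h1 : volume (B ∩ flipVel ⁻¹' D) = volume (D ∩ flipVel ⁻¹' B) := by
      rw [← volume_flipVel_preimage (D ∩ flipVel ⁻¹' B)]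
      congr 1
      ext z
      simp [and_comm]
    have h2 : volume (bouncyMap Us Ut T ⁻¹' B ∩ D) =
        volume (flipVel ⁻¹' (bouncyMap Us Ut T ⁻¹' B ∩ D)) := (volume_flipVel_preimage _).symm
    rw [h1, h2]
    refine (measure_mono_ae ?_).trans (hle _)
    filter_upwards [hinv] with u hu hmem
    obtain ⟨h3, h4⟩ := hu hmem.1
    refine ⟨hmem.1, ?_, h3⟩
    have h5 : bouncyMap Us Ut T (bouncyProposal Us Ut T u) = flipVel u := by
      rw [← flipVel_flipVel (bouncyMap Us Ut T (bouncyProposal Us Ut T u))]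
      exact congrArg flipVel h4
    change bouncyMap Us Ut T (bouncyProposal Us Ut T u) ∈ B
    rw [h5]
    exact hmem.2

theorem aemeasurable_bouncyProposal (hUs : ContDiff ℝ 2 Us) (hUt : ContDiff ℝ 1 Ut)
    {T : ℝ} (hT : 0 ≤ T) :
    AEMeasurable (bouncyProposal Us Ut T) (volume.restrict (bouncyDomain Us Ut T)) :=
  (flipVelEquiv d).measurable.comp_aemeasurable (aemeasurable_bouncyMap hUs hUt hT)

theorem map_bouncyProposal (hUs : ContDiff ℝ 2 Us) (hUt : ContDiff ℝ 1 Ut) {T : ℝ} (hT : 0 ≤ T) :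
    Measure.map (bouncyProposal Us Ut T) (volume.restrict (bouncyDomain Us Ut T)) =
      volume.restrict (bouncyDomain Us Ut T) := by
  have h1 := AEMeasurable.map_map_of_aemeasurable (g := flipVelEquiv d)
    (flipVelEquiv d).measurable.aemeasurable (aemeasurable_bouncyMap hUs hUt hT)
  rw [map_bouncyMap hUs hUt hT] at h1
  have h2 := (measurePreserving_flipVelEquiv (d := d)).restrict_preimage_emb
    (flipVelEquiv d).measurableEmbedding (bouncyDomain Us Ut T)
  exact h1.symm.trans h2.map_eq

theorem augTarget_inter (hUs : ContDiff ℝ 2 Us) (hUt : ContDiff ℝ 1 Ut) {T : ℝ} (hT : 0 ≤ T)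
    {A B : Set (BState d)} (hA : MeasurableSet A) (hB : MeasurableSet B) :
    augTarget Ut (bouncyDomain Us Ut T ∩ A ∩ bouncyProposal Us Ut T ⁻¹' B) =
      ∫⁻ z in bouncyDomain Us Ut T, A.indicator 1 z * B.indicator 1 (bouncyProposal Us Ut T z) *
        ENNReal.ofReal (Real.exp (-augEnergy Ut z)) := by
  set D := bouncyDomain Us Ut T
  have hD : NullMeasurableSet D volume := nullMeasurableSet_bouncyDomain hUs hUt hT
  have hPB : NullMeasurableSet (bouncyProposal Us Ut T ⁻¹' B ∩ D) volume := by
    rw [← nullMeasurableSet_restrict hD]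
    exact (aemeasurable_bouncyProposal hUs hUt hT).nullMeasurableSet_preimage hB
  have hS : NullMeasurableSet (D ∩ A ∩ bouncyProposal Us Ut T ⁻¹' B) volume := by
    have : D ∩ A ∩ bouncyProposal Us Ut T ⁻¹' B = A ∩ (bouncyProposal Us Ut T ⁻¹' B ∩ D) := by
      ext z
      simp only [mem_inter_iff]
      tauto
    rw [this]
    exact hA.nullMeasurableSet.inter hPB
  rw [augTarget, withDensity_apply', Measure.restrict_restrict_of_subset fun z hz => hz.1.1.1,
    ← lintegral_indicator₀ hS, ← lintegral_indicator₀ hD]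
  refine lintegral_congr fun z => ?_
  by_cases h1 : z ∈ D <;> by_cases h2 : z ∈ A <;> by_cases h3 : bouncyProposal Us Ut T z ∈ B <;>
    simp [indicator, h1, h2, h3]

/-- Substitute the proposal as integration variable: it preserves Lebesgue measure on the domain,
preserves the density, and exchanges the two indicators because it is an involution almost
everywhere. -/
theorem detailed_balance (hUs : ContDiff ℝ 2 Us) (hUt : ContDiff ℝ 1 Ut) {T : ℝ} (hT : 0 ≤ T)
    {A B : Set (BState d)} (hA : MeasurableSet A) (hB : MeasurableSet B) :
    augTarget Ut (bouncyDomain Us Ut T ∩ A ∩ bouncyProposal Us Ut T ⁻¹' B) =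
      augTarget Ut (bouncyDomain Us Ut T ∩ B ∩ bouncyProposal Us Ut T ⁻¹' A) := by
  rw [augTarget_inter hUs hUt hT hA hB, augTarget_inter hUs hUt hT hB hA]
  have hP := aemeasurable_bouncyProposal hUs hUt hT
  have hD := nullMeasurableSet_bouncyDomain hUs hUt hT
  have hρ : Measurable fun z : BState d => ENNReal.ofReal (Real.exp (-augEnergy Ut z)) := by
    have hc : Continuous fun z : BState d => augEnergy Ut z := by
      have := hUt.continuous
      unfold augEnergy
      fun_prop
    exact hc.measurable.neg.exp.ennreal_ofReal
  have hf : AEMeasurable (fun z => B.indicator 1 z * A.indicator 1 (bouncyProposal Us Ut T z) *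
      ENNReal.ofReal (Real.exp (-augEnergy Ut z)))
      (volume.restrict (bouncyDomain Us Ut T)) :=
    ((measurable_one.indicator hB).aemeasurable.mul
      ((measurable_one.indicator hA).comp_aemeasurable hP)).mul hρ.aemeasurable
  conv_rhs => rw [← map_bouncyProposal hUs hUt hT]
  rw [lintegral_map' (by rwa [map_bouncyProposal hUs hUt hT]) hP]
  refine lintegral_congr_ae ?_
  filter_upwards [ae_restrict_of_ae (ae_proposal_involutive hUs hUt hT), ae_restrict_mem₀ hD]
    with z hz hzD
  obtain ⟨hz0, z', hrun⟩ := hzD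
  have hen : augEnergy Ut (bouncyProposal Us Ut T z) = augEnergy Ut z := by
    rw [bouncyProposal, hrun.map_eq hUs, augEnergy_flipVel, hrun.augEnergy_eq hUs]
  rw [(hz ⟨hz0, z', hrun⟩).2, hen, mul_comm (A.indicator 1 z)]

end Main

theorem theorem1 (d : ℕ) (Us Ut : Pos d → ℝ)
    (hUs : ContDiff ℝ 2 Us) (hUt : ContDiff ℝ 1 Ut) :
    -- the dynamics are deterministic
    (∀ (T : ℝ) (z z₁ z₂ : BState d),
      BouncyRun Us Ut T z z₁ → BouncyRun Us Ut T z z₂ → z₁ = z₂) ∧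
    -- one null set of initial conditions, the same for all durations
    (∃ N : Set (BState d), volume N = 0 ∧
      ∀ z : BState d, z ∉ N → 0 ≤ z.2.2 →
        -- existence: the dynamics can end only by the position escaping to infinity
        (∀ T : ℝ, 0 ≤ T → z ∉ bouncyDomain Us Ut T →
          ∀ R : ℝ, ∃ t ∈ Ico 0 T, ∃ z', BouncyRun Us Ut t z z' ∧ R < ‖z'.1‖) ∧
        -- global existence when `U_s` decreases at most quadratically
        ((∃ C : ℝ, ∀ x, -(C * (1 + ‖x‖ ^ 2)) ≤ Us x) →
          ∀ T : ℝ, 0 ≤ T → z ∈ bouncyDomain Us Ut T) ∧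
        (∀ (T : ℝ) (z' : BState d), BouncyRun Us Ut T z z' →
          0 ≤ z'.2.2 ∧
          -- conservation of the augmented energy
          augEnergy Ut z' = augEnergy Ut z ∧
          -- time-reversibility, at all times but the finitely many bounce instants
          (z'.2.2 ≠ 0 → BouncyRun Us Ut T (flipVel z') (flipVel z)) ∧
          {t ∈ Icc 0 T | ∃ w, BouncyRun Us Ut t z w ∧ w.2.2 = 0}.Finite ∧
          -- the proposal is accepted with Metropolis probability one
          min 1 (Real.exp (-augEnergy Ut (bouncyProposal Us Ut T z)) /
            Real.exp (-augEnergy Ut z)) = 1)) ∧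
    (∀ T : ℝ, 0 ≤ T →
      -- time-reversibility of the time-`T` map
      (∀ᵐ z : BState d, z ∈ bouncyDomain Us Ut T →
        bouncyProposal Us Ut T z ∈ bouncyDomain Us Ut T ∧
        bouncyProposal Us Ut T (bouncyProposal Us Ut T z) = z) ∧
      -- volume preservation
      NullMeasurableSet (bouncyDomain Us Ut T) (volume : Measure (BState d)) ∧
      AEMeasurable (bouncyMap Us Ut T) (volume.restrict (bouncyDomain Us Ut T)) ∧
      Measure.map (bouncyMap Us Ut T) (volume.restrict (bouncyDomain Us Ut T)) =
        volume.restrict (flipVel ⁻¹' bouncyDomain Us Ut T) ∧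
      -- detailed balance of the proposal with respect to the target
      ∀ A B : Set (BState d), MeasurableSet A → MeasurableSet B →
        augTarget Ut (bouncyDomain Us Ut T ∩ A ∩ bouncyProposal Us Ut T ⁻¹' B) =
          augTarget Ut (bouncyDomain Us Ut T ∩ B ∩ bouncyProposal Us Ut T ⁻¹' A)) := by
  have hD := contDiff_potDiff hUs hUt
  refine ⟨fun T z z₁ z₂ h₁ h₂ => h₁.deterministic hUs h₂,
    -- Integer times and radii keep the union countable and still cover all `T`, since good runs can
    -- be cut short.
    ⟨{z | z.2.2 = 0} ∪ ⋃ (n : ℕ) (R : ℕ), irregularSet Us Ut R n, ?_, fun z hzN hz0 => ?_⟩,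
    fun T hT => ⟨ae_proposal_involutive hUs hUt hT, nullMeasurableSet_bouncyDomain hUs hUt hT,
      aemeasurable_bouncyMap hUs hUt hT, map_bouncyMap hUs hUt hT,
      fun A B hA hB => detailed_balance hUs hUt hT hA hB⟩⟩
  · exact measure_union_null volume_inertia_eq_zero (measure_iUnion_null fun n =>
      measure_iUnion_null fun R => volume_irregularSet hUs hUt R.cast_nonneg n.cast_nonneg)
  have hz : 0 < z.2.2 := lt_of_le_of_ne hz0 fun h => hzN (Or.inl h.symm)
  have hreg : ∀ n R : ℕ, z ∉ irregularSet Us Ut R n := fun n R h =>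
    hzN (Or.inr (mem_iUnion.2 ⟨n, mem_iUnion.2 ⟨R, h⟩⟩))
  refine ⟨fun T hT hzT R => exists_run_norm_gt hUs hT hz hreg hzT R,
    fun ⟨C, hC⟩ T hT => mem_bouncyDomain_of_growth hUs hC hT hz hreg, fun T z' hrun => ?_⟩
  have hen := hrun.augEnergy_eq hUs
  obtain ⟨w', hw', rfl⟩ := hrun.exists_goodRun hUs hz hreg
  have hlt := potDiff_lt_toLevel (Us := Us) (Ut := Ut) hz
  have hle := hw'.le_level hlt.le
  refine ⟨by simpa [stateAt] using hle, hen, fun hne => ?_, ?_, ?_⟩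
  · have hne' : potDiff Us Ut w'.1 ≠ (toLevel Us Ut z).2 := fun h => hne (by simp [stateAt, h])
    have := (hw'.reverse hlt (lt_of_le_of_ne hle hne')).toBouncyRun
    rwa [← flipVel_stateAt, ← flipVel_stateAt, stateAt_toLevel] at this
  · obtain ⟨Z, hZ, hsub⟩ := hw'.exists_subruns
    refine hZ.subset ?_
    rintro t ⟨ht, w, hw, hw0⟩
    by_contra htZ
    obtain ⟨u, hu, hu'⟩ := hsub t ht
    have h2 := hu.toBouncyRun
    rw [stateAt_toLevel] at h2
    rw [hw.deterministic hUs h2] at hw0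
    simp only [stateAt] at hw0
    linarith [hu' htZ]
  · rw [bouncyProposal, hrun.map_eq hUs, augEnergy_flipVel, hen, div_self (Real.exp_ne_zero _),
      min_self]
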